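/- Let $M$ be a developable surface of class $C^3$ in $\mathbb{R}^3$ (every point has a neighbourhood that is the image of a planar domain under a $C^3$ isometry; self-intersections in space are allowed), oriented by a unit normal field $n$, all of whose points are parabolic (exactly one of the two principal curvatures vanishes). For an arc-length parametrized curve $\gamma$ on a surface with unit normal $n$ put $T=\gamma'$, $u=n\times T$, and let $k_g=\langle T',u\rangle$, $k_n=\langle T',n\rangle$, $\tau_r=\langle u',n\rangle$ be its geodesic curvature, normal curvature and relative torsion. Let $\gamma_1$ (of class $C^3$) and $\gamma_2$ (of class $C^4$) be arc-length parametrized curves on $M$ over open intervals $I_1,I_2$ that do not meet, with nowhere vanishing geodesic and normal curvatures $k_{1,g},k_{1,n},k_{2,g},k_{2,n}$, and let $\tau_{1,r},\tau_{2,r}$ be their relative torsions, all with respect to $M$. Assume that there is a continuous bijection $s_2:I_1\to I_2$ such that $\gamma_2(s_2(s_1))$ is the first point of $\gamma_2$ on a ruling (straight segment contained in $M$) emanating from $\gamma_1(s_1)$. A foldline is an arc-length parametrized plane curve $\bar\gamma$ of class $C^4$. A proper fold along $\bar\gamma:J\to\mathbb{R}^2$ onto $\gamma_2|_J$ is a map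 $F$ into $\mathbb{R}^3$ from an open neighbourhood of $\bar\gamma(J)$ that the foldline divides into two sides, such that $F\circ\bar\gamma=\gamma_2$, $F$ is on each side a $C^2$ isometric immersion up to the foldline, $F$ is not differentiable at any point of the foldline, and the curvatures satisfy $0<|k_{\bar\gamma}|<\|\gamma_2''\|$. It is consistent with $M$ on one of the sides if $F$ lays this side onto $M$ (that is, $F$ lifts there to a continuous map into $M$ taking $\bar\gamma$ to $\gamma_2$). Then $s_2$ is of class $C^2$ with $s_2'\neq 0$, the functions $k_{1,n}$, $\tau_{1,r}$ and $k_{2,g}\circ s_2$ are differentiable, and there is a foldline over $I_2$ with signed curvature $k_{2,g}$. Moreover let $J\subseteq I_2$ be an open interval and $\bar\gamma$ a foldline over $J$ with signed curvature $k_{2,g}$ that is a topological embedding, and choose either side of $\bar\gamma$ (for example the one on which $\gamma_1$ lies). Then there is a proper fold along $\bar\gamma$ onto $\gamma_2|_J$ that is consistent with $M$ on the chosen side, and it is unique: any two such folds coincide in a neighbourhood of $\bar\gamma(J)$. At every $s_1\in I_1$ with $s_2(s_1)\in J$, the normal along $\gamma_2$ of the new developable (the image of the other side) is differentiable, and the normal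 curvature $k^{\mathrm{new}}_{2,n}$ and relative torsion $\tau^{\mathrm{new}}_{2,r}$ of $\gamma_2$ with respect to the new developable are $$k^{\mathrm{new}}_{2,n}=-k_{2,n},$$ $$\tau^{\mathrm{new}}_{2,r}=\tau_{2,r}-\frac{2}{(s_2')^2\left(k_{2,n}^2+k_{2,g}^2\right)}\Big(s_2''\,k_{2,n}k_{2,g}+s_2'\big(k_{2,n}k_{2,g}'-\tau_{2,r}k_{2,g}(s_2'k_{2,g}-k_{1,g})\big)-k_{2,g}\big(\cos(\beta_1-\beta_2)k_{1,n}'+\sin(\beta_1-\beta_2)\tau_{1,r}'\big)\Big).$$ Here the quantities of $\gamma_1$ are taken at $s_1$, those of $\gamma_2$ at $s_2(s_1)$, all primes denote derivatives with respect to $s_1$ (so $k_{2,g}'$ is the derivative of $k_{2,g}\circ s_2$), and $\beta_i$ is the angle from $\gamma_i'$ to a unit vector $r$ along the ruling through the two corresponding points (the same $r$ for $i=1,2$), measured anticlockwise with respect to $n$. -/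

import Mathlib

open Set Filter Topology

namespace CurvedFolding

/-- The plane (the unfolded sheet of paper). -/
abbrev E2 : Type := EuclideanSpace ℝ (Fin 2)

/-- Euclidean space. -/
abbrev E3 : Type := EuclideanSpace ℝ (Fin 3)

noncomputable section

/-- The vector product of space. -/
def cross (a b : E3) : E3 := WithLp.toLp 2 (crossProduct a.ofLp b.ofLp)

/-- Anticlockwise rotation of the plane by a right angle. -/
def rot (v : E2) : E2 := !₂[-(v 1), v 0]

/-! ### Surfaces isometric to planar domains -/

/-- `F` is a `C^h` isometric immersion of the planar set `S`: of class `C^h` on `S`, with a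
differential that preserves lengths. `S` is either open or an open set together with an arc of
its boundary; in the second case the derivatives are the one-sided ones (`C^h` up to the arc). -/
def IsometricImmersionOn (h : WithTop ℕ∞) (F : E2 → E3) (S : Set E2) : Prop :=
  ContDiffOn ℝ h F S ∧ ∀ x ∈ S, ∀ v : E2, ‖fderivWithin ℝ F S x v‖ = ‖v‖

/-- The unit normal `F_x × F_y` of an isometrically immersed planar set. -/
def unitNormal (F : E2 → E3) (S : Set E2) (x : E2) : E3 :=
  cross (fderivWithin ℝ F S x !₂[1, 0]) (fderivWithin ℝ F S x !₂[0, 1])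

variable {X : Type*} [TopologicalSpace X]

/-- A `C^h` planar chart of a surface `X` placed in space by `pos` and oriented by the unit normal
field `normal`: the map `pos ∘ φ` is an isometric immersion of a planar domain, and the chart is
positively oriented. -/
def IsPlanarChart (h : WithTop ℕ∞) (pos normal : X → E3) (φ : OpenPartialHomeomorph E2 X) : Prop :=
  IsometricImmersionOn h (pos ∘ φ) φ.source ∧
    ∀ x ∈ φ.source, normal (φ x) = unitNormal (pos ∘ φ) φ.source x

/-- `X` is a `C^h` developable surface, placed in space by `pos` and oriented by the unit normal
field `normal`: near every point it is the image of a planar domain by a `C^h` isometry.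
A surface `X ⊆ ℝ³` is the case where `pos` is the inclusion; in general self-intersections in
space are allowed. -/
def IsDevelopable (h : WithTop ℕ∞) (pos normal : X → E3) : Prop :=
  ∀ p : X, ∃ φ : OpenPartialHomeomorph E2 X, p ∈ φ.target ∧ IsPlanarChart h pos normal φ

/-- The normal curvatures, in all unit tangent directions, of an isometrically immersed planar
open set at a point. -/
def normalCurvaturesAt (F : E2 → E3) (S : Set E2) (x : E2) : Set ℝ :=
  {κ | ∃ v : E2, ‖v‖ = 1 ∧ κ = inner ℝ (fderiv ℝ (fderiv ℝ F) x v v) (unitNormal F S x)}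

/-- A parabolic point: of the two principal curvatures (the greatest and the least normal
curvature) exactly one is zero. -/
def IsParabolicAt (pos normal : X → E3) (p : X) : Prop :=
  ∀ φ : OpenPartialHomeomorph E2 X, p ∈ φ.target → IsPlanarChart 2 pos normal φ →
    ∃ k₁ k₂ : ℝ,
      IsGreatest (normalCurvaturesAt (pos ∘ φ) φ.source (φ.symm p)) k₁ ∧
      IsLeast (normalCurvaturesAt (pos ∘ φ) φ.source (φ.symm p)) k₂ ∧
      ((k₁ ≠ 0 ∧ k₂ = 0) ∨ (k₁ = 0 ∧ k₂ ≠ 0))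

/-! ### Curves on surfaces -/

/-- `γ` is an arc-length parametrized `C^h` curve on the surface, over the open interval `I`. -/
structure IsCurveOn (h : WithTop ℕ∞) (pos : X → E3) (γ : ℝ → X) (I : Set ℝ) : Prop where
  isOpen : IsOpen I
  ordConnected : I.OrdConnected
  continuousOn : ContinuousOn γ I
  contDiffOn : ContDiffOn ℝ h (pos ∘ γ) I
  unit_speed : ∀ s ∈ I, ‖deriv (pos ∘ γ) s‖ = 1

/-- The vector `u = n × T` of the Darboux frame `{T, u, n}` of a space curve `c` that lies on a
surface with unit normal `ν s` at `c s`. -/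
def conormal (c ν : ℝ → E3) (s : ℝ) : E3 := cross (ν s) (deriv c s)

/-- Geodesic curvature: `k_g = ⟨T', u⟩`. -/
def geodesicCurvature (c ν : ℝ → E3) (s : ℝ) : ℝ :=
  inner ℝ (deriv (deriv c) s) (conormal c ν s)

/-- Normal curvature: `k_n = ⟨T', n⟩`. -/
def normalCurvature (c ν : ℝ → E3) (s : ℝ) : ℝ :=
  inner ℝ (deriv (deriv c) s) (ν s)

/-- Relative torsion: `τ_r = ⟨u', n⟩`. -/
def relativeTorsion (c ν : ℝ → E3) (s : ℝ) : ℝ :=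
  inner ℝ (deriv (conormal c ν) s) (ν s)

/-- `σ` runs from `p` to `q` along a ruling: it is a path in the surface whose image in space is
the (nondegenerate) straight segment from `p` to `q`. On a surface with parabolic points only,
the straight segments in the surface are exactly the segments of its rulings. -/
structure IsRulingSegment (pos : X → E3) (σ : ℝ → X) (p q : X) : Prop where
  continuousOn : ContinuousOn σ (Icc 0 1)
  source : σ 0 = p
  target : σ 1 = q
  ne : pos p ≠ pos q
  straight : ∀ t ∈ Icc (0 : ℝ) 1, pos (σ t) = pos p + t • (pos q - pos p)

/-- The two curves do not meet and `γ₁ s ↔ γ₂ (s₂ s)` is a (continuous) bijection between them,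
`γ₂ (s₂ s)` being the first point of `γ₂` on a ruling emanating from `γ₁ s`. -/
structure LinkedByRulings (pos : X → E3) (γ₁ γ₂ : ℝ → X) (I₁ I₂ : Set ℝ) (s₂ : ℝ → ℝ) : Prop where
  disjoint : Disjoint (γ₁ '' I₁) (γ₂ '' I₂)
  bijOn : BijOn s₂ I₁ I₂
  continuousOn : ContinuousOn s₂ I₁
  ruling : ∀ s ∈ I₁, ∃ σ : ℝ → X, IsRulingSegment pos σ (γ₁ s) (γ₂ (s₂ s)) ∧
    ∀ t ∈ Ico (0 : ℝ) 1, σ t ∉ γ₂ '' I₂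

/-- In the oriented plane with orthonormal basis `T, u`, the angle from `T` to the unit vector `r`,
measured anticlockwise, is `β` (modulo `2π`). -/
def IsAngle (T u r : E3) (β : ℝ) : Prop := r = Real.cos β • T + Real.sin β • u

/-! ### Proper folds -/

/-- Signed curvature of an arc-length parametrized plane curve. -/
def planarCurvature (g : ℝ → E2) (s : ℝ) : ℝ :=
  inner ℝ (deriv (deriv g) s) (rot (deriv g s))

/-- `g` is a foldline over `J` with signed curvature `κ`: an arc-length parametrized plane curve
of class `C^4`. -/
structure IsFoldline (g : ℝ → E2) (J : Set ℝ) (κ : ℝ → ℝ) : Prop where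
  contDiffOn : ContDiffOn ℝ 4 g J
  unit_speed : ∀ s ∈ J, ‖deriv g s‖ = 1
  curvature : ∀ s ∈ J, planarCurvature g s = κ s

/-- `F` is a proper fold along the foldline `g` (over `J`) onto the ridge `c`. The folded sheet of
paper is the open set `A ∪ g '' J ∪ B`, which the foldline cuts into its two sides `A` and `B`;
`A` is the left-hand side of the foldline if `ε = 1` and its right-hand side if `ε = -1`.
On each side `F` is a `C²` isometric immersion up to the foldline, the two pieces meet along the
ridge with `C⁰` regularity and not more, and the curvatures of foldline and ridge satisfy
`k > |k_g| > 0`. -/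
structure IsProperFold (g : ℝ → E2) (c : ℝ → E3) (J : Set ℝ) (ε : ℝ) (A B : Set E2)
    (F : E2 → E3) : Prop where
  isOpen_A : IsOpen A
  isOpen_B : IsOpen B
  isOpen_sheet : IsOpen (A ∪ g '' J ∪ B)
  disjoint : Disjoint A B
  disjoint_A : Disjoint A (g '' J)
  disjoint_B : Disjoint B (g '' J)
  sides : ∀ s ∈ J, ∀ᶠ t in 𝓝[>] (0 : ℝ),
    g s + (ε * t) • rot (deriv g s) ∈ A ∧ g s - (ε * t) • rot (deriv g s) ∈ B
  onto : ∀ s ∈ J, F (g s) = c s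
  isometric_A : IsometricImmersionOn 2 F (A ∪ g '' J)
  isometric_B : IsometricImmersionOn 2 F (B ∪ g '' J)
  crease : ∀ s ∈ J, ¬ DifferentiableAt ℝ F (g s)
  proper : ∀ s ∈ J, 0 < |planarCurvature g s| ∧ |planarCurvature g s| < ‖deriv (deriv c) s‖

/-- The fold `F` is consistent with the surface `X` on the side `A` of the foldline: this side of
the sheet is laid onto `X`, with the foldline going to the curve `γ`. -/
def IsConsistent (pos : X → E3) (γ : ℝ → X) (g : ℝ → E2) (J : Set ℝ) (A : Set E2)
    (F : E2 → E3) : Prop :=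
  ∃ ψ : E2 → X, ContinuousOn ψ (A ∪ g '' J) ∧ (∀ s ∈ J, ψ (g s) = γ s) ∧
    ∀ x ∈ A ∪ g '' J, F x = pos (ψ x)

/-- The unit normal, along the ridge, of the piece of the folded sheet on the side `B`. -/
def ridgeNormal (g : ℝ → E2) (J : Set ℝ) (B : Set E2) (F : E2 → E3) (s : ℝ) : E3 :=
  unitNormal F (B ∪ g '' J) (g s)

end

end CurvedFolding

open CurvedFolding

/-!
The whole theorem rests on two facts about `C²` isometric immersions `F` of planar sets. Their
second fundamental form is degenerate (the Gauss equation, `IsometricImmersionOn.gauss`), although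
`F` need not have third derivatives; and `F` is determined near a plane curve `g` by its first
derivatives along `g` wherever the normal curvature of the image of `g` is not zero
(`IsRidgeFrame.eventually_eq_ruledStrip` on an open set, `IsSheet.eventually_eq_ruledStrip` on one
side of `g`): near `g`, the image is the ruled strip whose rulings are the kernel directions of the
second fundamental form along the curve. Conversely, a space curve `c` with a unit normal field `n`
of nonzero normal curvature lies on exactly one such strip
(`IsRidgeData.isRidgeFrame`, `IsRulingDomain.isometricImmersionOn_stripMap`).

*The fold.* Let `c` be the second curve and `n` the normal of the surface. A side of a fold along
`g` has along the ridge a unit normal `ν ⟂ c'` for which the geodesic curvature `⟨c'', ν × c'⟩` is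
the curvature of `g`, that is, `⟨c'', n × c'⟩`. There are two solutions, `n` and its mirror
image in the osculating plane, up to sign (`foldedNormal`, `eq_or_eq_foldedConormal`). The side
laid onto the surface is tangent to it, so that it takes `n`; as the fold is not differentiable, the
other side takes the mirror image. Each side is thus a known strip, which gives uniqueness
(`IsFoldData.eventually_eq`); the two strips put together form the fold
(`IsFoldData.exists_fold`). The first strip lifts to the surface, because it does so in planar
charts and local lifts fit together (`IsCurveOn.exists_lift`).

*The curvatures.* The normal of the surface is constant along rulings
(`IsDevelopable.normal_eq_of_isRulingSegment`), hence `n₁ = n₂ ∘ s₂`. As `n₂' ≠ 0`, this makes `s₂`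
of class `C²`, and `n₁' ≠ 0` gives `s₂' ≠ 0`. Its derivative says that
`k₁ₙ T₁ + τ₁ u₁ = s₂' (k₂ₙ T₂ + τ₂ u₂)`; differentiating the component of this equation along `T₂`
expresses the derivative of `k₂ₙ` by the other quantities
(`IsNormalLink.deriv_normalCurvature`). Going over to the mirror image changes the sign of the
normal curvature and adds to the relative torsion the derivative of twice the angle between the
conormal and the principal normal, `2 (k_g k_n' - k_n k_g') / (k_g² + k_n²)`
(`relativeTorsion_foldedNormal`); the formula follows.
-/

namespace CurvedFolding

open scoped RealInnerProductSpace ContDiff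

/-! ### The vector product and orthonormal frames -/

section Algebra

lemma inner_eq_three (a b : E3) : ⟪a, b⟫ = a 0 * b 0 + a 1 * b 1 + a 2 * b 2 := by
  simp [PiLp.inner_apply, Fin.sum_univ_three]; ring

lemma inner_eq_two (a b : E2) : ⟪a, b⟫ = a 0 * b 0 + a 1 * b 1 := by
  simp [PiLp.inner_apply, Fin.sum_univ_two]; ring

lemma cross_zero (a b : E3) : cross a b 0 = a 1 * b 2 - a 2 * b 1 := by
  simp [cross, cross_apply]

lemma cross_one (a b : E3) : cross a b 1 = a 2 * b 0 - a 0 * b 2 := by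
  simp [cross, cross_apply]

lemma cross_two (a b : E3) : cross a b 2 = a 0 * b 1 - a 1 * b 0 := by
  simp [cross, cross_apply]

lemma E3.ext {a b : E3} (h0 : a 0 = b 0) (h1 : a 1 = b 1) (h2 : a 2 = b 2) : a = b := by
  ext i; fin_cases i <;> assumption

lemma E2.ext {a b : E2} (h0 : a 0 = b 0) (h1 : a 1 = b 1) : a = b := by
  ext i; fin_cases i <;> assumption

/-- The vector product as a continuous bilinear map. -/
noncomputable def crossL : E3 →L[ℝ] E3 →L[ℝ] E3 :=
  LinearMap.toContinuousBilinearMap <| LinearMap.mk₂ ℝ cross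
    (fun a b c => by apply E3.ext <;> simp [cross_zero, cross_one, cross_two] <;> ring)
    (fun r a b => by apply E3.ext <;> simp [cross_zero, cross_one, cross_two] <;> ring)
    (fun a b c => by apply E3.ext <;> simp [cross_zero, cross_one, cross_two] <;> ring)
    (fun r a b => by apply E3.ext <;> simp [cross_zero, cross_one, cross_two] <;> ring)

@[simp] lemma crossL_apply (a b : E3) : crossL a b = cross a b := rfl

lemma inner_cross_left (a b : E3) : ⟪a, cross a b⟫ = 0 := by
  rw [inner_eq_three, cross_zero, cross_one, cross_two]; ring

lemma inner_cross_right (a b : E3) : ⟪b, cross a b⟫ = 0 := by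
  rw [inner_eq_three, cross_zero, cross_one, cross_two]; ring

lemma norm_cross_sq (a b : E3) : ‖cross a b‖ ^ 2 = ‖a‖ ^ 2 * ‖b‖ ^ 2 - ⟪a, b⟫ ^ 2 := by
  simp only [← real_inner_self_eq_norm_sq, inner_eq_three, cross_zero, cross_one, cross_two]; ring

lemma cross_cross (a b c : E3) : cross (cross a b) c = ⟪a, c⟫ • b - ⟪b, c⟫ • a := by
  apply E3.ext <;> simp [cross_zero, cross_one, cross_two, inner_eq_three] <;> ring

/-- An orthonormal triple of vectors of space. -/
structure IsONFrame (T u n : E3) : Prop where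
  TT : ⟪T, T⟫ = 1
  uu : ⟪u, u⟫ = 1
  nn : ⟪n, n⟫ = 1
  Tu : ⟪T, u⟫ = 0
  Tn : ⟪T, n⟫ = 0
  un : ⟪u, n⟫ = 0

lemma IsONFrame.expand {T u n : E3} (h : IsONFrame T u n) (v : E3) :
    v = ⟪v, T⟫ • T + ⟪v, u⟫ • u + ⟪v, n⟫ • n := by
  have hon : Orthonormal ℝ ![T, u, n] := by
    rw [orthonormal_iff_ite]
    intro i j
    have := h.TT; have := h.uu; have := h.nn; have := h.Tu; have := h.Tn; have := h.un
    fin_cases i <;> fin_cases j <;> simp_all [real_inner_comm]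
  have hcard : Fintype.card (Fin 3) = Module.finrank ℝ E3 := by simp
  let b := basisOfOrthonormalOfCardEqFinrank hon hcard
  have hb : ⇑b = ![T, u, n] := coe_basisOfOrthonormalOfCardEqFinrank hon hcard
  let ob := b.toOrthonormalBasis (by rw [hb]; exact hon)
  have hob : ⇑ob = ![T, u, n] := by simp [ob, hb]
  have := ob.sum_repr v
  simp only [Fin.sum_univ_three, ob.repr_apply_apply, hob] at this
  simpa [real_inner_comm] using this.symm

lemma IsONFrame.inner_eq {T u n : E3} (h : IsONFrame T u n) (v w : E3) :
    ⟪v, w⟫ = ⟪v, T⟫ * ⟪w, T⟫ + ⟪v, u⟫ * ⟪w, u⟫ + ⟪v, n⟫ * ⟪w, n⟫ := by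
  conv_lhs => rw [h.expand w]
  simp only [inner_add_right, inner_smul_right]; ring

/-- The Darboux frame `T`, `n × T`, `n`. -/
lemma isONFrame_cross {T n : E3} (hT : ⟪T, T⟫ = 1) (hn : ⟪n, n⟫ = 1) (hTn : ⟪T, n⟫ = 0) :
    IsONFrame T (cross n T) n := by
  refine ⟨hT, ?_, hn, inner_cross_right _ _, hTn, ?_⟩
  · rw [real_inner_self_eq_norm_sq, norm_cross_sq, ← real_inner_self_eq_norm_sq,
      ← real_inner_self_eq_norm_sq, hT, hn, real_inner_comm, hTn]; norm_num
  · rw [real_inner_comm]; exact inner_cross_left _ _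

lemma IsONFrame.eq_of_inner {T u n v w : E3} (h : IsONFrame T u n) (h1 : ⟪v, T⟫ = ⟪w, T⟫)
    (h2 : ⟪v, u⟫ = ⟪w, u⟫) (h3 : ⟪v, n⟫ = ⟪w, n⟫) : v = w := by
  rw [h.expand v, h.expand w, h1, h2, h3]

@[simp] lemma rot_apply_zero (v : E2) : rot v 0 = - v 1 := by simp [rot]

@[simp] lemma rot_apply_one (v : E2) : rot v 1 = v 0 := by simp [rot]

/-- The rotation by a right angle as a continuous linear map. -/
noncomputable def rotL : E2 →L[ℝ] E2 :=
  LinearMap.toContinuousLinearMap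
    { toFun := rot
      map_add' := fun a b => by apply E2.ext <;> (simp <;> ring)
      map_smul' := fun r a => by apply E2.ext <;> simp }

@[simp] lemma rotL_apply (v : E2) : rotL v = rot v := rfl

@[simp] lemma inner_rot_self (v : E2) : ⟪rot v, v⟫ = 0 := by
  rw [inner_eq_two]; simp; ring

@[simp] lemma inner_self_rot (v : E2) : ⟪v, rot v⟫ = 0 := by
  rw [real_inner_comm, inner_rot_self]

@[simp] lemma inner_rot_rot (v w : E2) : ⟪rot v, rot w⟫ = ⟪v, w⟫ := by
  rw [inner_eq_two, inner_eq_two]; simp; ring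

@[simp] lemma rot_rot (v : E2) : rot (rot v) = - v := by
  apply E2.ext <;> simp

@[simp] lemma norm_rot (v : E2) : ‖rot v‖ = ‖v‖ := by
  have h := inner_rot_rot v v
  rw [real_inner_self_eq_norm_sq, real_inner_self_eq_norm_sq] at h
  exact (sq_eq_sq₀ (norm_nonneg _) (norm_nonneg _)).1 h

lemma expand_rot {v : E2} (hv : ‖v‖ = 1) (w : E2) : w = ⟪w, v⟫ • v + ⟪w, rot v⟫ • rot v := by
  have h : v 0 * v 0 + v 1 * v 1 = 1 := by
    rw [← inner_eq_two, real_inner_self_eq_norm_sq, hv]; norm_num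
  apply E2.ext
  · simp [inner_eq_two]; linear_combination (-w 0) * h
  · simp [inner_eq_two]; linear_combination (-w 1) * h

lemma exists_smul_of_inner_rot {v : E2} (hv : v ≠ 0) {w : E2} (h : ⟪w, rot v⟫ = 0) :
    ∃ c : ℝ, w = c • v := by
  have hn : v 0 * v 0 + v 1 * v 1 ≠ 0 := by
    rw [← inner_eq_two]; exact inner_self_ne_zero.2 hv
  rw [inner_eq_two] at h
  simp only [rot_apply_zero, rot_apply_one] at h
  refine ⟨(w 0 * v 0 + w 1 * v 1) / (v 0 * v 0 + v 1 * v 1), ?_⟩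
  apply E2.ext
  · rw [PiLp.smul_apply, smul_eq_mul, div_mul_eq_mul_div, eq_div_iff hn]
    linear_combination (-v 1) * h
  · rw [PiLp.smul_apply, smul_eq_mul, div_mul_eq_mul_div, eq_div_iff hn]
    linear_combination (v 0) * h

/-- A length-preserving linear map preserves inner products. -/
lemma inner_map_of_norm {L : E2 →L[ℝ] E3} (hL : ∀ v, ‖L v‖ = ‖v‖) (v w : E2) :
    ⟪L v, L w⟫ = ⟪v, w⟫ :=
  (⟨L.toLinearMap, hL⟩ : E2 →ₗᵢ[ℝ] E3).inner_map_map v w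

lemma basis_eq (v : E2) : v = v 0 • (!₂[1, 0] : E2) + v 1 • (!₂[0, 1] : E2) := by
  apply E2.ext <;> simp

/-- The product `L e₁ × L e₂` can be computed in any positively oriented orthonormal basis. -/
lemma cross_map_rot (L : E2 →L[ℝ] E3) {v : E2} (hv : ‖v‖ = 1) :
    cross (L v) (L (rot v)) = cross (L !₂[1, 0]) (L !₂[0, 1]) := by
  have h : v 0 * v 0 + v 1 * v 1 = 1 := by
    rw [← inner_eq_two, real_inner_self_eq_norm_sq, hv]; norm_num
  rw [basis_eq (rot v), basis_eq v]
  simp only [map_add, map_smul]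
  generalize L !₂[1, 0] = a
  generalize L !₂[0, 1] = b
  apply E3.ext <;> simp [cross_zero, cross_one, cross_two]
  · linear_combination (a 1 * b 2 - a 2 * b 1) * h
  · linear_combination (a 2 * b 0 - a 0 * b 2) * h
  · linear_combination (a 0 * b 1 - a 1 * b 0) * h

/-- The frame of the tangent plane and the normal carried by a linear isometry of the plane. -/
lemma isONFrame_map {L : E2 →L[ℝ] E3} (hL : ∀ v, ‖L v‖ = ‖v‖) {v : E2} (hv : ‖v‖ = 1) :
    IsONFrame (L v) (L (rot v)) (cross (L !₂[1, 0]) (L !₂[0, 1])) := by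
  rw [← cross_map_rot L hv]
  have h1 : ⟪L v, L v⟫ = 1 := by rw [inner_map_of_norm hL, real_inner_self_eq_norm_sq, hv]; norm_num
  have h2 : ⟪L (rot v), L (rot v)⟫ = 1 := by
    rw [inner_map_of_norm hL, inner_rot_rot, real_inner_self_eq_norm_sq, hv]; norm_num
  have h3 : ⟪L v, L (rot v)⟫ = 0 := by rw [inner_map_of_norm hL, inner_self_rot]
  refine ⟨h1, h2, ?_, h3, inner_cross_left _ _, inner_cross_right _ _⟩
  rw [real_inner_self_eq_norm_sq, norm_cross_sq, ← real_inner_self_eq_norm_sq,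
      ← real_inner_self_eq_norm_sq, h1, h2, h3]; norm_num

/-- Rotation by a right angle in the tangent plane is the vector product with the normal. -/
lemma cross_normal_map {L : E2 →L[ℝ] E3} (hL : ∀ v, ‖L v‖ = ‖v‖) {v : E2} (hv : ‖v‖ = 1) :
    cross (cross (L !₂[1, 0]) (L !₂[0, 1])) (L v) = L (rot v) := by
  rw [← cross_map_rot L hv, cross_cross, inner_map_of_norm hL, inner_map_of_norm hL,
    real_inner_self_eq_norm_sq, hv, inner_rot_self]; simp

end Algebra

/-! ### Local inverses -/

section Inverse

/-- The inverse function theorem in finite dimensions, with its conclusions in one place. -/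
lemma exists_localInverse {E F : Type*} [NormedAddCommGroup E] [NormedSpace ℝ E]
    [FiniteDimensional ℝ E] [NormedAddCommGroup F] [NormedSpace ℝ F] [FiniteDimensional ℝ F]
    (hdim : Module.finrank ℝ E = Module.finrank ℝ F) {n : WithTop ℕ∞} (hn : 1 ≤ n)
    {f : E → F} {a : E} (hf : ContDiffAt ℝ n f a)
    (hinj : ∀ v, fderiv ℝ f a v = 0 → v = 0) :
    ∃ j : F → E, ContDiffAt ℝ n j (f a) ∧ j (f a) = a ∧ (∀ᶠ x in 𝓝 a, j (f x) = x) ∧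
      (∀ᶠ y in 𝓝 (f a), f (j y) = y) ∧ map f (𝓝 a) = 𝓝 (f a) := by
  have hn0 : n ≠ 0 := (lt_of_lt_of_le zero_lt_one hn).ne'
  have : CompleteSpace E := FiniteDimensional.complete ℝ E
  let e : E ≃L[ℝ] F := (LinearEquiv.ofInjectiveOfFinrankEq (fderiv ℝ f a).toLinearMap
    ((injective_iff_map_eq_zero _).2 hinj) hdim).toContinuousLinearEquiv
  have he : (e : E →L[ℝ] F) = fderiv ℝ f a := by ext; rfl
  have hd : HasFDerivAt f (e : E →L[ℝ] F) a := by
    rw [he]; exact (hf.differentiableAt hn0).hasFDerivAt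
  have hs : HasStrictFDerivAt f (e : E →L[ℝ] F) a := hf.hasStrictFDerivAt' hd hn0
  exact ⟨hs.localInverse f e a, hf.to_localInverse hd hn0, hs.localInverse_apply_image,
    hs.eventually_left_inverse, hs.eventually_right_inverse, hs.map_nhds_eq_of_equiv⟩

/-- If the kernel of the differential of a scalar function `p` without critical points is killed
by the differential of `q`, then `q` is locally a function of `p`. -/
lemma exists_nhds_eq_of_fderiv_ker {V : Type*} [NormedAddCommGroup V] [NormedSpace ℝ V]
    {p : E2 → ℝ} {q : E2 → V} {x₀ v₀ : E2} (hp : ContDiffAt ℝ 1 p x₀)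
    (hv : fderiv ℝ p x₀ v₀ ≠ 0) (hq : ∀ᶠ x in 𝓝 x₀, DifferentiableAt ℝ q x)
    (hker : ∀ᶠ x in 𝓝 x₀, ∀ w, fderiv ℝ p x w = 0 → fderiv ℝ q x w = 0) :
    ∃ U ∈ 𝓝 x₀, ∀ x ∈ U, ∀ x' ∈ U, p x = p x' → q x = q x' := by
  set Θ : E2 → ℝ × ℝ := fun x => (p x, ⟪x, rot v₀⟫) with hΘ
  have hΘc : ContDiffAt ℝ 1 Θ x₀ := hp.prodMk (contDiffAt_id.inner ℝ contDiffAt_const)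
  have hΘd : ∀ x, DifferentiableAt ℝ p x → HasFDerivAt Θ
      ((fderiv ℝ p x).prod (innerSL ℝ (rot v₀))) x := by
    intro x hx
    refine hx.hasFDerivAt.prodMk ?_
    have : (fun x : E2 => ⟪x, rot v₀⟫) = innerSL ℝ (rot v₀) := by
      ext x; simp [real_inner_comm]
    rw [this]; exact (innerSL ℝ (rot v₀)).hasFDerivAt
  have hpd : ∀ᶠ x in 𝓝 x₀, DifferentiableAt ℝ p x :=
    (hp.eventually (by simp)).mono fun x hx => hx.differentiableAt (by simp)
  have hinj : ∀ w, fderiv ℝ Θ x₀ w = 0 → w = 0 := by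
    intro w hw
    rw [(hΘd x₀ (hp.differentiableAt (by simp))).fderiv] at hw
    simp only [ContinuousLinearMap.prod_apply, innerSL_apply_apply, Prod.mk_eq_zero] at hw
    have hv0 : v₀ ≠ 0 := by rintro rfl; simp at hv
    obtain ⟨c, h1⟩ : ∃ c : ℝ, w = c • v₀ :=
      exists_smul_of_inner_rot hv0 (by rw [real_inner_comm]; exact hw.2)
    rw [h1, map_smul, smul_eq_mul] at hw
    rw [h1]
    rcases mul_eq_zero.1 hw.1 with h | h
    · rw [h, zero_smul]
    · exact absurd h hv
  obtain ⟨j, hjc, hj0, hjl, hjr, hmap⟩ := exists_localInverse (by simp) le_rfl hΘc hinj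
  have hjd : ∀ᶠ y in 𝓝 (Θ x₀), DifferentiableAt ℝ j y :=
    (hjc.eventually (by simp)).mono fun x hx => hx.differentiableAt (by simp)
  have hjt : Tendsto j (𝓝 (Θ x₀)) (𝓝 x₀) := by
    have := hjc.continuousAt.tendsto; rwa [hj0] at this
  have hgood := hjr.eventually_nhds.and (hjd.and (hjt.eventually (hq.and (hker.and hpd))))
  obtain ⟨r, hr, hball⟩ := Metric.eventually_nhds_iff_ball.1 hgood
  refine ⟨{x | j (Θ x) = x ∧ Θ x ∈ Metric.ball (Θ x₀) r},
    hjl.and (hΘc.continuousAt (Metric.ball_mem_nhds _ hr)), ?_⟩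
  rintro x ⟨hx1, hx2⟩ x' ⟨hx1', hx2'⟩ hpp
  -- along the level `p = p x` the function `q` has derivative zero
  have hline : ∀ b ∈ Metric.ball (Θ x₀).2 r, HasDerivWithinAt (fun b => q (j (p x, b))) 0
      (Metric.ball (Θ x₀).2 r) b := by
    intro b hb
    have hab : (p x, b) ∈ Metric.ball (Θ x₀) r := by
      rw [← ball_prod_same] at hx2 ⊢
      exact ⟨hx2.1, hb⟩
    obtain ⟨h1, h2, h3, h4, h5⟩ := hball _ hab
    have hpath : HasDerivAt (fun b : ℝ => (p x, b)) ((0 : ℝ), (1 : ℝ)) b :=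
      (hasDerivAt_const b (p x)).prodMk (hasDerivAt_id b)
    have hjp : HasDerivAt (fun b => j (p x, b)) (fderiv ℝ j (p x, b) (0, 1)) b :=
      h2.hasFDerivAt.comp_hasDerivAt b hpath
    have hpj : HasDerivAt (fun b => p (j (p x, b)))
        (fderiv ℝ p (j (p x, b)) (fderiv ℝ j (p x, b) (0, 1))) b :=
      h5.hasFDerivAt.comp_hasDerivAt b hjp
    have hconst : (fun b => p (j (p x, b))) =ᶠ[𝓝 b] fun _ => p x := by
      have hc : ContinuousAt (fun b : ℝ => (p x, b)) b := by fun_prop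
      filter_upwards [hc.eventually h1] with b' hb'
      exact congrArg Prod.fst hb'
    have h0 : fderiv ℝ p (j (p x, b)) (fderiv ℝ j (p x, b) (0, 1)) = 0 :=
      hpj.unique ((hasDerivAt_const b (p x)).congr_of_eventuallyEq hconst)
    have := h3.hasFDerivAt.comp_hasDerivAt b hjp
    rw [h4 _ h0] at this
    exact this.hasDerivWithinAt
  have hxb : (Θ x).2 ∈ Metric.ball (Θ x₀).2 r := by
    rw [← ball_prod_same] at hx2; exact hx2.2
  have hxb' : (Θ x').2 ∈ Metric.ball (Θ x₀).2 r := by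
    rw [← ball_prod_same] at hx2'; exact hx2'.2
  have key := (convex_ball (Θ x₀).2 r).norm_image_sub_le_of_norm_hasDerivWithin_le
    (C := 0) hline (by simp) hxb' hxb
  have e1 : (p x, (Θ x).2) = Θ x := rfl
  have e2 : (p x, (Θ x').2) = Θ x' := by rw [hpp]
  simp only [e1, e2, hx1, hx1', zero_mul, norm_le_zero_iff, sub_eq_zero] at key
  exact key

end Inverse

/-! ### The second fundamental form -/

section SecondFundamentalForm

/-- The second derivative of `F` on `S`. If `F` is an isometric immersion, its values are normal
to the surface, so that this is the second fundamental form times the unit normal. -/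
noncomputable def sff (F : E2 → E3) (S : Set E2) (x : E2) : E2 →L[ℝ] E2 →L[ℝ] E3 :=
  fderivWithin ℝ (fderivWithin ℝ F S) S x

/-- Planar sets that allow differential calculus up to the boundary: an open set together with a
regular part of its boundary. -/
structure IsRegularDomain (S : Set E2) : Prop where
  uniqueDiffOn : UniqueDiffOn ℝ S
  subset_closure : S ⊆ closure (interior S)

lemma _root_.IsOpen.isRegularDomain {S : Set E2} (hS : IsOpen S) : IsRegularDomain S :=
  ⟨hS.uniqueDiffOn, by rw [hS.interior_eq]; exact subset_closure⟩

variable {F : E2 → E3} {S : Set E2}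

lemma IsometricImmersionOn.of_le {m n : WithTop ℕ∞} (hF : IsometricImmersionOn n F S)
    (h : m ≤ n) : IsometricImmersionOn m F S := ⟨hF.1.of_le h, hF.2⟩

lemma IsometricImmersionOn.contDiffOn_fderivWithin {m n : WithTop ℕ∞}
    (hF : IsometricImmersionOn n F S) (hS : IsRegularDomain S) (h : m + 1 ≤ n) :
    ContDiffOn ℝ m (fderivWithin ℝ F S) S :=
  hF.1.fderivWithin hS.uniqueDiffOn h

lemma IsometricImmersionOn.hasFDerivWithinAt (hF : IsometricImmersionOn 2 F S) {x : E2}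
    (hx : x ∈ S) : HasFDerivWithinAt F (fderivWithin ℝ F S x) S x :=
  (hF.1.differentiableOn (by simp) x hx).hasFDerivWithinAt

lemma IsometricImmersionOn.hasFDerivWithinAt_sff (hF : IsometricImmersionOn 2 F S)
    (hS : IsRegularDomain S) {x : E2} (hx : x ∈ S) :
    HasFDerivWithinAt (fderivWithin ℝ F S) (sff F S x) S x :=
  ((hF.contDiffOn_fderivWithin (m := 1) hS (by norm_num)).differentiableOn
    (by simp) x hx).hasFDerivWithinAt

lemma IsometricImmersionOn.continuousOn_sff (hF : IsometricImmersionOn 2 F S)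
    (hS : IsRegularDomain S) : ContinuousOn (sff F S) S :=
  (hF.contDiffOn_fderivWithin (m := 1) hS (by norm_num)).continuousOn_fderivWithin
    hS.uniqueDiffOn (by simp)

lemma IsometricImmersionOn.sff_symm (hF : IsometricImmersionOn 2 F S)
    (hS : IsRegularDomain S) {x : E2} (hx : x ∈ S) (a b : E2) : sff F S x a b = sff F S x b a :=
  (hF.1 x hx).isSymmSndFDerivWithinAt (by simp) hS.uniqueDiffOn (hS.subset_closure hx) hx a b

lemma IsometricImmersionOn.inner_fderivWithin {n : WithTop ℕ∞} (hF : IsometricImmersionOn n F S)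
    {x : E2} (hx : x ∈ S) (a b : E2) :
    ⟪fderivWithin ℝ F S x a, fderivWithin ℝ F S x b⟫ = ⟪a, b⟫ :=
  inner_map_of_norm (hF.2 x hx) a b

/-- The Christoffel symbols of the flat metric vanish. -/
lemma IsometricImmersionOn.inner_sff (hF : IsometricImmersionOn 2 F S)
    (hS : IsRegularDomain S) {x : E2} (hx : x ∈ S) (a b c : E2) :
    ⟪sff F S x a b, fderivWithin ℝ F S x c⟫ = 0 := by
  have key : ∀ a b c : E2, ⟪fderivWithin ℝ F S x b, sff F S x a c⟫ +
      ⟪sff F S x a b, fderivWithin ℝ F S x c⟫ = 0 := by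
    intro a b c
    have hG := hF.hasFDerivWithinAt_sff hS hx
    have hb := hG.clm_apply (hasFDerivWithinAt_const b x S)
    have hc := hG.clm_apply (hasFDerivWithinAt_const c x S)
    have h1 := hb.inner ℝ hc
    have h2 : HasFDerivWithinAt (fun y => ⟪fderivWithin ℝ F S y b, fderivWithin ℝ F S y c⟫)
        (0 : E2 →L[ℝ] ℝ) S x :=
      (hasFDerivWithinAt_const (⟪b, c⟫ : ℝ) x S).congr
        (fun y hy => hF.inner_fderivWithin hy b c) (hF.inner_fderivWithin hx b c)
    have h3 := congrArg (fun L : E2 →L[ℝ] ℝ => L a)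
      ((hS.uniqueDiffOn x hx).eq h1 h2)
    simpa [fderivInnerCLM_apply] using h3
  have s := hF.sff_symm hS hx
  have k1 := key a b c
  have k2 := key b c a
  have k3 := key c a b
  rw [s c b, real_inner_comm] at k3
  rw [s b a, s b c, real_inner_comm] at k2
  rw [s a c, real_inner_comm] at k1
  rw [s b c] at k3
  linarith

lemma IsometricImmersionOn.isONFrame {n : WithTop ℕ∞} (hF : IsometricImmersionOn n F S) {x : E2}
    (hx : x ∈ S) {v : E2} (hv : ‖v‖ = 1) :
    IsONFrame (fderivWithin ℝ F S x v) (fderivWithin ℝ F S x (rot v)) (unitNormal F S x) :=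
  isONFrame_map (hF.2 x hx) hv

lemma norm_e1 : ‖(!₂[1, 0] : E2)‖ = 1 := by simp [EuclideanSpace.norm_eq]

lemma rot_e1 : rot (!₂[1, 0] : E2) = !₂[0, 1] := by apply E2.ext <;> simp

lemma IsometricImmersionOn.eq_smul_unitNormal {n : WithTop ℕ∞} (hF : IsometricImmersionOn n F S)
    {x : E2} (hx : x ∈ S) {z : E3} (hz : ∀ c, ⟪z, fderivWithin ℝ F S x c⟫ = 0) :
    z = ⟪z, unitNormal F S x⟫ • unitNormal F S x := by
  have h := (hF.isONFrame hx norm_e1).expand z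
  rw [hz, hz] at h
  simpa using h

lemma IsometricImmersionOn.sff_eq (hF : IsometricImmersionOn 2 F S)
    (hS : IsRegularDomain S) {x : E2} (hx : x ∈ S) (a b : E2) :
    sff F S x a b = ⟪sff F S x a b, unitNormal F S x⟫ • unitNormal F S x :=
  hF.eq_smul_unitNormal hx fun c => hF.inner_sff hS hx a b c

lemma IsometricImmersionOn.contDiffOn_unitNormal {m n : WithTop ℕ∞}
    (hF : IsometricImmersionOn n F S) (hS : IsRegularDomain S) (h : m + 1 ≤ n) :
    ContDiffOn ℝ m (unitNormal F S) S := by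
  have hG := hF.contDiffOn_fderivWithin hS h
  have h1 := hG.clm_apply (contDiffOn_const (c := (!₂[1, 0] : E2)))
  have h2 := hG.clm_apply (contDiffOn_const (c := (!₂[0, 1] : E2)))
  exact (crossL.contDiff.comp_contDiffOn h1).clm_apply h2

lemma IsometricImmersionOn.inner_unitNormal_fderivWithin {n : WithTop ℕ∞}
    (hF : IsometricImmersionOn n F S) {x : E2} (hx : x ∈ S) (c : E2) :
    ⟪unitNormal F S x, fderivWithin ℝ F S x c⟫ = 0 := by
  have h := hF.isONFrame hx norm_e1
  rw [basis_eq c, ← rot_e1, map_add, map_smul, map_smul, inner_add_right, inner_smul_right,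
    inner_smul_right, real_inner_comm, h.Tn, real_inner_comm, h.un]
  simp

/-- The Weingarten equation. -/
lemma IsometricImmersionOn.inner_fderivWithin_unitNormal (hF : IsometricImmersionOn 2 F S)
    (hS : IsRegularDomain S) {x : E2} (hx : x ∈ S) (w c : E2) :
    ⟪fderivWithin ℝ (unitNormal F S) S x w, fderivWithin ℝ F S x c⟫ =
      - ⟪sff F S x w c, unitNormal F S x⟫ := by
  have hN := ((hF.contDiffOn_unitNormal (m := 1) hS (by norm_num)).differentiableOn
    (by simp) x hx).hasFDerivWithinAt
  have hG := (hF.hasFDerivWithinAt_sff hS hx).clm_apply (hasFDerivWithinAt_const c x S)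
  have h2 : HasFDerivWithinAt (fun y => ⟪unitNormal F S y, fderivWithin ℝ F S y c⟫)
      (0 : E2 →L[ℝ] ℝ) S x :=
    (hasFDerivWithinAt_const (0 : ℝ) x S).congr
      (fun y hy => hF.inner_unitNormal_fderivWithin hy c) (hF.inner_unitNormal_fderivWithin hx c)
  have h3 := congrArg (fun L : E2 →L[ℝ] ℝ => L w) ((hS.uniqueDiffOn x hx).eq (hN.inner ℝ hG) h2)
  simp [fderivInnerCLM_apply] at h3
  rw [real_inner_comm] at h3
  linarith [real_inner_comm (sff F S x w c) (unitNormal F S x)]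

end SecondFundamentalForm

/-! ### The Gauss equation for `C²` isometric immersions -/

section Gauss

variable {F : E2 → E3} {S : Set E2}

/-- A graph over its tangent plane: a unit vector field whose orthogonal projection to a plane is
prescribed is, near the normal of the plane, an explicit smooth function of the projection. -/
lemma eq_add_sqrt_smul {L : E2 →L[ℝ] E3} (hL : ∀ v, ‖L v‖ = ‖v‖) {z : E2} {ν : E3}
    (hν : ⟪ν, ν⟫ = 1) (hz : ∀ c, ⟪ν, L c⟫ = ⟪z, c⟫)
    (hpos : 0 ≤ ⟪ν, cross (L !₂[1, 0]) (L !₂[0, 1])⟫) :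
    ν = L z + √(1 - ‖z‖ ^ 2) • cross (L !₂[1, 0]) (L !₂[0, 1]) := by
  have hfr := isONFrame_map hL norm_e1
  have hLN : ∀ c, ⟪L c, cross (L !₂[1, 0]) (L !₂[0, 1])⟫ = 0 := by
    intro c
    have hc := basis_eq c
    rw [← rot_e1] at hc
    rw [hc, map_add, map_smul, map_smul, inner_add_left, inner_smul_left, inner_smul_left,
      hfr.Tn, hfr.un]
    simp
  set N0 := cross (L !₂[1, 0]) (L !₂[0, 1]) with hN0
  have hsq : ⟪ν, N0⟫ ^ 2 = 1 - ‖z‖ ^ 2 := by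
    have h := hfr.inner_eq ν ν
    rw [hν, hz, hz] at h
    have h2 := expand_rot norm_e1 z
    have h3 : ‖z‖ ^ 2 = ⟪z, !₂[1, 0]⟫ ^ 2 + ⟪z, rot !₂[1, 0]⟫ ^ 2 := by
      rw [← real_inner_self_eq_norm_sq, inner_eq_two, inner_eq_two, inner_eq_two]; simp; ring
    rw [h3]; linarith [h]
  have hcoef : ⟪ν, N0⟫ = √(1 - ‖z‖ ^ 2) := by
    rw [← hsq, Real.sqrt_sq hpos]
  refine hfr.eq_of_inner ?_ ?_ ?_
  · rw [hz, inner_add_left, inner_smul_left, inner_map_of_norm hL, real_inner_comm (L _) N0, hLN]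
    simp
  · rw [hz, inner_add_left, inner_smul_left, inner_map_of_norm hL, real_inner_comm (L _) N0, hLN]
    simp
  · rw [inner_add_left, inner_smul_left, hLN, hfr.nn, ← hcoef]; simp

/-- The bilinear forms with `det = 0` in the plane are the degenerate ones. -/
lemma det_form_eq (h : E2 →L[ℝ] E2 →L[ℝ] ℝ) (hs : ∀ a b, h a b = h b a)
    (hdet : h !₂[1, 0] !₂[1, 0] * h !₂[0, 1] !₂[0, 1] = h !₂[1, 0] !₂[0, 1] ^ 2) (a b : E2) :
    h a a * h b b = h a b ^ 2 := by
  have e : ∀ a b : E2, h a b = a 0 * b 0 * h !₂[1, 0] !₂[1, 0]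
      + (a 0 * b 1 + a 1 * b 0) * h !₂[1, 0] !₂[0, 1] + a 1 * b 1 * h !₂[0, 1] !₂[0, 1] := by
    intro a b
    conv_lhs => rw [basis_eq a, basis_eq b]
    simp only [map_add, map_smul, add_apply, smul_apply,
      smul_eq_mul, hs !₂[0, 1] !₂[1, 0]]
    ring
  rw [e a a, e b b, e a b]
  linear_combination (a 0 * b 1 - a 1 * b 0) ^ 2 * hdet

/-- The Gauss equation on an open set, for an immersion of class `C²` only. If the determinant
were not zero at `x₀`, the unit normal would be a local `C¹` chart there. Seen in the chart given by
the projection to the tangent plane at `x₀`, the unit normal `ν` is smooth, and a tangent field `a`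
of the frame satisfies `Da = -⟨a, Dν⟩ ν`; hence `a` is of class `C²`, and the symmetry of
its second derivative is violated. -/
lemma IsometricImmersionOn.gauss_of_isOpen (hS : IsOpen S) (hF : IsometricImmersionOn 2 F S)
    {x₀ : E2} (hx₀ : x₀ ∈ S) (a b : E2) :
    ⟪sff F S x₀ a a, unitNormal F S x₀⟫ * ⟪sff F S x₀ b b, unitNormal F S x₀⟫ =
      ⟪sff F S x₀ a b, unitNormal F S x₀⟫ ^ 2 := by
  have hR := hS.isRegularDomain
  set G := fderivWithin ℝ F S with hG
  set N := unitNormal F S with hN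
  set h : E2 →L[ℝ] E2 →L[ℝ] ℝ :=
    (ContinuousLinearMap.compL ℝ E2 E3 ℝ (innerSL ℝ (N x₀))).comp (sff F S x₀) with hh
  have happ : ∀ a b, h a b = ⟪sff F S x₀ a b, N x₀⟫ := by
    intro a b; simp [hh, real_inner_comm]
  have hsymm : ∀ a b, h a b = h b a := fun a b => by
    rw [happ, happ, hF.sff_symm hR hx₀]
  rw [← happ, ← happ, ← happ]
  refine det_form_eq h hsymm ?_ a b
  by_contra hdet
  have hSn : S ∈ 𝓝 x₀ := hS.mem_nhds hx₀
  have hNc : ContDiffAt ℝ 1 N x₀ :=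
    (hF.contDiffOn_unitNormal (m := 1) hR (by norm_num)).contDiffAt hSn
  have hGc : ContDiffAt ℝ 1 G x₀ :=
    (hF.contDiffOn_fderivWithin (m := 1) hR (by norm_num)).contDiffAt hSn
  set P : E3 →L[ℝ] E2 := ContinuousLinearMap.adjoint (G x₀) with hP
  have hPi : ∀ z c, ⟪P z, c⟫ = ⟪z, G x₀ c⟫ := fun z c =>
    ContinuousLinearMap.adjoint_inner_left _ _ _
  set y : E2 → E2 := fun x => P (N x) with hy
  have hyc : ContDiffAt ℝ 1 y x₀ := P.contDiff.contDiffAt.comp x₀ hNc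
  have hNd : HasFDerivAt N (fderiv ℝ N x₀) x₀ := (hNc.differentiableAt (by simp)).hasFDerivAt
  have hyd : fderiv ℝ y x₀ = P.comp (fderiv ℝ N x₀) := (P.hasFDerivAt.comp x₀ hNd).fderiv
  have hDN : ∀ w c, ⟪fderiv ℝ N x₀ w, G x₀ c⟫ = - h w c := by
    intro w c
    rw [happ, ← hF.inner_fderivWithin_unitNormal hR hx₀, fderivWithin_of_isOpen hS hx₀]
  have hinj : ∀ w, fderiv ℝ y x₀ w = 0 → w = 0 := by
    intro w hw
    have hw' : ∀ c, h w c = 0 := by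
      intro c
      rw [← neg_eq_zero, ← hDN, ← hPi]
      rw [hyd] at hw
      have : P (fderiv ℝ N x₀ w) = 0 := hw
      rw [this, inner_zero_left]
    have h1 := hw' !₂[1, 0]
    have h2 := hw' !₂[0, 1]
    rw [basis_eq w] at h1 h2
    simp only [map_add, map_smul, add_apply, smul_apply,
      smul_eq_mul, hsymm !₂[0, 1] !₂[1, 0]] at h1 h2
    have hd : h !₂[1, 0] !₂[1, 0] * h !₂[0, 1] !₂[0, 1] - h !₂[1, 0] !₂[0, 1] ^ 2 ≠ 0 :=
      sub_ne_zero.2 hdet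
    apply E2.ext
    · refine (mul_eq_zero.1 ?_).resolve_right hd
      linear_combination h !₂[0, 1] !₂[0, 1] * h1 - h !₂[1, 0] !₂[0, 1] * h2
    · refine (mul_eq_zero.1 ?_).resolve_right hd
      linear_combination h !₂[1, 0] !₂[1, 0] * h2 - h !₂[1, 0] !₂[0, 1] * h1
  obtain ⟨j, hjc, hj0, -, hjr, -⟩ := exists_localInverse rfl le_rfl hyc hinj
  have hy0 : y x₀ = 0 := by
    refine ext_inner_right ℝ fun c => ?_
    rw [hPi, hF.inner_unitNormal_fderivWithin hx₀, inner_zero_left]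
  rw [hy0] at hjc hj0 hjr
  have hjt : Tendsto j (𝓝 0) (𝓝 x₀) := by
    have := hjc.continuousAt.tendsto; rwa [hj0] at this
  have hfr := hF.isONFrame hx₀ norm_e1
  -- the unit normal in the new coordinates is smooth
  set ν : E2 → E3 := fun z => G x₀ z + √(1 - ‖z‖ ^ 2) • N x₀ with hν
  have hνc : ContDiffAt ℝ 2 ν 0 := by
    have h1 : ContDiffAt ℝ 2 (fun z : E2 => √(1 - ‖z‖ ^ 2)) 0 :=
      (contDiffAt_const.sub (contDiff_norm_sq ℝ).contDiffAt).sqrt (by simp)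
    exact (G x₀).contDiff.contDiffAt.add (h1.smul contDiffAt_const)
  have hνd : HasFDerivAt ν (G x₀) 0 := by
    have h1 : HasFDerivAt (fun z : E2 => ‖z‖ ^ 2) (0 : E2 →L[ℝ] ℝ) 0 := by
      have := (hasStrictFDerivAt_norm_sq (0 : E2)).hasFDerivAt
      simpa using this
    have h2 := ((hasFDerivAt_const (1 : ℝ) (0 : E2)).sub h1).sqrt (by simp)
    have h3 := (G x₀).hasFDerivAt.add (h2.smul (hasFDerivAt_const (N x₀) 0))
    refine h3.congr_fderiv ?_
    ext; simp
  have hNν : ∀ᶠ z in 𝓝 (0 : E2), N (j z) = ν z := by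
    have hpos : ∀ᶠ x in 𝓝 x₀, 0 < ⟪N x, N x₀⟫ := by
      refine (hNc.continuousAt.inner continuousAt_const).eventually (lt_mem_nhds ?_)
      simp only [hN]; rw [hfr.nn]; norm_num
    filter_upwards [hjr, hjt.eventually hpos, hjt.eventually hSn] with z h1 h2 h3
    refine eq_add_sqrt_smul (hF.2 x₀ hx₀) (hF.isONFrame h3 norm_e1).nn (fun c => ?_) h2.le
    rw [← hPi]; exact congrArg (fun v => ⟪v, c⟫) h1
  -- the tangent field of the frame in the new coordinates
  set α : E2 → E3 := fun z => G (j z) !₂[1, 0] with hα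
  set A : E2 → E2 →L[ℝ] E3 := fun z =>
    -(((innerSL ℝ (α z)).comp (fderiv ℝ ν z)).smulRight (ν z)) with hA
  have hαc : ContDiffAt ℝ 1 α 0 := by
    have : ContDiffAt ℝ 1 (fun z => G (j z)) 0 := by
      refine ContDiffAt.comp 0 ?_ hjc
      rw [hj0]; exact hGc
    exact this.clm_apply contDiffAt_const
  have hαA : ∀ᶠ z in 𝓝 (0 : E2), HasFDerivAt α (A z) z := by
    have hjd : ∀ᶠ z in 𝓝 (0 : E2), DifferentiableAt ℝ j z :=
      (hjc.eventually (by simp)).mono fun x hx => hx.differentiableAt (by simp)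
    have hνd' : ∀ᶠ z in 𝓝 (0 : E2), DifferentiableAt ℝ ν z :=
      (hνc.eventually (by simp)).mono fun x hx => hx.differentiableAt (by simp)
    filter_upwards [hjd, hjt.eventually hSn, hνd', hNν.eventually_nhds,
      (hjt.eventually (hS.mem_nhds hx₀)).eventually_nhds] with z h1 h2 h3 h4 h5
    have hGd : HasFDerivAt G (sff F S (j z)) (j z) :=
      (hF.hasFDerivWithinAt_sff hR h2).hasFDerivAt (hS.mem_nhds h2)
    have hd := (hGd.comp z h1.hasFDerivAt).clm_apply (hasFDerivAt_const (!₂[1, 0] : E2) z)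
    refine hd.congr_fderiv ?_
    ext1 w
    have e1 : ∀ c, ⟪sff F S (j z) (fderiv ℝ j z w) !₂[1, 0], G (j z) c⟫ = 0 := fun c =>
      hF.inner_sff hR h2 _ _ c
    have e2 := hF.eq_smul_unitNormal h2 e1
    have e3 : ⟪α z, fderiv ℝ ν z w⟫ + ⟪sff F S (j z) (fderiv ℝ j z w) !₂[1, 0], ν z⟫ = 0 := by
      have k1 := hd.inner ℝ h3.hasFDerivAt
      have k2 : HasFDerivAt (fun z' => ⟪G (j z') !₂[1, 0], ν z'⟫) (0 : E2 →L[ℝ] ℝ) z := by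
        refine (hasFDerivAt_const (0 : ℝ) z).congr_of_eventuallyEq ?_
        filter_upwards [h4, h5] with z' h4' h5'
        rw [← h4', real_inner_comm]
        exact hF.inner_unitNormal_fderivWithin h5' _
      have k3 := congrArg (fun L : E2 →L[ℝ] ℝ => L w) (k1.unique k2)
      simpa [fderivInnerCLM_apply] using k3
    have e4 : ⟪sff F S (j z) (fderiv ℝ j z w) !₂[1, 0], ν z⟫ = -⟪α z, fderiv ℝ ν z w⟫ := by
      linarith
    have hz4 : unitNormal F S (j z) = ν z := h4.self_of_nhds
    rw [hz4, e4] at e2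
    simp [hA, e2]
  have hAc : ContDiffAt ℝ 1 A 0 := by
    have h1 : ContDiffAt ℝ 1 (fderiv ℝ ν) 0 := hνc.fderiv_right (by norm_num)
    have h2 : ContDiffAt ℝ 1 (fun z => innerSL ℝ (α z)) 0 :=
      (innerSL ℝ : E3 →L[ℝ] E3 →L[ℝ] ℝ).contDiff.contDiffAt.comp 0 hαc
    exact ((h2.clm_comp h1).smulRight (hνc.of_le (by norm_num))).neg
  have hα2 : ContDiffAt ℝ 2 α 0 := by
    have h2 : (2 : WithTop ℕ∞) = ((1 : ℕ) : WithTop ℕ∞) + 1 := by norm_num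
    rw [h2, contDiffAt_succ_iff_hasFDerivAt]
    exact ⟨A, ⟨_, hαA, fun x hx => hx⟩, hAc⟩
  have hsymA : ∀ w w' : E2, fderiv ℝ A 0 w w' = fderiv ℝ A 0 w' w := by
    have hs := hα2.isSymmSndFDerivAt (by simp)
    have he : fderiv ℝ α =ᶠ[𝓝 0] A := hαA.mono fun z hz => hz.fderiv
    intro w w'
    have := hs w w'
    rwa [he.fderiv_eq] at this
  -- the component of the second derivative in the direction of the second coordinate vector
  have hcomp : ∀ w w' : E2, ⟪fderiv ℝ A 0 w' w, G x₀ !₂[0, 1]⟫ = - (w 0 * w' 1) := by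
    intro w w'
    have hAd : HasFDerivAt A (fderiv ℝ A 0) 0 := (hAc.differentiableAt (by simp)).hasFDerivAt
    have k1 := (hAd.clm_apply (hasFDerivAt_const w 0)).inner ℝ
      (hasFDerivAt_const (G x₀ !₂[0, 1]) 0)
    have hψ : DifferentiableAt ℝ (fun z => ⟪α z, fderiv ℝ ν z w⟫) 0 := by
      have h1 : ContDiffAt ℝ 1 (fderiv ℝ ν) 0 := hνc.fderiv_right (by norm_num)
      exact ((hαc.differentiableAt (by simp))).inner ℝ
        ((h1.differentiableAt (by simp)).clm_apply (differentiableAt_const w))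
    have k2 := (hψ.hasFDerivAt.mul
      ((innerSL ℝ (!₂[0, 1] : E2)).hasFDerivAt (x := 0))).neg
    have k3 : (fun z => ⟪A z w, G x₀ !₂[0, 1]⟫) =
        fun z => - (⟪α z, fderiv ℝ ν z w⟫ * innerSL ℝ (!₂[0, 1] : E2) z) := by
      ext z
      have : ⟪ν z, G x₀ !₂[0, 1]⟫ = ⟪(!₂[0, 1] : E2), z⟫ := by
        rw [hν]; simp only
        rw [inner_add_left, inner_smul_left, hF.inner_unitNormal_fderivWithin hx₀,
          hF.inner_fderivWithin hx₀, real_inner_comm]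
        simp
      simp only [hA, neg_apply, ContinuousLinearMap.smulRight_apply,
        inner_neg_left, inner_smul_left, this, ContinuousLinearMap.comp_apply,
        innerSL_apply_apply]
      simp
    have k4 := congrArg (fun L : E2 →L[ℝ] ℝ => L w')
      (k1.unique (k2.congr_of_eventuallyEq (.of_eq k3)))
    have e0 : α 0 = G x₀ !₂[1, 0] := by simp only [hα, hj0]
    have e1 : ⟪α 0, fderiv ℝ ν 0 w⟫ = w 0 := by
      rw [hνd.fderiv, e0, hF.inner_fderivWithin hx₀, inner_eq_two]; simp
    have e2 : ⟪(!₂[0, 1] : E2), w'⟫ = w' 1 := by rw [inner_eq_two]; simp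
    simpa [fderivInnerCLM_apply, e1, e2] using k4
  have f1 := hcomp !₂[1, 0] !₂[0, 1]
  have f2 := hcomp !₂[0, 1] !₂[1, 0]
  rw [hsymA] at f1
  rw [f1] at f2
  simp at f2

lemma fderivWithin_interior {x : E2} (hx : x ∈ interior S) :
    fderivWithin ℝ F (interior S) x = fderivWithin ℝ F S x := by
  rw [fderivWithin_of_isOpen isOpen_interior hx, fderivWithin_of_mem_nhds
    (mem_interior_iff_mem_nhds.1 hx)]

lemma sff_of_mem_interior {x : E2} (hx : x ∈ interior S) :
    sff F (interior S) x = sff F S x := by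
  rw [sff, sff, fderivWithin_of_isOpen isOpen_interior hx, fderivWithin_of_mem_nhds
    (mem_interior_iff_mem_nhds.1 hx)]
  refine Filter.EventuallyEq.fderiv_eq ?_
  filter_upwards [isOpen_interior.mem_nhds hx] with y hy
  exact fderivWithin_interior hy

/-- The Gauss equation: the second fundamental form is degenerate. -/
lemma IsometricImmersionOn.gauss (hF : IsometricImmersionOn 2 F S) (hS : IsRegularDomain S)
    {x : E2} (hx : x ∈ S) (a b : E2) :
    ⟪sff F S x a a, unitNormal F S x⟫ * ⟪sff F S x b b, unitNormal F S x⟫ =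
      ⟪sff F S x a b, unitNormal F S x⟫ ^ 2 := by
  have hN := (hF.contDiffOn_unitNormal (m := 1) hS (by norm_num)).continuousOn
  have hc : ∀ a b, ContinuousWithinAt (fun y => ⟪sff F S y a b, unitNormal F S y⟫) S x :=
    fun a b => (((hF.continuousOn_sff hS).clm_apply continuousOn_const).clm_apply
      continuousOn_const).inner hN x hx
  have hF' : IsometricImmersionOn 2 F (interior S) :=
    ⟨hF.1.mono interior_subset, fun y hy v => by
      rw [fderivWithin_interior hy]; exact hF.2 y (interior_subset hy) v⟩
  have hd : ContinuousWithinAt (fun y => ⟪sff F S y a a, unitNormal F S y⟫ *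
      ⟪sff F S y b b, unitNormal F S y⟫ - ⟪sff F S y a b, unitNormal F S y⟫ ^ 2) (interior S) x :=
    (((hc a a).mul (hc b b)).sub ((hc a b).pow 2)).mono interior_subset
  have hz : ∀ y ∈ interior S, ⟪sff F S y a a, unitNormal F S y⟫ *
      ⟪sff F S y b b, unitNormal F S y⟫ - ⟪sff F S y a b, unitNormal F S y⟫ ^ 2 = 0 := by
    intro y hy
    have := hF'.gauss_of_isOpen isOpen_interior hy a b
    have e : unitNormal F (interior S) y = unitNormal F S y := by
      simp only [unitNormal, fderivWithin_interior hy]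
    rw [sff_of_mem_interior hy, e] at this
    linarith
  have hne : (𝓝[interior S] x).NeBot := mem_closure_iff_nhdsWithin_neBot.1 (hS.subset_closure hx)
  have := tendsto_nhds_unique (hd.tendsto.congr' (eventually_nhdsWithin_of_forall hz))
    (tendsto_const_nhds (x := (0 : ℝ)))
  linarith

/-- A direction in which the normal curvature vanishes is a kernel direction of the second
fundamental form. -/
lemma IsometricImmersionOn.sff_eq_zero (hF : IsometricImmersionOn 2 F S) (hS : IsRegularDomain S)
    {x : E2} (hx : x ∈ S) {a : E2} (ha : ⟪sff F S x a a, unitNormal F S x⟫ = 0) (b : E2) :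
    sff F S x a b = 0 := by
  rw [hF.sff_eq hS hx]
  have h := hF.gauss hS hx a b
  rw [ha, zero_mul] at h
  rw [pow_eq_zero_iff (by norm_num)|>.1 h.symm, zero_smul]

/-- If the normal curvature in the direction `v` is not zero, the directions conjugate to `v` are
in the kernel of the (degenerate) second fundamental form. -/
lemma IsometricImmersionOn.sff_eq_zero_of_inner_eq_zero (hF : IsometricImmersionOn 2 F S)
    (hS : IsRegularDomain S) {x : E2} (hx : x ∈ S) {v w : E2}
    (hv : ⟪sff F S x v v, unitNormal F S x⟫ ≠ 0)
    (hw : ⟪sff F S x w v, unitNormal F S x⟫ = 0) : sff F S x w = 0 := by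
  ext1 b
  refine hF.sff_eq_zero hS hx ?_ b
  have h := hF.gauss hS hx w v
  rw [hw] at h
  simpa [hv] using h

end Gauss

/-! ### Ruled strips along a curve -/

section Ridge

variable {g : ℝ → E2} {c : ℝ → E3} {L : ℝ → E2 →L[ℝ] E3} {ρ : ℝ → E2} {J : Set ℝ}

/-- The data of a developable strip along the space curve `c`, unrolled along the plane curve `g`:
`L s` is the differential along the curve of the isometric immersion in question, and the ruling
through `g s` has the direction `ρ s`, in which `L` is stationary. The vector `ρ s` is normalized to
have height one over the tangent of `g`. -/
structure IsRidgeFrame (g : ℝ → E2) (c : ℝ → E3) (L : ℝ → E2 →L[ℝ] E3) (ρ : ℝ → E2)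
    (J : Set ℝ) : Prop where
  isOpen : IsOpen J
  contDiffOn_planar : ContDiffOn ℝ 2 g J
  contDiffOn_space : ContDiffOn ℝ 1 c J
  contDiffOn_map : ContDiffOn ℝ 1 L J
  contDiffOn_ruling : ContDiffOn ℝ 1 ρ J
  unit_speed : ∀ s ∈ J, ‖deriv g s‖ = 1
  norm_map : ∀ s ∈ J, ∀ v, ‖L s v‖ = ‖v‖
  map_deriv : ∀ s ∈ J, L s (deriv g s) = deriv c s
  deriv_map_ruling : ∀ s ∈ J, deriv L s (ρ s) = 0
  deriv_map_tangent : ∀ s ∈ J, deriv L s (deriv g s) ≠ 0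
  inner_ruling : ∀ s ∈ J, ⟪ρ s, rot (deriv g s)⟫ = 1

/-- Planar coordinates `(s, t)` given by the points `g s + t ρ(s)` of the rulings. -/
noncomputable def rulingMap (g ρ : ℝ → E2) (y : ℝ × ℝ) : E2 := g y.1 + y.2 • ρ y.1

/-- The ruled strip along `c`. -/
noncomputable def ruledStrip (c : ℝ → E3) (L : ℝ → E2 →L[ℝ] E3) (ρ : ℝ → E2) (y : ℝ × ℝ) : E3 :=
  c y.1 + y.2 • L y.1 (ρ y.1)

@[simp] lemma rulingMap_zero (g ρ : ℝ → E2) (s : ℝ) : rulingMap g ρ (s, 0) = g s := by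
  simp [rulingMap]

@[simp] lemma ruledStrip_zero (c : ℝ → E3) (L : ℝ → E2 →L[ℝ] E3) (ρ : ℝ → E2) (s : ℝ) :
    ruledStrip c L ρ (s, 0) = c s := by
  simp [ruledStrip]

namespace IsRidgeFrame

variable (h : IsRidgeFrame g c L ρ J) {s : ℝ} (hs : s ∈ J)
include h hs

lemma mem_nhds : J ∈ 𝓝 s := h.isOpen.mem_nhds hs

lemma hasDerivAt_planar : HasDerivAt g (deriv g s) s :=
  (((h.contDiffOn_planar).contDiffAt (h.mem_nhds hs)).differentiableAt (by simp)).hasDerivAt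

lemma hasDerivAt_space : HasDerivAt c (deriv c s) s :=
  (((h.contDiffOn_space).contDiffAt (h.mem_nhds hs)).differentiableAt (by simp)).hasDerivAt

lemma hasDerivAt_map : HasDerivAt L (deriv L s) s :=
  (((h.contDiffOn_map).contDiffAt (h.mem_nhds hs)).differentiableAt (by simp)).hasDerivAt

lemma hasDerivAt_ruling : HasDerivAt ρ (deriv ρ s) s :=
  (((h.contDiffOn_ruling).contDiffAt (h.mem_nhds hs)).differentiableAt (by simp)).hasDerivAt

lemma contDiffAt_rulingMap (t : ℝ) : ContDiffAt ℝ 1 (rulingMap g ρ) (s, t) := by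
  have h1 : ContDiffAt ℝ 1 g (s, t).1 :=
    (h.contDiffOn_planar.contDiffAt (h.mem_nhds hs)).of_le (by norm_num)
  have h2 : ContDiffAt ℝ 1 ρ (s, t).1 := h.contDiffOn_ruling.contDiffAt (h.mem_nhds hs)
  exact (h1.comp (s, t) contDiffAt_fst).add (contDiffAt_snd.smul (h2.comp (s, t) contDiffAt_fst))

lemma contDiffAt_ruledStrip (t : ℝ) : ContDiffAt ℝ 1 (ruledStrip c L ρ) (s, t) := by
  have h1 : ContDiffAt ℝ 1 c (s, t).1 := h.contDiffOn_space.contDiffAt (h.mem_nhds hs)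
  have h2 : ContDiffAt ℝ 1 ρ (s, t).1 := h.contDiffOn_ruling.contDiffAt (h.mem_nhds hs)
  have h3 : ContDiffAt ℝ 1 L (s, t).1 := h.contDiffOn_map.contDiffAt (h.mem_nhds hs)
  exact (h1.comp (s, t) contDiffAt_fst).add (contDiffAt_snd.smul
    ((h3.comp (s, t) contDiffAt_fst).clm_apply (h2.comp (s, t) contDiffAt_fst)))

lemma fderiv_rulingMap (t : ℝ) (w : ℝ × ℝ) : fderiv ℝ (rulingMap g ρ) (s, t) w =
    w.1 • (deriv g s + t • deriv ρ s) + w.2 • ρ s := by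
  have h1 : HasFDerivAt (fun y : ℝ × ℝ => g y.1) _ (s, t) :=
    (h.hasDerivAt_planar hs).hasFDerivAt.comp (s, t) hasFDerivAt_fst
  have h2 : HasFDerivAt (fun y : ℝ × ℝ => ρ y.1) _ (s, t) :=
    (h.hasDerivAt_ruling hs).hasFDerivAt.comp (s, t) hasFDerivAt_fst
  have h3 := h1.add (hasFDerivAt_snd.smul h2)
  have e : HasFDerivAt (rulingMap g ρ) _ (s, t) := h3
  rw [e.fderiv]
  simp [smul_smul, mul_comm, add_assoc]

/-- The strip is unrolled isometrically: its differential is `L s` after that of the planar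
coordinates. -/
lemma fderiv_ruledStrip (t : ℝ) (w : ℝ × ℝ) : fderiv ℝ (ruledStrip c L ρ) (s, t) w =
    L s (fderiv ℝ (rulingMap g ρ) (s, t) w) := by
  have h1 : HasFDerivAt (fun y : ℝ × ℝ => c y.1) _ (s, t) :=
    (h.hasDerivAt_space hs).hasFDerivAt.comp (s, t) hasFDerivAt_fst
  have h2 : HasFDerivAt (fun y : ℝ × ℝ => L y.1 (ρ y.1)) _ (s, t) :=
    HasFDerivAt.comp (g := fun s => L s (ρ s)) (s, t)
      ((h.hasDerivAt_map hs).clm_apply (h.hasDerivAt_ruling hs)).hasFDerivAt hasFDerivAt_fst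
  have h3 := h1.add (hasFDerivAt_snd.smul h2)
  have e : HasFDerivAt (ruledStrip c L ρ) _ (s, t) := h3
  rw [e.fderiv, h.fderiv_rulingMap hs]
  simp [smul_smul, mul_comm, add_assoc, h.deriv_map_ruling s hs, ← h.map_deriv s hs]

lemma eq_zero_of_fderiv_rulingMap {w : ℝ × ℝ} (hw : fderiv ℝ (rulingMap g ρ) (s, 0) w = 0) :
    w = 0 := by
  rw [h.fderiv_rulingMap hs, zero_smul, add_zero] at hw
  have h1 := congrArg (fun v => ⟪v, rot (deriv g s)⟫) hw
  simp only [inner_add_left, inner_smul_left, inner_self_rot, h.inner_ruling s hs] at h1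
  have h2 : w.2 = 0 := by simpa using h1
  rw [h2, zero_smul, add_zero] at hw
  have h3 : deriv g s ≠ 0 := by
    rw [← norm_ne_zero_iff, h.unit_speed s hs]; norm_num
  exact Prod.ext ((smul_eq_zero.1 hw).resolve_right h3) h2

lemma eventually_injOn_rulingMap :
    ∃ U ∈ 𝓝 (s, (0 : ℝ)), InjOn (rulingMap g ρ) U ∧
      map (rulingMap g ρ) (𝓝 (s, 0)) = 𝓝 (g s) := by
  obtain ⟨j, -, -, hj, -, hmap⟩ := exists_localInverse (by simp) le_rfl
    (h.contDiffAt_rulingMap hs 0) (fun w hw => h.eq_zero_of_fderiv_rulingMap hs hw)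
  rw [rulingMap_zero] at hmap
  refine ⟨_, hj, fun y hy y' hy' he => ?_, hmap⟩
  have h1 : j (rulingMap g ρ y) = y := hy
  have h2 : j (rulingMap g ρ y') = y' := hy'
  rw [← h1, he, h2]

/-- The kernel of the derivative of `L` is the direction of the ruling. -/
lemma eq_smul_ruling {v : E2} (hv : deriv L s v = 0) :
    v = ⟪v, rot (deriv g s)⟫ • ρ s := by
  have hu := h.unit_speed s hs
  have e1 := expand_rot hu (v - ⟪v, rot (deriv g s)⟫ • ρ s)
  have e2 : ⟪v - ⟪v, rot (deriv g s)⟫ • ρ s, rot (deriv g s)⟫ = 0 := by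
    rw [inner_sub_left, inner_smul_left, h.inner_ruling s hs]; simp
  rw [e2, zero_smul, add_zero] at e1
  have e3 : deriv L s (v - ⟪v, rot (deriv g s)⟫ • ρ s) = 0 := by
    rw [map_sub, map_smul, hv, h.deriv_map_ruling s hs]; simp
  rw [e1, map_smul] at e3
  have e4 := (smul_eq_zero.1 e3).resolve_right (h.deriv_map_tangent s hs)
  rw [e4, zero_smul] at e1
  exact sub_eq_zero.1 e1

end IsRidgeFrame

/-- A `C²` isometric immersion is determined near a curve by its first derivatives along
it, provided that the normal curvature in the direction of the curve is not zero. The Gauss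
equation makes the differential `G` and the function `F - G x` constant on the level
sets of a suitable component `p` of `G`, hence functions of the point `σ` where the level set meets
the curve; differentiating `F x = c σ + L_σ (x - g σ)` shows that `x` lies on the ruling
through `g σ`. -/
lemma IsRidgeFrame.eventually_eq_ruledStrip (h : IsRidgeFrame g c L ρ J) {s₀ : ℝ} (hs₀ : s₀ ∈ J)
    {F : E2 → E3} {S : Set E2} (hS : IsOpen S) (hF : IsometricImmersionOn 2 F S)
    (hmem : g s₀ ∈ S) (hFc : ∀ᶠ s in 𝓝 s₀, F (g s) = c s)
    (hFL : ∀ᶠ s in 𝓝 s₀, fderivWithin ℝ F S (g s) = L s) :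
    ∀ᶠ y in 𝓝 (s₀, (0 : ℝ)), F (rulingMap g ρ y) = ruledStrip c L ρ y := by
  have hR := hS.isRegularDomain
  set G := fderivWithin ℝ F S with hG
  set x₀ := g s₀ with hx₀
  set v₀ := deriv g s₀ with hv₀
  set e₀ := deriv L s₀ v₀ with he₀
  have he₀0 : e₀ ≠ 0 := h.deriv_map_tangent s₀ hs₀
  have hgd := h.hasDerivAt_planar hs₀
  have hSn : S ∈ 𝓝 x₀ := hS.mem_nhds hmem
  have hGd : ∀ x ∈ S, HasFDerivAt G (sff F S x) x := fun x hx =>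
    (hF.hasFDerivWithinAt_sff hR hx).hasFDerivAt (hS.mem_nhds hx)
  have hFd : ∀ x ∈ S, HasFDerivAt F (G x) x := fun x hx =>
    (hF.hasFDerivWithinAt hx).hasFDerivAt (hS.mem_nhds hx)
  have hGc : ContDiffAt ℝ 1 G x₀ :=
    (hF.contDiffOn_fderivWithin (m := 1) hR (by norm_num)).contDiffAt hSn
  have hLd : deriv L s₀ = sff F S x₀ v₀ :=
    (((hGd x₀ hmem).comp_hasDerivAt s₀ hgd).congr_of_eventuallyEq
      (hFL.mono fun s hs => hs.symm)).deriv
  have he₀' : sff F S x₀ v₀ v₀ = e₀ := by rw [he₀, hLd]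
  set p : E2 → ℝ := fun x => ⟪G x v₀, e₀⟫ with hp
  have hpc : ContDiffAt ℝ 1 p x₀ := (hGc.clm_apply contDiffAt_const).inner ℝ contDiffAt_const
  have hpd : ∀ x ∈ S, ∀ w, fderiv ℝ p x w = ⟪sff F S x w v₀, e₀⟫ := by
    intro x hx w
    have := ((hGd x hx).clm_apply (hasFDerivAt_const v₀ x)).inner ℝ (hasFDerivAt_const e₀ x)
    rw [this.fderiv]
    simp [fderivInnerCLM_apply]
  have hp0 : fderiv ℝ p x₀ v₀ = ⟪e₀, e₀⟫ := by rw [hpd x₀ hmem, he₀']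
  have hp0' : fderiv ℝ p x₀ v₀ ≠ 0 := by rw [hp0]; exact inner_self_ne_zero.2 he₀0
  -- near `x₀` the kernel of `dp` is the kernel of the second fundamental form
  have hker : ∀ᶠ x in 𝓝 x₀, ∀ w, fderiv ℝ p x w = 0 → sff F S x w = 0 := by
    have hNe : ⟪e₀, unitNormal F S x₀⟫ ≠ 0 := by
      intro h0
      have := hF.sff_eq hR hmem v₀ v₀
      rw [he₀', h0, zero_smul] at this
      exact he₀0 this
    have hNc : ContinuousAt (unitNormal F S) x₀ :=
      (hF.contDiffOn_unitNormal (m := 1) hR (by norm_num)).continuousOn.continuousAt hSn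
    have hHc : ContinuousAt (sff F S) x₀ := (hF.continuousOn_sff hR).continuousAt hSn
    have h1 : ∀ᶠ x in 𝓝 x₀, ⟪sff F S x v₀ v₀, unitNormal F S x⟫ ≠ 0 := by
      refine (((hHc.clm_apply continuousAt_const).clm_apply continuousAt_const).inner
        hNc).eventually_ne ?_
      rwa [he₀']
    have h2 : ∀ᶠ x in 𝓝 x₀, ⟪e₀, unitNormal F S x⟫ ≠ 0 :=
      (continuousAt_const.inner hNc).eventually_ne hNe
    filter_upwards [h1, h2, hSn] with x h1 h2 hx w hw
    rw [hpd x hx, hF.sff_eq hR hx, inner_smul_left,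
      real_inner_comm e₀] at hw
    exact hF.sff_eq_zero_of_inner_eq_zero hR hx h1 ((mul_eq_zero.1 hw).resolve_right h2)
  set q : E2 → (E2 →L[ℝ] E3) × E3 := fun x => (G x, F x - G x x) with hq
  have hqd : ∀ x ∈ S, HasFDerivAt q ((sff F S x).prod
      (G x - ((G x).comp (ContinuousLinearMap.id ℝ E2) + (sff F S x).flip x))) x := by
    intro x hx
    exact (hGd x hx).prodMk ((hFd x hx).sub ((hGd x hx).clm_apply (hasFDerivAt_id x)))
  obtain ⟨U, hU, hUq⟩ := exists_nhds_eq_of_fderiv_ker (q := q) hpc hp0'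
    (by filter_upwards [hSn] with x hx using (hqd x hx).differentiableAt)
    (by
      filter_upwards [hker, hSn] with x hx hxS w hw
      rw [(hqd x hxS).fderiv]
      simp [hx w hw])
  -- the foot point of the ruling
  have hkc : ContDiffAt ℝ 1 (fun s => p (g s)) s₀ :=
    ContDiffAt.comp s₀ hpc
      ((h.contDiffOn_planar.contDiffAt (h.mem_nhds hs₀)).of_le (by norm_num))
  have hkd : HasDerivAt (fun s => p (g s)) ⟪e₀, e₀⟫ s₀ := by
    rw [← hp0]
    exact (hpc.differentiableAt (by simp)).hasFDerivAt.comp_hasDerivAt s₀ hgd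
  obtain ⟨j, hjc, hj0, hjl, hjr, -⟩ := exists_localInverse rfl le_rfl hkc (by
    intro v hv
    have : fderiv ℝ (fun s => p (g s)) s₀ v = v * ⟪e₀, e₀⟫ := by
      rw [hkd.hasFDerivAt.fderiv]; simp
    rw [this] at hv
    exact (mul_eq_zero.1 hv).resolve_right (inner_self_ne_zero.2 he₀0))
  set σ : E2 → ℝ := fun x => j (p x) with hσ
  have hσc : ContDiffAt ℝ 1 σ x₀ := ContDiffAt.comp x₀ hjc hpc
  have hσ0 : σ x₀ = s₀ := hj0
  have hσt : Tendsto σ (𝓝 x₀) (𝓝 s₀) := by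
    have := hσc.continuousAt.tendsto; rwa [hσ0] at this
  have hσ1 : fderiv ℝ σ x₀ v₀ = 1 := by
    have h1 : HasDerivAt (fun s => σ (g s)) (fderiv ℝ σ x₀ v₀) s₀ :=
      (hσc.differentiableAt (by simp)).hasFDerivAt.comp_hasDerivAt s₀ hgd
    exact h1.unique ((hasDerivAt_id s₀).congr_of_eventuallyEq hjl)
  have hσne : ∀ᶠ x in 𝓝 x₀, fderiv ℝ σ x v₀ ≠ 0 := by
    have h1 : ContinuousAt (fderiv ℝ σ) x₀ :=
      (hσc.fderiv_right (m := 0) (by norm_num)).continuousAt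
    refine (h1.clm_apply continuousAt_const).eventually_ne ?_
    rw [hσ1]; norm_num
  have hσd : ∀ᶠ x in 𝓝 x₀, DifferentiableAt ℝ σ x :=
    (hσc.eventually (by simp)).mono fun x hx => hx.differentiableAt (by simp)
  have hgσ : Tendsto (fun x => g (σ x)) (𝓝 x₀) (𝓝 x₀) := by
    have h1 : Tendsto g (𝓝 s₀) (𝓝 x₀) := hgd.continuousAt.tendsto
    exact h1.comp hσt
  have hpσ : ∀ᶠ x in 𝓝 x₀, p (g (σ x)) = p x :=
    (hpc.continuousAt.tendsto.eventually hjr)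
  have hGL : ∀ᶠ x in 𝓝 x₀, G x = L (σ x) ∧
      F x = c (σ x) + L (σ x) (x - g (σ x)) := by
    filter_upwards [hU, hgσ.eventually hU, hpσ, hσt.eventually hFL, hσt.eventually hFc]
      with x h1 h2 h3 h4 h5
    have h6 := hUq x h1 _ h2 h3.symm
    have h7 : G x = G (g (σ x)) := congrArg Prod.fst h6
    have h8 : F x - G x x = F (g (σ x)) - G (g (σ x)) (g (σ x)) := congrArg Prod.snd h6
    rw [h7, h4] at h8
    refine ⟨h7.trans h4, ?_⟩
    rw [map_sub, ← h5, ← sub_eq_zero, ← sub_eq_zero.2 h8]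
    abel
  have hline : ∀ᶠ x in 𝓝 x₀,
      x - g (σ x) = ⟪x - g (σ x), rot (deriv g (σ x))⟫ • ρ (σ x) := by
    filter_upwards [hGL.eventually_nhds, hσd, hσne, hσt.eventually (h.mem_nhds hs₀), hSn]
      with x h1 h2 h3 hJ hxS
    refine h.eq_smul_ruling hJ ?_
    have k1 := (h.hasDerivAt_space hJ).hasFDerivAt.comp x h2.hasFDerivAt
    have k2 := (h.hasDerivAt_map hJ).hasFDerivAt.comp x h2.hasFDerivAt
    have k3 := (h.hasDerivAt_planar hJ).hasFDerivAt.comp x h2.hasFDerivAt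
    have k4 := k1.add (k2.clm_apply ((hasFDerivAt_id x).sub k3))
    have k5 := (hFd x hxS).unique (k4.congr_of_eventuallyEq
      (h1.mono fun z hz => hz.2))
    have k6 := congrArg (fun M : E2 →L[ℝ] E3 => M v₀) k5
    simp only [h1.self_of_nhds.1] at k6
    simp only [add_apply, sub_apply, ContinuousLinearMap.comp_apply,
      ContinuousLinearMap.flip_apply, Function.comp_apply, map_sub,
      Pi.sub_apply, id, ContinuousLinearMap.toSpanSingleton_apply, map_smul, smul_apply,
      h.map_deriv _ hJ, ContinuousLinearMap.id_apply] at k6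
    have k7 : fderiv ℝ σ x v₀ • deriv L (σ x) (x - g (σ x)) = 0 := by
      rw [map_sub, smul_sub]
      rw [← sub_eq_zero] at k6
      rw [← neg_eq_zero, ← k6]
      abel
    exact (smul_eq_zero.1 k7).resolve_left h3
  -- transfer to the planar coordinates
  obtain ⟨V, hV, hVinj, hmap⟩ := h.eventually_injOn_rulingMap hs₀
  have hτt : Tendsto (fun x => (σ x, ⟪x - g (σ x), rot (deriv g (σ x))⟫)) (𝓝 x₀)
      (𝓝 (s₀, (0 : ℝ))) := by
    refine hσt.prodMk_nhds ?_
    have h1 : ContinuousAt (deriv g) s₀ :=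
      ((h.contDiffOn_planar.continuousOn_deriv_of_isOpen h.isOpen (by simp)).continuousAt
        (h.mem_nhds hs₀))
    have h2 : Tendsto (fun x => rot (deriv g (σ x))) (𝓝 x₀) (𝓝 (rot v₀)) :=
      (rotL.continuous.tendsto v₀).comp (h1.tendsto.comp hσt)
    have h3 : Tendsto (fun x => x - g (σ x)) (𝓝 x₀) (𝓝 (x₀ - x₀)) := tendsto_id.sub hgσ
    have := h3.inner (𝕜 := ℝ) h2
    simpa using this
  have hΦt : Tendsto (rulingMap g ρ) (𝓝 (s₀, 0)) (𝓝 x₀) := hmap.le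
  filter_upwards [hV, hΦt.eventually (hτt.eventually hV), hΦt.eventually hline,
    hΦt.eventually hGL] with y h1 h2 h3 h4
  set x := rulingMap g ρ y with hx
  have h5 : rulingMap g ρ (σ x, ⟪x - g (σ x), rot (deriv g (σ x))⟫) = x := by
    simp only [rulingMap]
    rw [← h3]; abel
  have h6 := hVinj h2 h1 (h5.trans hx)
  rw [h4.2, h3, ← h6, ruledStrip, map_smul]

end Ridge

/-! ### Darboux frames -/

section Darboux

/-- `n` is a `C¹` unit normal field along the `C²` arc-length parametrized space curve `c`. -/
structure IsUnitNormalAlong (c n : ℝ → E3) (J : Set ℝ) : Prop where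
  isOpen : IsOpen J
  contDiffOn_curve : ContDiffOn ℝ 2 c J
  contDiffOn_normal : ContDiffOn ℝ 1 n J
  tangent_unit : ∀ s ∈ J, ⟪deriv c s, deriv c s⟫ = 1
  normal_unit : ∀ s ∈ J, ⟪n s, n s⟫ = 1
  tangent_normal : ∀ s ∈ J, ⟪deriv c s, n s⟫ = 0

variable {c n : ℝ → E3} {J : Set ℝ}

namespace IsUnitNormalAlong

variable (h : IsUnitNormalAlong c n J) {s : ℝ} (hs : s ∈ J)
include h hs

lemma isONFrame : IsONFrame (deriv c s) (conormal c n s) (n s) :=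
  isONFrame_cross (h.tangent_unit s hs) (h.normal_unit s hs) (h.tangent_normal s hs)

lemma differentiableAt_tangent : DifferentiableAt ℝ (deriv c) s :=
  ((h.contDiffOn_curve.deriv_of_isOpen (m := 1) h.isOpen (by norm_num)).contDiffAt
    (h.isOpen.mem_nhds hs)).differentiableAt (by simp)

lemma differentiableAt_normal : DifferentiableAt ℝ n s :=
  (h.contDiffOn_normal.contDiffAt (h.isOpen.mem_nhds hs)).differentiableAt (by simp)

lemma differentiableAt_conormal : DifferentiableAt ℝ (conormal c n) s := by
  have h1 := crossL.differentiableAt.comp s (h.differentiableAt_normal hs)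
  exact h1.clm_apply (h.differentiableAt_tangent hs)

/-- `T' = k_g u + k_n n`. -/
lemma hasDerivAt_tangent : HasDerivAt (deriv c)
    (geodesicCurvature c n s • conormal c n s + normalCurvature c n s • n s) s := by
  have hT := (h.differentiableAt_tangent hs).hasDerivAt
  refine hT.congr_deriv ?_
  have h1 : ⟪deriv (deriv c) s, deriv c s⟫ = 0 := by
    have k1 := hT.inner ℝ hT
    have k2 : HasDerivAt (fun t => ⟪deriv c t, deriv c t⟫) 0 s :=
      (hasDerivAt_const s (1 : ℝ)).congr_of_eventuallyEq (by
        filter_upwards [h.isOpen.mem_nhds hs] with t ht using h.tangent_unit t ht)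
    have := k1.unique k2
    rw [real_inner_comm (deriv (deriv c) s)] at this
    linarith
  rw [(h.isONFrame hs).expand (deriv (deriv c) s), h1, zero_smul, zero_add]; rfl

/-- `n' = -k_n T - τ_r u`. -/
lemma hasDerivAt_normal : HasDerivAt n
    (-normalCurvature c n s • deriv c s - relativeTorsion c n s • conormal c n s) s := by
  have hT := (h.differentiableAt_tangent hs).hasDerivAt
  have hn := (h.differentiableAt_normal hs).hasDerivAt
  have hu := (h.differentiableAt_conormal hs).hasDerivAt
  refine hn.congr_deriv ?_
  have h1 : ⟪deriv n s, n s⟫ = 0 := by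
    have k1 := hn.inner ℝ hn
    have k2 : HasDerivAt (fun t => ⟪n t, n t⟫) 0 s :=
      (hasDerivAt_const s (1 : ℝ)).congr_of_eventuallyEq (by
        filter_upwards [h.isOpen.mem_nhds hs] with t ht using h.normal_unit t ht)
    have := k1.unique k2
    rw [real_inner_comm (deriv n s)] at this
    linarith
  have h2 : ⟪deriv n s, deriv c s⟫ = - normalCurvature c n s := by
    have k1 := hT.inner ℝ hn
    have k2 : HasDerivAt (fun t => ⟪deriv c t, n t⟫) 0 s :=
      (hasDerivAt_const s (0 : ℝ)).congr_of_eventuallyEq (by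
        filter_upwards [h.isOpen.mem_nhds hs] with t ht using h.tangent_normal t ht)
    have := k1.unique k2
    rw [real_inner_comm] at this
    rw [normalCurvature]; linarith
  have h3 : ⟪deriv n s, conormal c n s⟫ = - relativeTorsion c n s := by
    have k1 := hu.inner ℝ hn
    have k2 : HasDerivAt (fun t => ⟪conormal c n t, n t⟫) 0 s :=
      (hasDerivAt_const s (0 : ℝ)).congr_of_eventuallyEq (by
        filter_upwards [h.isOpen.mem_nhds hs] with t ht using (h.isONFrame ht).un)
    have := k1.unique k2
    rw [real_inner_comm] at this
    rw [relativeTorsion]; linarith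
  rw [(h.isONFrame hs).expand (deriv n s), h1, h2, h3]
  module

/-- `u' = -k_g T + τ_r n`. -/
lemma hasDerivAt_conormal : HasDerivAt (conormal c n)
    (-geodesicCurvature c n s • deriv c s + relativeTorsion c n s • n s) s := by
  have hT := (h.differentiableAt_tangent hs).hasDerivAt
  have hu := (h.differentiableAt_conormal hs).hasDerivAt
  refine hu.congr_deriv ?_
  have h1 : ⟪deriv (conormal c n) s, conormal c n s⟫ = 0 := by
    have k1 := hu.inner ℝ hu
    have k2 : HasDerivAt (fun t => ⟪conormal c n t, conormal c n t⟫) 0 s :=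
      (hasDerivAt_const s (1 : ℝ)).congr_of_eventuallyEq (by
        filter_upwards [h.isOpen.mem_nhds hs] with t ht using (h.isONFrame ht).uu)
    have := k1.unique k2
    rw [real_inner_comm (deriv (conormal c n) s)] at this
    linarith
  have h2 : ⟪deriv (conormal c n) s, deriv c s⟫ = - geodesicCurvature c n s := by
    have k1 := hT.inner ℝ hu
    have k2 : HasDerivAt (fun t => ⟪deriv c t, conormal c n t⟫) 0 s :=
      (hasDerivAt_const s (0 : ℝ)).congr_of_eventuallyEq (by
        filter_upwards [h.isOpen.mem_nhds hs] with t ht using (h.isONFrame ht).Tu)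
    have := k1.unique k2
    rw [real_inner_comm] at this
    rw [geodesicCurvature]; linarith
  rw [(h.isONFrame hs).expand (deriv (conormal c n) s), h1, h2, zero_smul, add_zero]; rfl

/-- The curvature of the curve is composed of its geodesic and its normal curvature. -/
lemma norm_sq_deriv_tangent : ‖deriv (deriv c) s‖ ^ 2 =
    geodesicCurvature c n s ^ 2 + normalCurvature c n s ^ 2 := by
  have f := h.isONFrame hs
  rw [(h.hasDerivAt_tangent hs).deriv, ← real_inner_self_eq_norm_sq]
  simp only [inner_add_left, inner_add_right, inner_smul_left, inner_smul_right, f.uu, f.nn, f.un,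
    real_inner_comm (conormal c n s) (n s)]
  simp; ring

end IsUnitNormalAlong

/-- The Frenet equation of an arc-length parametrized plane curve. -/
lemma hasDerivAt_deriv_planar {g : ℝ → E2} {s : ℝ} (hd : DifferentiableAt ℝ (deriv g) s)
    (hu : ∀ᶠ t in 𝓝 s, ‖deriv g t‖ = 1) :
    HasDerivAt (deriv g) (planarCurvature g s • rot (deriv g s)) s := by
  have hT := hd.hasDerivAt
  refine hT.congr_deriv ?_
  have h1 : ⟪deriv (deriv g) s, deriv g s⟫ = 0 := by
    have k1 := hT.inner ℝ hT
    have k2 : HasDerivAt (fun t => ⟪deriv g t, deriv g t⟫) 0 s :=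
      (hasDerivAt_const s (1 : ℝ)).congr_of_eventuallyEq (by
        filter_upwards [hu] with t ht
        rw [real_inner_self_eq_norm_sq, ht]; norm_num)
    have := k1.unique k2
    rw [real_inner_comm (deriv (deriv g) s)] at this
    linarith
  rw [expand_rot hu.self_of_nhds (deriv (deriv g) s), h1, zero_smul, zero_add]; rfl

end Darboux

/-! ### The strip with prescribed normal -/

section RidgeData

/-- A plane curve `g` and a space curve `c` with a unit normal field `n`, such that the curvature
of `g` is the geodesic curvature of `c`, and the normal curvature of `c` does not vanish. -/
structure IsRidgeData (g : ℝ → E2) (c n : ℝ → E3) (J : Set ℝ) : Prop where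
  isOpen : IsOpen J
  contDiffOn_planar : ContDiffOn ℝ 3 g J
  contDiffOn_space : ContDiffOn ℝ 3 c J
  contDiffOn_normal : ContDiffOn ℝ 2 n J
  unit_planar : ∀ s ∈ J, ‖deriv g s‖ = 1
  tangent_unit : ∀ s ∈ J, ⟪deriv c s, deriv c s⟫ = 1
  normal_unit : ∀ s ∈ J, ⟪n s, n s⟫ = 1
  tangent_normal : ∀ s ∈ J, ⟪deriv c s, n s⟫ = 0
  curvature_eq : ∀ s ∈ J, planarCurvature g s = geodesicCurvature c n s
  normalCurvature_ne : ∀ s ∈ J, normalCurvature c n s ≠ 0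

/-- The linear isometry that takes the frame of `g` to the frame of `c` and its conormal. -/
noncomputable def ridgeMap (g : ℝ → E2) (c n : ℝ → E3) (s : ℝ) : E2 →L[ℝ] E3 :=
  (innerSL ℝ (deriv g s)).smulRight (deriv c s) +
    (innerSL ℝ (rot (deriv g s))).smulRight (conormal c n s)

/-- The direction of the rulings of the developable through `c` with normal `n`, unrolled. -/
noncomputable def ridgeRuling (g : ℝ → E2) (c n : ℝ → E3) (s : ℝ) : E2 :=
  rot (deriv g s) - (relativeTorsion c n s / normalCurvature c n s) • deriv g s

variable {g : ℝ → E2} {c n : ℝ → E3} {J : Set ℝ}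

lemma IsRidgeData.isUnitNormalAlong (h : IsRidgeData g c n J) : IsUnitNormalAlong c n J :=
  ⟨h.isOpen, h.contDiffOn_space.of_le (by norm_num), h.contDiffOn_normal.of_le (by norm_num),
    h.tangent_unit, h.normal_unit, h.tangent_normal⟩

lemma ridgeMap_apply (s : ℝ) (v : E2) : ridgeMap g c n s v =
    ⟪deriv g s, v⟫ • deriv c s + ⟪rot (deriv g s), v⟫ • conormal c n s := by
  simp [ridgeMap]

lemma contDiffOn_conormal {m : WithTop ℕ∞} (hJ : IsOpen J) (hc : ContDiffOn ℝ (m + 1) c J)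
    (hn : ContDiffOn ℝ m n J) : ContDiffOn ℝ m (conormal c n) J :=
  (crossL.contDiff.comp_contDiffOn hn).clm_apply (hc.deriv_of_isOpen hJ le_rfl)

lemma contDiffOn_geodesicCurvature {m : WithTop ℕ∞} (hJ : IsOpen J)
    (hc : ContDiffOn ℝ (m + 2) c J) (hn : ContDiffOn ℝ m n J) :
    ContDiffOn ℝ m (geodesicCurvature c n) J := by
  have h1 : ContDiffOn ℝ (m + 1) (deriv c) J :=
    hc.deriv_of_isOpen hJ (by rw [add_assoc, one_add_one_eq_two])
  have h2 := h1.deriv_of_isOpen (m := m) hJ le_rfl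
  exact h2.inner ℝ ((crossL.contDiff.comp_contDiffOn hn).clm_apply (h1.of_le le_self_add))

lemma contDiffOn_normalCurvature {m : WithTop ℕ∞} (hJ : IsOpen J)
    (hc : ContDiffOn ℝ (m + 2) c J) (hn : ContDiffOn ℝ m n J) :
    ContDiffOn ℝ m (normalCurvature c n) J := by
  have h1 : ContDiffOn ℝ (m + 1) (deriv c) J :=
    hc.deriv_of_isOpen hJ (by rw [add_assoc, one_add_one_eq_two])
  exact (h1.deriv_of_isOpen (m := m) hJ le_rfl).inner ℝ hn

lemma contDiffOn_relativeTorsion {m : WithTop ℕ∞} (hJ : IsOpen J)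
    (hc : ContDiffOn ℝ (m + 2) c J) (hn : ContDiffOn ℝ (m + 1) n J) :
    ContDiffOn ℝ m (relativeTorsion c n) J := by
  have h1 : ContDiffOn ℝ (m + 1) (conormal c n) J :=
    contDiffOn_conormal hJ (hc.of_le (by rw [add_assoc, one_add_one_eq_two])) hn
  exact (h1.deriv_of_isOpen (m := m) hJ le_rfl).inner ℝ (hn.of_le le_self_add)

/-- The developable strip through `c` with normal `n`: its ruling direction is found from
`L' v = (k_n ⟨v, g'⟩ + τ_r ⟨v, rot g'⟩) n`. -/
lemma IsRidgeData.isRidgeFrame (h : IsRidgeData g c n J) :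
    IsRidgeFrame g c (ridgeMap g c n) (ridgeRuling g c n) J := by
  have hJ := h.isOpen
  have hN := h.isUnitNormalAlong
  have hg1 : ContDiffOn ℝ 2 (deriv g) J :=
    h.contDiffOn_planar.deriv_of_isOpen hJ (by norm_num)
  have hc1 : ContDiffOn ℝ 2 (deriv c) J :=
    h.contDiffOn_space.deriv_of_isOpen hJ (by norm_num)
  have hr1 : ContDiffOn ℝ 2 (fun s => rot (deriv g s)) J := rotL.contDiff.comp_contDiffOn hg1
  have hu1 : ContDiffOn ℝ 2 (conormal c n) J :=
    contDiffOn_conormal hJ (h.contDiffOn_space.of_le (by norm_num)) h.contDiffOn_normal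
  have hd : ∀ s ∈ J, ∀ v, deriv (ridgeMap g c n) s v = (normalCurvature c n s * ⟪v, deriv g s⟫ +
      relativeTorsion c n s * ⟪v, rot (deriv g s)⟫) • n s := by
    intro s hs v
    have hgd := hasDerivAt_deriv_planar
      ((hg1.contDiffAt (hJ.mem_nhds hs)).differentiableAt (by simp))
      (by filter_upwards [hJ.mem_nhds hs] with t ht using h.unit_planar t ht)
    have hrd := rotL.hasFDerivAt.comp_hasDerivAt s hgd
    have k1 := (hgd.inner ℝ (hasDerivAt_const s v)).smul (hN.hasDerivAt_tangent hs)
    have k2 := (hrd.inner ℝ (hasDerivAt_const s v)).smul (hN.hasDerivAt_conormal hs)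
    have hdiff : DifferentiableAt ℝ (ridgeMap g c n) s := by
      refine ((?_ : ContDiffAt ℝ 1 (ridgeMap g c n) s)).differentiableAt (by simp)
      have e1 := ((innerSL ℝ : E2 →L[ℝ] E2 →L[ℝ] ℝ).contDiff.comp_contDiffOn hg1).smulRight hc1
      have e2 := ((innerSL ℝ : E2 →L[ℝ] E2 →L[ℝ] ℝ).contDiff.comp_contDiffOn hr1).smulRight hu1
      exact ((e1.add e2).contDiffAt (hJ.mem_nhds hs)).of_le (by norm_num)
    have k3 := hdiff.hasDerivAt.clm_apply (hasDerivAt_const s v)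
    have k4 := k3.unique ((k1.add k2).congr_of_eventuallyEq
      (.of_eq (funext fun t => ridgeMap_apply t v)))
    simp only [map_zero, add_zero] at k4
    rw [k4]
    simp only [rotL_apply, Function.comp_apply, map_smul, rot_rot, inner_zero_right,
      inner_neg_right, inner_smul_right, zero_add, h.curvature_eq s hs, real_inner_comm v]
    module
  refine ⟨hJ, h.contDiffOn_planar.of_le (by norm_num), h.contDiffOn_space.of_le (by norm_num),
    ?_, ?_, h.unit_planar, ?_, ?_, ?_, ?_, ?_⟩
  · have e1 := ((innerSL ℝ : E2 →L[ℝ] E2 →L[ℝ] ℝ).contDiff.comp_contDiffOn hg1).smulRight hc1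
    have e2 := ((innerSL ℝ : E2 →L[ℝ] E2 →L[ℝ] ℝ).contDiff.comp_contDiffOn hr1).smulRight hu1
    exact (e1.add e2).of_le (by norm_num)
  · have e1 : ContDiffOn ℝ 1 (relativeTorsion c n) J :=
      contDiffOn_relativeTorsion hJ (h.contDiffOn_space.of_le (by norm_num))
        (h.contDiffOn_normal.of_le (by norm_num))
    have e2 : ContDiffOn ℝ 1 (normalCurvature c n) J :=
      contDiffOn_normalCurvature hJ (h.contDiffOn_space.of_le (by norm_num))
        (h.contDiffOn_normal.of_le (by norm_num))
    exact (hr1.of_le (by norm_num)).sub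
      ((e1.div e2 h.normalCurvature_ne).smul (hg1.of_le (by norm_num)))
  · intro s hs v
    have f := hN.isONFrame hs
    have e1 : ‖ridgeMap g c n s v‖ ^ 2 = ‖v‖ ^ 2 := by
      rw [← real_inner_self_eq_norm_sq, ← real_inner_self_eq_norm_sq, ridgeMap_apply]
      conv_rhs => rw [expand_rot (h.unit_planar s hs) v]
      have k : ⟪deriv g s, deriv g s⟫ = 1 := by
        rw [real_inner_self_eq_norm_sq, h.unit_planar s hs]; norm_num
      simp only [inner_add_left, inner_add_right, inner_smul_left, inner_smul_right, f.TT, f.uu,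
        f.Tu, real_inner_comm (deriv c s) (conormal c n s), inner_rot_rot, inner_rot_self,
        inner_self_rot, k, real_inner_comm v]
    exact (sq_eq_sq₀ (norm_nonneg _) (norm_nonneg _)).1 e1
  · intro s hs
    rw [ridgeMap_apply, real_inner_self_eq_norm_sq, h.unit_planar s hs, inner_rot_self]; simp
  · intro s hs
    have k : ⟪deriv g s, deriv g s⟫ = 1 := by
      rw [real_inner_self_eq_norm_sq, h.unit_planar s hs]; norm_num
    have hk := h.normalCurvature_ne s hs
    rw [hd s hs, ridgeRuling]
    simp only [inner_sub_left, inner_smul_left, inner_rot_self, inner_rot_rot, inner_self_rot, k]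
    simp only [conj_trivial]
    rw [show normalCurvature c n s * (0 - relativeTorsion c n s / normalCurvature c n s * 1) +
      relativeTorsion c n s * (1 - relativeTorsion c n s / normalCurvature c n s * 0) = 0 by
        field_simp; ring, zero_smul]
  · intro s hs
    have k : ⟪deriv g s, deriv g s⟫ = 1 := by
      rw [real_inner_self_eq_norm_sq, h.unit_planar s hs]; norm_num
    rw [hd s hs, k, inner_self_rot, mul_zero, mul_one, add_zero]
    refine smul_ne_zero (h.normalCurvature_ne s hs) ?_
    intro h0
    have := h.normal_unit s hs
    rw [h0] at this; simp at this
  · intro s hs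
    have k : ⟪deriv g s, deriv g s⟫ = 1 := by
      rw [real_inner_self_eq_norm_sq, h.unit_planar s hs]; norm_num
    rw [ridgeRuling, inner_sub_left, inner_smul_left, inner_rot_rot, inner_self_rot, k]; simp

/-- The strip in space does not depend on the way it is unrolled. -/
lemma IsRidgeData.ruledStrip_eq (h : IsRidgeData g c n J) {y : ℝ × ℝ} (hy : y.1 ∈ J) :
    ruledStrip c (ridgeMap g c n) (ridgeRuling g c n) y = c y.1 + y.2 • (conormal c n y.1 -
      (relativeTorsion c n y.1 / normalCurvature c n y.1) • deriv c y.1) := by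
  have k : ⟪deriv g y.1, deriv g y.1⟫ = 1 := by
    rw [real_inner_self_eq_norm_sq, h.unit_planar _ hy]; norm_num
  rw [ruledStrip, ridgeMap_apply, ridgeRuling]
  simp only [inner_sub_right, inner_smul_right, inner_rot_rot, inner_self_rot, inner_rot_self, k]
  congr 2
  module

end RidgeData

/-! ### The two sides of a foldline -/

section Sheet

/-- A sheet of paper divided by the curve `g` into the sides `A` and `B`; the side `A` is to the
left of the curve if `ε = 1`, and to its right if `ε = -1`. -/
structure IsSheet (g : ℝ → E2) (J : Set ℝ) (ε : ℝ) (A B : Set E2) : Prop where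
  isOpen_A : IsOpen A
  isOpen_B : IsOpen B
  isOpen_sheet : IsOpen (A ∪ g '' J ∪ B)
  disjoint : Disjoint A B
  disjoint_A : Disjoint A (g '' J)
  disjoint_B : Disjoint B (g '' J)
  sides : ∀ s ∈ J, ∀ᶠ t in 𝓝[>] (0 : ℝ),
    g s + (ε * t) • rot (deriv g s) ∈ A ∧ g s - (ε * t) • rot (deriv g s) ∈ B

/-- A regular arc-length parametrized plane curve that is embedded: the parameter depends
continuously on the point. -/
structure IsEmbeddedArc (g : ℝ → E2) (J : Set ℝ) : Prop where
  isOpen : IsOpen J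
  contDiffOn : ContDiffOn ℝ 2 g J
  unit_speed : ∀ s ∈ J, ‖deriv g s‖ = 1
  embedded : ∀ s ∈ J, ∀ δ > 0, ∃ η > 0, ∀ s' ∈ J, dist (g s') (g s) < η → dist s' s < δ

variable {g : ℝ → E2} {J : Set ℝ} {ε : ℝ} {A B : Set E2}

lemma IsProperFold.isSheet {c : ℝ → E3} {F : E2 → E3} (h : IsProperFold g c J ε A B F) :
    IsSheet g J ε A B :=
  ⟨h.isOpen_A, h.isOpen_B, h.isOpen_sheet, h.disjoint, h.disjoint_A, h.disjoint_B, h.sides⟩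

lemma IsSheet.swap (h : IsSheet g J ε A B) : IsSheet g J (-ε) B A := by
  refine ⟨h.isOpen_B, h.isOpen_A, ?_, h.disjoint.symm, h.disjoint_B, h.disjoint_A, ?_⟩
  · have := h.isOpen_sheet
    rwa [show B ∪ g '' J ∪ A = A ∪ g '' J ∪ B by
      rw [union_comm, union_comm B, union_assoc]]
  · intro s hs
    filter_upwards [h.sides s hs] with t ht
    rw [neg_mul, neg_smul, ← sub_eq_add_neg, sub_neg_eq_add]
    exact ht.symm

lemma isEmbeddedArc_of_isEmbedding (hJ : IsOpen J) (hg : ContDiffOn ℝ 2 g J)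
    (hu : ∀ s ∈ J, ‖deriv g s‖ = 1) (he : IsEmbedding (fun t : J => g t)) :
    IsEmbeddedArc g J := by
  refine ⟨hJ, hg, hu, fun s hs δ hδ => ?_⟩
  have h1 : Metric.ball (⟨s, hs⟩ : J) δ ∈ 𝓝 (⟨s, hs⟩ : J) := Metric.ball_mem_nhds _ hδ
  rw [he.nhds_eq_comap, mem_comap] at h1
  obtain ⟨U, hU, hsub⟩ := h1
  obtain ⟨η, hη, hball⟩ := Metric.mem_nhds_iff.1 hU
  exact ⟨η, hη, fun s' hs' hd => hsub (show (⟨s', hs'⟩ : J) ∈ (fun t : J => g t) ⁻¹' U from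
    hball hd)⟩

/-- Near a point of an embedded curve, the points in transversal directions within a fixed cone
do not lie on the curve. -/
lemma IsEmbeddedArc.exists_notMem_image (h : IsEmbeddedArc g J) {s₀ : ℝ} (hs₀ : s₀ ∈ J) {M : ℝ}
    (hM : 0 ≤ M) {U : Set E2} (hU : U ∈ 𝓝 (g s₀)) :
    ∃ δ > 0, ∀ s t m : ℝ, dist s s₀ < δ → |t| < δ → |m| ≤ M →
      s ∈ J ∧ g s + t • (rot (deriv g s) + m • deriv g s) ∈ U ∧
        (t ≠ 0 → g s + t • (rot (deriv g s) + m • deriv g s) ∉ g '' J) := by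
  have hJn := h.isOpen.mem_nhds hs₀
  have hc : ContDiffAt ℝ 1 g s₀ := (h.contDiffOn.contDiffAt hJn).of_le (by norm_num)
  -- then `2 η (1 + M) = 1 / 2`, so that the error of the linear approximation is absorbed
  set η : ℝ := 1 / (4 * (1 + M)) with hη
  have hηpos : 0 < η := by positivity
  have hstrict : HasStrictDerivAt g (deriv g s₀) s₀ := hc.hasStrictDerivAt (by simp)
  have h1 := hstrict.isLittleO.def hηpos
  obtain ⟨δ₁, hδ₁, h1⟩ := Metric.eventually_nhds_iff.1 h1
  have hdc : ContinuousAt (deriv g) s₀ :=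
    (h.contDiffOn.continuousOn_deriv_of_isOpen h.isOpen (by simp)).continuousAt hJn
  obtain ⟨δ₂, hδ₂, h2⟩ := Metric.continuousAt_iff.1 hdc η hηpos
  obtain ⟨δ₃, hδ₃, h3⟩ := Metric.mem_nhds_iff.1 hJn
  obtain ⟨r, hr, h4⟩ := Metric.mem_nhds_iff.1 hU
  obtain ⟨η', hη', h5⟩ := h.embedded s₀ hs₀ δ₁ hδ₁
  have hr' : 0 < min r η' := lt_min hr hη'
  obtain ⟨δ₄, hδ₄, h6⟩ := Metric.continuousAt_iff.1 hc.continuousAt (min r η' / 2) (by positivity)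
  refine ⟨min (min δ₁ δ₂) (min δ₃ (min δ₄ (min r η' / (2 * (1 + M))))), by positivity, ?_⟩
  intro s t m hs ht hm
  simp only [lt_min_iff] at hs ht
  obtain ⟨⟨hs1, hs2⟩, hs3, hs4, -⟩ := hs
  obtain ⟨-, -, -, ht5⟩ := ht
  have hsJ : s ∈ J := h3 hs3
  have hu := h.unit_speed s hsJ
  have hnear : dist (g s + t • (rot (deriv g s) + m • deriv g s)) (g s₀) < min r η' := by
    have e1 : ‖t • (rot (deriv g s) + m • deriv g s)‖ ≤ |t| * (1 + M) := by
      rw [norm_smul, Real.norm_eq_abs]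
      refine mul_le_mul_of_nonneg_left ?_ (abs_nonneg _)
      refine (norm_add_le _ _).trans ?_
      rw [norm_rot, norm_smul, hu, mul_one, Real.norm_eq_abs]; linarith
    have hpos : 0 < 1 + M := by linarith
    have e2 : |t| * (1 + M) < min r η' / 2 := by
      rw [lt_div_iff₀ (by positivity)] at ht5
      linarith
    have e3 := h6 hs4
    have e4 : dist (g s + t • (rot (deriv g s) + m • deriv g s)) (g s₀) ≤
        ‖t • (rot (deriv g s) + m • deriv g s)‖ + dist (g s) (g s₀) := by
      rw [dist_eq_norm, dist_eq_norm, add_sub_right_comm, add_comm]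
      exact norm_add_le _ _
    linarith
  refine ⟨hsJ, h4 (hnear.trans_le (min_le_left _ _)), ?_⟩
  rintro ht0 ⟨a, haJ, ha⟩
  have ha1 : dist a s₀ < δ₁ := h5 a haJ (by rw [ha]; exact hnear.trans_le (min_le_right _ _))
  have k1 : ‖g a - g s - (a - s) • deriv g s₀‖ ≤ η * ‖a - s‖ :=
    h1 (y := (a, s)) (by rw [Prod.dist_eq]; exact max_lt ha1 hs1)
  have k2 : ‖deriv g s - deriv g s₀‖ ≤ η := by
    rw [← dist_eq_norm]; exact (h2 hs2).le
  have hd : g a - g s = t • (rot (deriv g s) + m • deriv g s) := by rw [ha]; abel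
  have k3 : ‖g a - g s - (a - s) • deriv g s‖ ≤ 2 * η * |a - s| := by
    have e : g a - g s - (a - s) • deriv g s = (g a - g s - (a - s) • deriv g s₀) -
        (a - s) • (deriv g s - deriv g s₀) := by module
    rw [e]
    refine (norm_sub_le _ _).trans ?_
    rw [norm_smul, ← Real.norm_eq_abs]
    have := mul_le_mul_of_nonneg_left k2 (norm_nonneg (a - s))
    linarith
  have hTT : ⟪deriv g s, deriv g s⟫ = 1 := by rw [real_inner_self_eq_norm_sq, hu]; norm_num
  rw [hd] at k3
  have k4 : |t| ≤ 2 * η * |a - s| := by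
    have e1 := abs_real_inner_le_norm (t • (rot (deriv g s) + m • deriv g s) -
      (a - s) • deriv g s) (rot (deriv g s))
    rw [norm_rot, hu, mul_one] at e1
    simp only [inner_sub_left, inner_smul_left, inner_add_left, inner_rot_rot, inner_self_rot,
      hTT] at e1
    simp only [conj_trivial, mul_zero, add_zero, mul_one, sub_zero] at e1
    exact e1.trans k3
  have k5 : |t * m - (a - s)| ≤ 2 * η * |a - s| := by
    have e1 := abs_real_inner_le_norm (t • (rot (deriv g s) + m • deriv g s) -
      (a - s) • deriv g s) (deriv g s)
    rw [hu, mul_one] at e1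
    simp only [inner_sub_left, inner_smul_left, inner_add_left, inner_rot_self,
      hTT] at e1
    simp only [conj_trivial, zero_add, mul_one] at e1
    exact e1.trans k3
  have k6 : |a - s| ≤ |t| * M + 2 * η * |a - s| := by
    have e1 : |a - s| ≤ |t * m| + |t * m - (a - s)| := by
      have := abs_sub (t * m) (t * m - (a - s))
      rwa [sub_sub_cancel] at this
    rw [abs_mul] at e1
    have := mul_le_mul_of_nonneg_left hm (abs_nonneg t)
    linarith
  have k7 : 2 * η * (1 + M) = 1 / 2 := by rw [hη]; field_simp; norm_num
  have k8 : |a - s| ≤ (2 * η * (1 + M)) * |a - s| := by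
    have := mul_le_mul_of_nonneg_right k4 hM
    linarith
  rw [k7] at k8
  have k9 : |a - s| = 0 := le_antisymm (by linarith) (abs_nonneg _)
  rw [k9, mul_zero] at k4
  exact ht0 (abs_eq_zero.1 (le_antisymm k4 (abs_nonneg _)))

/-- Near the foldline, the side `A` consists of the points on the side of the sign `ε`: the half
cone of these points is connected and avoids the foldline. -/
lemma IsSheet.eventually_mem (hsh : IsSheet g J ε A B) (h : IsEmbeddedArc g J)
    (hε : ε = 1 ∨ ε = -1) {s₀ : ℝ} (hs₀ : s₀ ∈ J) (M : ℝ) :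
    ∀ᶠ y in 𝓝 (s₀, (0 : ℝ)), ∀ m, |m| ≤ M → 0 < ε * y.2 →
      g y.1 + y.2 • (rot (deriv g y.1) + m • deriv g y.1) ∈ A := by
  have hM : 0 ≤ |M| := abs_nonneg M
  have hεε : ε * ε = 1 := by rcases hε with rfl | rfl <;> norm_num
  have hεa : |ε| = 1 := by rcases hε with rfl | rfl <;> simp
  obtain ⟨δ, hδ, hcone⟩ := h.exists_notMem_image hs₀ hM
    (hsh.isOpen_sheet.mem_nhds (Or.inl (Or.inr ⟨s₀, hs₀, rfl⟩)))
  set Ψ : ℝ × ℝ × ℝ → E2 := fun z =>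
    g z.1 + z.2.1 • (rot (deriv g z.1) + z.2.2 • deriv g z.1) with hΨ
  set Q : Set (ℝ × ℝ × ℝ) := Metric.ball s₀ δ ×ˢ ((fun t => ε * t) ⁻¹' Ioo 0 δ) ×ˢ Icc (-|M|) |M|
    with hQ
  have hQc : Convex ℝ Q := by
    refine (convex_ball s₀ δ).prod (Convex.prod ?_ (convex_Icc _ _))
    exact (convex_Ioo (0 : ℝ) δ).linear_preimage (LinearMap.mul ℝ ℝ ε)
  have habs : ∀ t, ε * t ∈ Ioo 0 δ → |t| < δ ∧ t ≠ 0 := by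
    intro t ht
    have : |t| = |ε * t| := by rw [abs_mul, hεa, one_mul]
    rw [this, abs_of_pos ht.1]
    refine ⟨ht.2, ?_⟩
    rintro rfl
    simpa using ht.1
  have hΨc : ContinuousOn Ψ Q := by
    have hdg : ContinuousOn (deriv g) J := h.contDiffOn.continuousOn_deriv_of_isOpen h.isOpen
      (by simp)
    have hm : MapsTo (fun z : ℝ × ℝ × ℝ => z.1) Q J := by
      rintro ⟨s, t, m⟩ ⟨h1, -, -⟩
      exact (hcone s 0 0 h1 (by simpa using hδ) (by simp)).1
    have e1 := h.contDiffOn.continuousOn.comp continuousOn_fst hm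
    have e2 := hdg.comp continuousOn_fst hm
    have e3 := rotL.continuous.comp_continuousOn e2
    exact e1.add ((continuous_fst.comp continuous_snd).continuousOn.smul
      (e3.add ((continuous_snd.comp continuous_snd).continuousOn.smul e2)))
  have hpre : IsPreconnected (Ψ '' Q) := hQc.isPreconnected.image _ hΨc
  have hsub : Ψ '' Q ⊆ A ∪ B := by
    rintro _ ⟨⟨s, t, m⟩, ⟨h1, h2, h3⟩, rfl⟩
    obtain ⟨-, h4, h5⟩ := hcone s t m h1 (habs t h2).1 (abs_le.2 h3)
    rcases h4 with (h4 | h4) | h4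
    · exact Or.inl h4
    · exact absurd h4 (h5 (habs t h2).2)
    · exact Or.inr h4
  have hne : (Ψ '' Q ∩ A).Nonempty := by
    have hsm : ∀ᶠ t in 𝓝[>] (0 : ℝ), t < δ :=
      (eventually_lt_nhds hδ).filter_mono nhdsWithin_le_nhds
    obtain ⟨t, ⟨ht1, ht2⟩, ht3⟩ := ((hsh.sides s₀ hs₀).and hsm |>.and self_mem_nhdsWithin).exists
    refine ⟨_, ⟨(s₀, ε * t, 0), ⟨Metric.mem_ball_self hδ, ?_, ?_⟩, rfl⟩, ?_⟩
    · show ε * (ε * t) ∈ Ioo 0 δ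
      rw [← mul_assoc, hεε, one_mul]; exact ⟨ht3, ht2⟩
    · exact ⟨by simp, hM⟩
    · simpa [hΨ] using ht1.1
  have hall := hpre.subset_left_of_subset_union hsh.isOpen_A hsh.isOpen_B hsh.disjoint hsub hne
  have hnhds : Metric.ball s₀ δ ×ˢ Metric.ball (0 : ℝ) δ ∈ 𝓝 (s₀, (0 : ℝ)) :=
    prod_mem_nhds (Metric.ball_mem_nhds _ hδ) (Metric.ball_mem_nhds _ hδ)
  filter_upwards [hnhds] with y hy m hm hpos
  refine hall ⟨(y.1, y.2, m), ⟨hy.1, ⟨hpos, ?_⟩, abs_le.1 (hm.trans (le_abs_self M))⟩, rfl⟩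
  have h1 : |y.2| < δ := by simpa [Real.dist_eq] using hy.2
  calc ε * y.2 ≤ |ε * y.2| := le_abs_self _
    _ = |y.2| := by rw [abs_mul, hεa, one_mul]
    _ < δ := h1

/-- A side of a sheet, together with the foldline, admits calculus up to the foldline. -/
lemma IsSheet.isRegularDomain (hsh : IsSheet g J ε A B) (h : IsEmbeddedArc g J)
    (hε : ε = 1 ∨ ε = -1) : IsRegularDomain (A ∪ g '' J) := by
  have hεε : ε * ε = 1 := by rcases hε with rfl | rfl <;> norm_num
  have key : ∀ s ∈ J, ∀ m : ℝ, |m| ≤ 1 → ∀ᶠ t in 𝓝[>] (0 : ℝ),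
      g s + t • (ε • (rot (deriv g s) + m • deriv g s)) ∈ A := by
    intro s hs m hm
    have h1 : Tendsto (fun t : ℝ => (s, ε * t)) (𝓝[>] 0) (𝓝 (s, (0 : ℝ))) := by
      have : Continuous fun t : ℝ => (s, ε * t) := by fun_prop
      simpa using (this.tendsto 0).mono_left nhdsWithin_le_nhds
    filter_upwards [h1.eventually (hsh.eventually_mem h hε hs 1), self_mem_nhdsWithin] with t ht h0
    have h3 := ht m hm (by rw [← mul_assoc, hεε, one_mul]; exact h0)
    rw [smul_smul, mul_comm t]
    exact h3
  refine ⟨?_, ?_⟩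
  · rintro x (hx | ⟨s, hs, rfl⟩)
    · exact (uniqueDiffWithinAt_of_mem_nhds
        (mem_of_superset (hsh.isOpen_A.mem_nhds hx) subset_union_left))
    · have hclos : g s ∈ closure (A ∪ g '' J) := subset_closure (Or.inr ⟨s, hs, rfl⟩)
      have htan : ∀ m : ℝ, |m| ≤ 1 → ε • (rot (deriv g s) + m • deriv g s) ∈
          tangentConeAt ℝ (A ∪ g '' J) (g s) := by
        intro m hm
        refine mem_tangentConeAt_of_add_smul_mem (l := 𝓝[>] (0 : ℝ)) (c := id) ?_
          ((key s hs m hm).mono fun t ht => Or.inl ht)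
        exact tendsto_id.mono_left (nhdsWithin_mono _ fun t (ht : 0 < t) => ht.ne')
      refine ⟨?_, hclos⟩
      have hspan : (⊤ : Submodule ℝ E2) ≤
          Submodule.span ℝ (tangentConeAt ℝ (A ∪ g '' J) (g s)) := by
        intro w _
        have e0 := Submodule.subset_span (R := ℝ) (htan 0 (by simp))
        have e1 := Submodule.subset_span (R := ℝ) (htan 1 (by simp))
        have e2 : rot (deriv g s) = ε • (ε • (rot (deriv g s) + (0 : ℝ) • deriv g s)) := by
          rw [smul_smul, hεε]; simp
        have e3 : deriv g s = ε • (ε • (rot (deriv g s) + (1 : ℝ) • deriv g s)) -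
            rot (deriv g s) := by
          rw [smul_smul, hεε]; simp
        have e4 : rot (deriv g s) ∈ Submodule.span ℝ (tangentConeAt ℝ (A ∪ g '' J) (g s)) := by
          rw [e2]; exact Submodule.smul_mem _ _ e0
        have e5 : deriv g s ∈ Submodule.span ℝ (tangentConeAt ℝ (A ∪ g '' J) (g s)) := by
          rw [e3]; exact Submodule.sub_mem _ (Submodule.smul_mem _ _ e1) e4
        rw [expand_rot (h.unit_speed s hs) w]
        exact Submodule.add_mem _ (Submodule.smul_mem _ _ e5) (Submodule.smul_mem _ _ e4)
      rw [top_le_iff.1 hspan]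
      simp
  · have hAint : A ⊆ interior (A ∪ g '' J) :=
      interior_maximal subset_union_left hsh.isOpen_A
    rintro x (hx | ⟨s, hs, rfl⟩)
    · exact subset_closure (hAint hx)
    · refine closure_mono hAint ?_
      have h1 : Tendsto (fun t : ℝ => g s + t • (ε • (rot (deriv g s) + (0 : ℝ) • deriv g s)))
          (𝓝[>] 0) (𝓝 (g s)) := by
        have : Continuous fun t : ℝ => g s + t • (ε • (rot (deriv g s) + (0 : ℝ) • deriv g s)) := by
          fun_prop
        simpa using (this.tendsto 0).mono_left nhdsWithin_le_nhds
      exact mem_closure_of_tendsto h1 (key s hs 0 (by simp))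

end Sheet

/-! ### The isometric immersion of a planar neighbourhood onto a strip -/

section RulingDomain

variable {g : ℝ → E2} {c : ℝ → E3} {L : ℝ → E2 →L[ℝ] E3} {ρ : ℝ → E2} {J : Set ℝ}
  {V : Set (ℝ × ℝ)}

/-- A neighbourhood `V` of `J × {0}` on which `(s, t) ↦ g s + t ρ(s)` is a coordinate system. -/
structure IsRulingDomain (g ρ : ℝ → E2) (J : Set ℝ) (V : Set (ℝ × ℝ)) : Prop where
  isOpen : IsOpen V
  mem : ∀ s ∈ J, (s, (0 : ℝ)) ∈ V
  fst_mem : ∀ y ∈ V, y.1 ∈ J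
  injOn : InjOn (rulingMap g ρ) V
  eq_zero : ∀ y ∈ V, ∀ w, fderiv ℝ (rulingMap g ρ) y w = 0 → w = 0

lemma IsRulingDomain.inter (h : IsRulingDomain g ρ J V) {V' : Set (ℝ × ℝ)} (hV' : IsOpen V')
    (hmem : ∀ s ∈ J, (s, (0 : ℝ)) ∈ V') : IsRulingDomain g ρ J (V ∩ V') :=
  ⟨h.isOpen.inter hV', fun s hs => ⟨h.mem s hs, hmem s hs⟩, fun y hy => h.fst_mem y hy.1,
    h.injOn.mono inter_subset_left, fun y hy => h.eq_zero y hy.1⟩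

lemma IsRidgeFrame.eventually_eq_zero_of_fderiv (h : IsRidgeFrame g c L ρ J) {s : ℝ}
    (hs : s ∈ J) : ∀ᶠ y in 𝓝 (s, (0 : ℝ)), ∀ w, fderiv ℝ (rulingMap g ρ) y w = 0 → w = 0 := by
  have hc : ContinuousAt (fderiv ℝ (rulingMap g ρ)) (s, 0) :=
    ((h.contDiffAt_rulingMap hs 0).fderiv_right (m := 0) (by norm_num)).continuousAt
  have h1 : ContinuousAt (fun y => fderiv ℝ (rulingMap g ρ) y (1, 0)) (s, 0) :=
    hc.clm_apply continuousAt_const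
  have h2 : ContinuousAt (fun y => fderiv ℝ (rulingMap g ρ) y (0, 1)) (s, 0) :=
    hc.clm_apply continuousAt_const
  have h3 : ContinuousAt (fun y => rot (fderiv ℝ (rulingMap g ρ) y (1, 0))) (s, 0) :=
    rotL.continuous.continuousAt.comp h1
  have h4 : ⟪rot (fderiv ℝ (rulingMap g ρ) (s, 0) (1, 0)),
      fderiv ℝ (rulingMap g ρ) (s, 0) (0, 1)⟫ ≠ 0 := by
    rw [h.fderiv_rulingMap hs, h.fderiv_rulingMap hs, real_inner_comm]
    simp [h.inner_ruling s hs]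
  filter_upwards [(h3.inner h2).eventually_ne h4] with y hy w hw
  have hw' : w = w.1 • ((1 : ℝ), (0 : ℝ)) + w.2 • ((0 : ℝ), (1 : ℝ)) := by ext <;> simp
  rw [hw', map_add, map_smul, map_smul] at hw
  set a := fderiv ℝ (rulingMap g ρ) y (1, 0)
  set b := fderiv ℝ (rulingMap g ρ) y (0, 1)
  have e1 : w.2 * ⟪rot a, b⟫ = 0 := by
    have := congrArg (fun v => ⟪rot a, v⟫) hw
    simpa [inner_add_right, inner_smul_right] using this
  have e2 : w.1 * ⟪rot b, a⟫ = 0 := by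
    have := congrArg (fun v => ⟪rot b, v⟫) hw
    simpa [inner_add_right, inner_smul_right] using this
  have e3 : ⟪rot b, a⟫ = - ⟪rot a, b⟫ := by
    rw [inner_eq_two, inner_eq_two]; simp; ring
  rw [e3] at e2
  have hy' : ⟪rot a, b⟫ ≠ 0 := hy
  exact Prod.ext ((mul_eq_zero.1 e2).resolve_right (neg_ne_zero.2 hy'))
    ((mul_eq_zero.1 e1).resolve_right hy')

/-- Coordinates by rulings exist near an embedded curve. The boxes around the points of the curve
are chosen so small that, of two boxes with intersecting images, one lies in the larger box around
the centre of the other on which the coordinates are known to be injective. -/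
lemma IsRidgeFrame.exists_isRulingDomain (h : IsRidgeFrame g c L ρ J) (he : IsEmbeddedArc g J) :
    ∃ V, IsRulingDomain g ρ J V := by
  have hloc : ∀ s ∈ J, ∃ δ > 0, InjOn (rulingMap g ρ) (Metric.ball (s, (0 : ℝ)) δ) ∧
      ∀ y ∈ Metric.ball (s, (0 : ℝ)) δ, y.1 ∈ J ∧
        ∀ w, fderiv ℝ (rulingMap g ρ) y w = 0 → w = 0 := by
    intro s hs
    obtain ⟨U, hU, hinj, -⟩ := h.eventually_injOn_rulingMap hs
    have h1 : ∀ᶠ y in 𝓝 (s, (0 : ℝ)), y.1 ∈ J :=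
      continuous_fst.continuousAt.eventually (h.mem_nhds hs)
    obtain ⟨δ, hδ, hb⟩ := Metric.mem_nhds_iff.1
      (inter_mem hU (h1.and (h.eventually_eq_zero_of_fderiv hs)))
    exact ⟨δ, hδ, hinj.mono fun y hy => (hb hy).1, fun y hy => (hb hy).2⟩
  choose! δ hδ hinj hreg using hloc
  have hη : ∀ s ∈ J, ∃ η > 0, η ≤ δ s / 3 ∧ ∀ s' ∈ J, dist (g s') (g s) < η →
      dist s' s < δ s / 3 := by
    intro s hs
    obtain ⟨η, hη, h1⟩ := he.embedded s hs (δ s / 3) (by have := hδ s hs; positivity)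
    refine ⟨min η (δ s / 3), lt_min hη (by have := hδ s hs; positivity), min_le_right _ _,
      fun s' hs' hd => h1 s' hs' (hd.trans_le (min_le_left _ _))⟩
  choose! η hη0 hηδ hηs using hη
  have hε : ∀ s ∈ J, ∃ ε > 0, ε ≤ η s ∧ ∀ y ∈ Metric.ball (s, (0 : ℝ)) ε,
      dist (rulingMap g ρ y) (g s) < η s / 2 := by
    intro s hs
    have hc := (h.contDiffAt_rulingMap hs 0).continuousAt
    obtain ⟨ε, hε, h1⟩ := Metric.continuousAt_iff.1 hc (η s / 2) (by have := hη0 s hs; positivity)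
    refine ⟨min ε (η s), lt_min hε (hη0 s hs), min_le_right _ _, fun y hy => ?_⟩
    have := h1 (x := y) ((Metric.mem_ball.1 hy).trans_le (min_le_left _ _))
    rwa [rulingMap_zero] at this
  choose! ε hε0 hεη hεd using hε
  refine ⟨⋃ s ∈ J, Metric.ball (s, (0 : ℝ)) (ε s), ?_, ?_, ?_, ?_, ?_⟩
  · exact isOpen_biUnion fun s _ => Metric.isOpen_ball
  · exact fun s hs => mem_biUnion hs (Metric.mem_ball_self (hε0 s hs))
  · intro y hy
    obtain ⟨s, hs, hys⟩ := mem_iUnion₂.1 hy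
    refine (hreg s hs y (Metric.ball_subset_ball ?_ hys)).1
    have := hηδ s hs; have := hεη s hs; have := hδ s hs; linarith
  · -- the case distinction `η s' ≤ η s` is symmetric
    have key : ∀ s ∈ J, ∀ s' ∈ J, η s' ≤ η s → ∀ y ∈ Metric.ball (s, (0 : ℝ)) (ε s),
        ∀ y' ∈ Metric.ball (s', (0 : ℝ)) (ε s'), rulingMap g ρ y = rulingMap g ρ y' → y = y' := by
      intro s hs s' hs' hle y hy y' hy' hyy
      have h1 := hεd s hs y hy
      have h2 := hεd s' hs' y' hy'
      have h3 : dist (g s') (g s) < η s := by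
        rw [← hyy] at h2
        have := dist_triangle_left (g s') (g s) (rulingMap g ρ y)
        linarith
      have h4 := hηs s hs s' hs' h3
      have h5 := hηδ s hs; have h6 := hεη s hs; have h7 := hδ s hs; have h8 := hεη s' hs'
      refine hinj s hs (Metric.ball_subset_ball (by linarith) hy) ?_ hyy
      have h9 : dist (s', (0 : ℝ)) (s, (0 : ℝ)) = dist s' s := by simp [Prod.dist_eq]
      have h10 := dist_triangle y' (s', (0 : ℝ)) (s, (0 : ℝ))
      rw [Metric.mem_ball] at hy' ⊢
      linarith
    intro y hy y' hy' hyy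
    obtain ⟨s, hs, hys⟩ := mem_iUnion₂.1 hy
    obtain ⟨s', hs', hys'⟩ := mem_iUnion₂.1 hy'
    rcases le_total (η s') (η s) with hle | hle
    · exact key s hs s' hs' hle y hys y' hys' hyy
    · exact (key s' hs' s hs hle y' hys' y hys hyy.symm).symm
  · intro y hy
    obtain ⟨s, hs, hys⟩ := mem_iUnion₂.1 hy
    refine (hreg s hs y (Metric.ball_subset_ball ?_ hys)).2
    have := hηδ s hs; have := hεη s hs; have := hδ s hs; linarith

/-- The coordinates by rulings. -/
noncomputable def rulingCoord (g ρ : ℝ → E2) (V : Set (ℝ × ℝ)) : E2 → ℝ × ℝ :=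
  Function.invFunOn (rulingMap g ρ) V

/-- The isometric immersion of the planar neighbourhood `rulingMap g ρ '' V` onto the strip. -/
noncomputable def stripMap (g : ℝ → E2) (c : ℝ → E3) (L : ℝ → E2 →L[ℝ] E3) (ρ : ℝ → E2)
    (V : Set (ℝ × ℝ)) (x : E2) : E3 :=
  ruledStrip c L ρ (rulingCoord g ρ V x)

namespace IsRulingDomain

variable (hV : IsRulingDomain g ρ J V)
include hV

lemma rulingCoord_rulingMap {y : ℝ × ℝ} (hy : y ∈ V) : rulingCoord g ρ V (rulingMap g ρ y) = y :=
  hV.injOn.leftInvOn_invFunOn hy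

lemma rulingCoord_planar {s : ℝ} (hs : s ∈ J) : rulingCoord g ρ V (g s) = (s, 0) := by
  rw [← rulingMap_zero g ρ s, hV.rulingCoord_rulingMap (hV.mem s hs)]

lemma mem_image {s : ℝ} (hs : s ∈ J) : g s ∈ rulingMap g ρ '' V :=
  ⟨(s, 0), hV.mem s hs, rulingMap_zero g ρ s⟩

lemma stripMap_planar {s : ℝ} (hs : s ∈ J) : stripMap g c L ρ V (g s) = c s := by
  rw [stripMap, hV.rulingCoord_planar hs, ruledStrip_zero]

variable (h : IsRidgeFrame g c L ρ J)
include h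

lemma rulingCoord_spec {y : ℝ × ℝ} (hy : y ∈ V) :
    ContDiffAt ℝ 1 (rulingCoord g ρ V) (rulingMap g ρ y) ∧
      rulingMap g ρ '' V ∈ 𝓝 (rulingMap g ρ y) := by
  have hc : ContDiffAt ℝ 1 (rulingMap g ρ) y := h.contDiffAt_rulingMap (hV.fst_mem y hy) y.2
  obtain ⟨j, hjc, hj0, hjl, hjr, hmap⟩ := exists_localInverse (by simp) le_rfl hc (hV.eq_zero y hy)
  have hjt : Tendsto j (𝓝 (rulingMap g ρ y)) (𝓝 y) := by
    have := hjc.continuousAt.tendsto; rwa [hj0] at this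
  refine ⟨hjc.congr_of_eventuallyEq ?_, ?_⟩
  · filter_upwards [hjr, hjt.eventually (hV.isOpen.mem_nhds hy)] with z h1 h2
    rw [← hV.rulingCoord_rulingMap h2, h1]
  · rw [← hmap]; exact image_mem_map (hV.isOpen.mem_nhds hy)

lemma isOpen_image : IsOpen (rulingMap g ρ '' V) := by
  rw [isOpen_iff_mem_nhds]
  rintro _ ⟨y, hy, rfl⟩
  exact (hV.rulingCoord_spec h hy).2

lemma hasFDerivAt_stripMap {y : ℝ × ℝ} (hy : y ∈ V) :
    HasFDerivAt (stripMap g c L ρ V) (L y.1) (rulingMap g ρ y) := by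
  have hs := hV.fst_mem y hy
  have h1 : DifferentiableAt ℝ (ruledStrip c L ρ) y :=
    (h.contDiffAt_ruledStrip hs y.2).differentiableAt (by simp)
  have h2 : DifferentiableAt ℝ (rulingMap g ρ) y :=
    (h.contDiffAt_rulingMap hs y.2).differentiableAt (by simp)
  have h3 : DifferentiableAt ℝ (rulingCoord g ρ V) (rulingMap g ρ y) :=
    (hV.rulingCoord_spec h hy).1.differentiableAt (by simp)
  have e := hV.rulingCoord_rulingMap hy
  have k1 : HasFDerivAt (stripMap g c L ρ V) ((fderiv ℝ (ruledStrip c L ρ) y).comp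
      (fderiv ℝ (rulingCoord g ρ V) (rulingMap g ρ y))) (rulingMap g ρ y) := by
    refine HasFDerivAt.comp (rulingMap g ρ y) ?_ h3.hasFDerivAt
    rw [e]; exact h1.hasFDerivAt
  have k2 : HasFDerivAt (fun x => rulingMap g ρ (rulingCoord g ρ V x))
      ((fderiv ℝ (rulingMap g ρ) y).comp
      (fderiv ℝ (rulingCoord g ρ V) (rulingMap g ρ y))) (rulingMap g ρ y) := by
    refine HasFDerivAt.comp (g := rulingMap g ρ) (rulingMap g ρ y) ?_ h3.hasFDerivAt
    rw [e]; exact h2.hasFDerivAt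
  have k3 : (fun x => rulingMap g ρ (rulingCoord g ρ V x)) =ᶠ[𝓝 (rulingMap g ρ y)] id := by
    filter_upwards [(hV.rulingCoord_spec h hy).2] with x hx
    obtain ⟨z, hz, rfl⟩ := hx
    simp only [id, hV.rulingCoord_rulingMap hz]
  have k4 := k2.unique ((hasFDerivAt_id (𝕜 := ℝ) (rulingMap g ρ y)).congr_of_eventuallyEq k3)
  refine k1.congr_fderiv ?_
  ext1 w
  have k5 := congrArg (fun M : E2 →L[ℝ] E2 => M w) k4
  simp only [ContinuousLinearMap.comp_apply, ContinuousLinearMap.id_apply] at k5 ⊢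
  have : y = (y.1, y.2) := rfl
  rw [this, h.fderiv_ruledStrip hs, ← this, k5]

lemma fderivWithin_stripMap {y : ℝ × ℝ} (hy : y ∈ V) :
    fderivWithin ℝ (stripMap g c L ρ V) (rulingMap g ρ '' V) (rulingMap g ρ y) = L y.1 := by
  rw [fderivWithin_of_isOpen (hV.isOpen_image h) ⟨y, hy, rfl⟩,
    (hV.hasFDerivAt_stripMap h hy).fderiv]

lemma isometricImmersionOn_stripMap :
    IsometricImmersionOn 2 (stripMap g c L ρ V) (rulingMap g ρ '' V) := by
  refine ⟨?_, ?_⟩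
  · have h2 : (2 : WithTop ℕ∞) = 1 + 1 := by norm_num
    rw [h2, contDiffOn_succ_iff_fderiv_of_isOpen (hV.isOpen_image h)]
    refine ⟨?_, by simp, ?_⟩
    · rintro _ ⟨y, hy, rfl⟩
      exact (hV.hasFDerivAt_stripMap h hy).differentiableAt.differentiableWithinAt
    · have k : ContDiffOn ℝ 1 (fun x => L (rulingCoord g ρ V x).1) (rulingMap g ρ '' V) := by
        rintro _ ⟨y, hy, rfl⟩
        have e1 : ContDiffAt ℝ 1 L (rulingCoord g ρ V (rulingMap g ρ y)).1 := by
          rw [hV.rulingCoord_rulingMap hy]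
          exact h.contDiffOn_map.contDiffAt (h.mem_nhds (hV.fst_mem y hy))
        exact (ContDiffAt.comp (rulingMap g ρ y) e1
          (contDiffAt_fst.comp _ (hV.rulingCoord_spec h hy).1)).contDiffWithinAt
      refine k.congr ?_
      rintro _ ⟨y, hy, rfl⟩
      rw [(hV.hasFDerivAt_stripMap h hy).fderiv, hV.rulingCoord_rulingMap hy]
  · rintro _ ⟨y, hy, rfl⟩ v
    rw [hV.fderivWithin_stripMap h hy]
    exact h.norm_map _ (hV.fst_mem y hy) v

end IsRulingDomain

end RulingDomain

/-! ### Uniqueness of the strip on one side of the foldline -/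

section OneSided

variable {g : ℝ → E2} {c : ℝ → E3} {L : ℝ → E2 →L[ℝ] E3} {ρ : ℝ → E2} {J : Set ℝ} {ε : ℝ}
  {A B O : Set E2}

/-- The rulings, too, leave the foldline to the proper side. -/
lemma IsSheet.eventually_rulingMap_mem (hsh : IsSheet g J ε A B) (he : IsEmbeddedArc g J)
    (hε : ε = 1 ∨ ε = -1) (h : IsRidgeFrame g c L ρ J) {s₀ : ℝ} (hs₀ : s₀ ∈ J) :
    ∀ᶠ y in 𝓝 (s₀, (0 : ℝ)), y.1 ∈ J ∧ (0 < ε * y.2 → rulingMap g ρ y ∈ A) := by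
  have hdg : ContinuousAt (deriv g) s₀ :=
    (he.contDiffOn.continuousOn_deriv_of_isOpen he.isOpen (by simp)).continuousAt (h.mem_nhds hs₀)
  have hc : ContinuousAt (fun y : ℝ × ℝ => |⟪ρ y.1, deriv g y.1⟫|) (s₀, 0) := by
    have e1 : ContinuousAt (fun s => |⟪ρ s, deriv g s⟫|) s₀ :=
      ((h.hasDerivAt_ruling hs₀).continuousAt.inner hdg).abs
    exact ContinuousAt.comp (x := (s₀, (0 : ℝ))) (f := Prod.fst)
      (g := fun s => |⟪ρ s, deriv g s⟫|) e1 continuousAt_fst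
  have hb : ∀ᶠ y in 𝓝 (s₀, (0 : ℝ)), |⟪ρ y.1, deriv g y.1⟫| < |⟪ρ s₀, deriv g s₀⟫| + 1 :=
    hc.eventually (gt_mem_nhds (lt_add_one _))
  have hJ : ∀ᶠ y in 𝓝 (s₀, (0 : ℝ)), y.1 ∈ J :=
    continuous_fst.continuousAt.eventually (h.mem_nhds hs₀)
  filter_upwards [hb, hJ, hsh.eventually_mem he hε hs₀ (|⟪ρ s₀, deriv g s₀⟫| + 1)]
    with y h1 h2 h3
  refine ⟨h2, fun h4 => ?_⟩
  have h5 := h3 _ h1.le h4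
  have h6 := expand_rot (h.unit_speed _ h2) (ρ y.1)
  rw [h.inner_ruling _ h2, one_smul, add_comm] at h6
  rwa [← h6] at h5

/-- Along a curve with non-vanishing normal curvature the differential determines the second
fundamental form. -/
lemma IsRidgeFrame.sff_eq (h : IsRidgeFrame g c L ρ J) {F : E2 → E3} {S : Set E2}
    (hR : IsRegularDomain S) (hF : IsometricImmersionOn 2 F S) (hmaps : MapsTo g J S)
    (hFL : ∀ s ∈ J, fderivWithin ℝ F S (g s) = L s) {s : ℝ} (hs : s ∈ J) (w : E2) :
    sff F S (g s) w = ⟪w - ⟪w, rot (deriv g s)⟫ • ρ s, deriv g s⟫ • deriv L s := by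
  have h1 : sff F S (g s) (deriv g s) = deriv L s := by
    have k1 := (hF.hasFDerivWithinAt_sff hR (hmaps hs)).comp_hasDerivWithinAt s
      (h.hasDerivAt_planar hs).hasDerivWithinAt hmaps
    have k2 := (k1.congr (fun t ht => (hFL t ht).symm) (hFL s hs).symm).hasDerivAt (h.mem_nhds hs)
    exact k2.deriv.symm
  have h2 : ⟪sff F S (g s) (deriv g s) (deriv g s), unitNormal F S (g s)⟫ ≠ 0 := by
    intro h0
    have := hF.sff_eq hR (hmaps hs) (deriv g s) (deriv g s)
    rw [h0, zero_smul, h1] at this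
    exact h.deriv_map_tangent s hs this
  have h3 : sff F S (g s) (ρ s) = 0 := by
    refine hF.sff_eq_zero_of_inner_eq_zero hR (hmaps hs) h2 ?_
    rw [hF.sff_symm hR (hmaps hs), h1, h.deriv_map_ruling s hs, inner_zero_left]
  have h4 : w - ⟪w, rot (deriv g s)⟫ • ρ s =
      ⟪w - ⟪w, rot (deriv g s)⟫ • ρ s, deriv g s⟫ • deriv g s := by
    have k1 := expand_rot (h.unit_speed s hs) (w - ⟪w, rot (deriv g s)⟫ • ρ s)
    have k2 : ⟪w - ⟪w, rot (deriv g s)⟫ • ρ s, rot (deriv g s)⟫ = 0 := by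
      rw [inner_sub_left, inner_smul_left, h.inner_ruling s hs]; simp
    rwa [k2, zero_smul, add_zero] at k1
  rw [← h1, ← map_smul, ← h4, map_sub, map_smul, h3]
  ext1 v
  simp

open scoped Classical in
/-- Functions on the two sides with the same values and derivatives along the foldline fit together
to a differentiable function. -/
lemma IsSheet.hasFDerivAt_piecewise (hsh : IsSheet g J ε A B) {W : Type*} [NormedAddCommGroup W]
    [NormedSpace ℝ W] {f₁ f₂ : E2 → W} {f₁' f₂' : E2 → E2 →L[ℝ] W}
    (h1 : ∀ x ∈ A ∪ g '' J, HasFDerivWithinAt f₁ (f₁' x) (A ∪ g '' J) x)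
    (h2 : ∀ x ∈ O, HasFDerivAt f₂ (f₂' x) x) (e : ∀ x ∈ g '' J, f₁ x = f₂ x)
    (e' : ∀ x ∈ g '' J, f₁' x = f₂' x) {x : E2} (hxO : x ∈ O) (hx : x ∈ A ∪ g '' J ∪ B) :
    HasFDerivAt ((A ∪ g '' J).piecewise f₁ f₂) ((A ∪ g '' J).piecewise f₁' f₂' x) x := by
  have hS : EqOn ((A ∪ g '' J).piecewise f₁ f₂) f₁ (A ∪ g '' J) := piecewise_eqOn _ _ _
  have hB : ∀ z ∈ B, z ∉ A ∪ g '' J := fun z hz hz' => hz'.elim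
    (fun hA => disjoint_left.1 hsh.disjoint hA hz) (disjoint_left.1 hsh.disjoint_B hz)
  have hS' : EqOn ((A ∪ g '' J).piecewise f₁ f₂) f₂ (B ∪ g '' J) := by
    rintro z (hz | hz)
    · exact piecewise_eq_of_notMem _ _ _ (hB z hz)
    · rw [hS (Or.inr hz), e z hz]
  rcases hx with (hx | hx) | hx
  · have hxS : x ∈ A ∪ g '' J := Or.inl hx
    rw [piecewise_eq_of_mem _ _ _ hxS]
    exact ((h1 x (Or.inl hx)).congr hS (hS (Or.inl hx))).hasFDerivAt
      (mem_of_superset (hsh.isOpen_A.mem_nhds hx) subset_union_left)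
  · have k1 := (h1 x (Or.inr hx)).congr hS (hS (Or.inr hx))
    have k2 := ((h2 x hxO).hasFDerivWithinAt (s := B ∪ g '' J)).congr hS' (hS' (Or.inr hx))
    have hxS : x ∈ A ∪ g '' J := Or.inr hx
    rw [piecewise_eq_of_mem _ _ _ hxS]
    rw [← e' x hx] at k2
    refine (k1.union k2).hasFDerivAt (mem_of_superset
      (hsh.isOpen_sheet.mem_nhds (Or.inl (Or.inr hx))) ?_)
    exact union_subset subset_union_left (subset_union_of_subset_right subset_union_left _)
  · rw [piecewise_eq_of_notMem _ _ _ (hB x hx)]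
    refine (h2 x hxO).congr_of_eventuallyEq ?_
    filter_upwards [hsh.isOpen_B.mem_nhds hx] with z hz using hS' (Or.inl hz)

open scoped Classical in
lemma IsSheet.continuousOn_piecewise (hsh : IsSheet g J ε A B) {W : Type*} [TopologicalSpace W]
    {f₁ f₂ : E2 → W} (hO : IsOpen O)
    (h1 : ContinuousOn f₁ (A ∪ g '' J)) (h2 : ContinuousOn f₂ O) (e : ∀ x ∈ g '' J, f₁ x = f₂ x) :
    ContinuousOn ((A ∪ g '' J).piecewise f₁ f₂) (O ∩ (A ∪ g '' J ∪ B)) := by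
  have hS : EqOn ((A ∪ g '' J).piecewise f₁ f₂) f₁ (A ∪ g '' J) := piecewise_eqOn _ _ _
  have hB : ∀ z ∈ B, z ∉ A ∪ g '' J := fun z hz hz' => hz'.elim
    (fun hA => disjoint_left.1 hsh.disjoint hA hz) (disjoint_left.1 hsh.disjoint_B hz)
  have hS' : EqOn ((A ∪ g '' J).piecewise f₁ f₂) f₂ (B ∪ g '' J) := by
    rintro z (hz | hz)
    · exact piecewise_eq_of_notMem _ _ _ (hB z hz)
    · rw [hS (Or.inr hz), e z hz]
  rintro x ⟨hxO, hx⟩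
  refine ContinuousAt.continuousWithinAt ?_
  have h2' := h2.continuousAt (hO.mem_nhds hxO)
  rcases hx with (hx | hx) | hx
  · exact ((h1 x (Or.inl hx)).congr hS (hS (Or.inl hx))).continuousAt
      (mem_of_superset (hsh.isOpen_A.mem_nhds hx) subset_union_left)
  · have k1 := (h1 x (Or.inr hx)).congr hS (hS (Or.inr hx))
    have k2 := (h2'.continuousWithinAt (s := B ∪ g '' J)).congr hS' (hS' (Or.inr hx))
    refine (k1.union k2).continuousAt (mem_of_superset
      (hsh.isOpen_sheet.mem_nhds (Or.inl (Or.inr hx))) ?_)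
    exact union_subset subset_union_left (subset_union_of_subset_right subset_union_left _)
  · refine h2'.congr_of_eventuallyEq ?_
    filter_upwards [hsh.isOpen_B.mem_nhds hx] with z hz using hS' (Or.inl hz)

open scoped Classical in
/-- A `C²` isometric immersion of a side of the sheet, up to the foldline, is determined near the
foldline by its first derivatives along it: together with the known strip on the other side it makes
up an isometric immersion of a full neighbourhood, which is again of class `C²`. -/
lemma IsSheet.eventually_eq_ruledStrip (hsh : IsSheet g J ε A B) (he : IsEmbeddedArc g J)
    (hε : ε = 1 ∨ ε = -1) (h : IsRidgeFrame g c L ρ J) {F : E2 → E3}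
    (hF : IsometricImmersionOn 2 F (A ∪ g '' J)) (hFc : ∀ s ∈ J, F (g s) = c s)
    (hFL : ∀ s ∈ J, fderivWithin ℝ F (A ∪ g '' J) (g s) = L s) {s₀ : ℝ} (hs₀ : s₀ ∈ J) :
    ∀ᶠ y in 𝓝 (s₀, (0 : ℝ)), 0 ≤ ε * y.2 → F (rulingMap g ρ y) = ruledStrip c L ρ y := by
  have hε0 : ε ≠ 0 := by rcases hε with rfl | rfl <;> norm_num
  obtain ⟨V, hV⟩ := h.exists_isRulingDomain he
  set S := A ∪ g '' J with hS
  set O := rulingMap g ρ '' V with hO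
  set F₂ := stripMap g c L ρ V with hF₂
  have hOo : IsOpen O := hV.isOpen_image h
  have hR := hsh.isRegularDomain he hε
  have hRO := hOo.isRegularDomain
  have hF2 : IsometricImmersionOn 2 F₂ O := hV.isometricImmersionOn_stripMap h
  have hmS : MapsTo g J S := fun s hs => Or.inr ⟨s, hs, rfl⟩
  have hmO : MapsTo g J O := fun s hs => hV.mem_image hs
  have hF2L : ∀ s ∈ J, fderivWithin ℝ F₂ O (g s) = L s := by
    intro s hs
    have := hV.fderivWithin_stripMap h (hV.mem s hs)
    rwa [rulingMap_zero] at this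
  set U := O ∩ (S ∪ B) with hU
  have hUo : IsOpen U := hOo.inter hsh.isOpen_sheet
  have e0 : ∀ x ∈ g '' J, F x = F₂ x := by
    rintro _ ⟨s, hs, rfl⟩
    rw [hFc s hs, hF₂, hV.stripMap_planar hs]
  have e1 : ∀ x ∈ g '' J, fderivWithin ℝ F S x = fderivWithin ℝ F₂ O x := by
    rintro _ ⟨s, hs, rfl⟩
    rw [hFL s hs, hF2L s hs]
  have e2 : ∀ x ∈ g '' J, sff F S x = sff F₂ O x := by
    rintro _ ⟨s, hs, rfl⟩
    ext1 w
    rw [h.sff_eq hR hF hmS hFL hs, h.sff_eq hRO hF2 hmO hF2L hs]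
  set F₃ := S.piecewise F F₂ with hF₃
  set G₃ := S.piecewise (fderivWithin ℝ F S) (fderivWithin ℝ F₂ O) with hG₃
  set H₃ := S.piecewise (sff F S) (sff F₂ O) with hH₃
  have d1 : ∀ x ∈ U, HasFDerivAt F₃ (G₃ x) x := fun x hx =>
    hsh.hasFDerivAt_piecewise (fun z hz => hF.hasFDerivWithinAt hz)
      (fun z hz => (hF2.hasFDerivWithinAt hz).hasFDerivAt (hOo.mem_nhds hz)) e0 e1 hx.1 hx.2
  have d2 : ∀ x ∈ U, HasFDerivAt G₃ (H₃ x) x := fun x hx =>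
    hsh.hasFDerivAt_piecewise (fun z hz => hF.hasFDerivWithinAt_sff hR hz)
      (fun z hz => (hF2.hasFDerivWithinAt_sff hRO hz).hasFDerivAt (hOo.mem_nhds hz)) e1 e2 hx.1 hx.2
  have d3 : ContinuousOn H₃ U :=
    hsh.continuousOn_piecewise hOo (hF.continuousOn_sff hR) (hF2.continuousOn_sff hRO) e2
  have hF3 : IsometricImmersionOn 2 F₃ U := by
    refine ⟨?_, ?_⟩
    · have h2 : (2 : WithTop ℕ∞) = 1 + 1 := by norm_num
      have h1 : (1 : WithTop ℕ∞) = 0 + 1 := by norm_num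
      rw [h2, contDiffOn_succ_iff_fderiv_of_isOpen hUo]
      refine ⟨fun x hx => (d1 x hx).differentiableAt.differentiableWithinAt, by simp, ?_⟩
      refine ContDiffOn.congr (f := G₃) ?_ fun x hx => (d1 x hx).fderiv
      rw [h1, contDiffOn_succ_iff_fderiv_of_isOpen hUo]
      refine ⟨fun x hx => (d2 x hx).differentiableAt.differentiableWithinAt, by simp, ?_⟩
      exact contDiffOn_zero.2 (d3.congr fun x hx => (d2 x hx).fderiv)
    · intro x hx v
      rw [fderivWithin_of_isOpen hUo hx, (d1 x hx).fderiv, hG₃]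
      by_cases hxS : x ∈ S
      · rw [piecewise_eq_of_mem _ _ _ hxS]; exact hF.2 x hxS v
      · rw [piecewise_eq_of_notMem _ _ _ hxS]; exact hF2.2 x hx.1 v
  have hmU : MapsTo g J U := fun s hs => ⟨hmO hs, Or.inl (hmS hs)⟩
  have hJn := h.mem_nhds hs₀
  have key := h.eventually_eq_ruledStrip hs₀ hUo hF3 (hmU hs₀)
    (by
      filter_upwards [hJn] with s hs
      rw [hF₃, piecewise_eq_of_mem _ _ _ (hmS hs), hFc s hs])
    (by
      filter_upwards [hJn] with s hs
      rw [fderivWithin_of_isOpen hUo (hmU hs), (d1 _ (hmU hs)).fderiv, hG₃,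
        piecewise_eq_of_mem _ _ _ (hmS hs), hFL s hs])
  filter_upwards [key, hsh.eventually_rulingMap_mem he hε h hs₀] with y h1 h2 h3
  have hyS : rulingMap g ρ y ∈ S := by
    rcases h3.eq_or_lt with h4 | h4
    · have h5 : y.2 = 0 := by simpa [hε0] using h4.symm
      have h6 : y = (y.1, 0) := Prod.ext rfl h5
      rw [h6, rulingMap_zero]; exact hmS h2.1
    · exact Or.inl (h2.2 h4)
  rw [← h1, hF₃, piecewise_eq_of_mem _ _ _ hyS]

end OneSided

/-! ### Curves on an isometrically immersed planar domain -/

section CurveInDomain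

variable {F : E2 → E3} {S : Set E2} {g : ℝ → E2} {c : ℝ → E3} {J : Set ℝ}

/-- A plane curve `g` in the domain of the isometric immersion `F`, and its image `c`. -/
structure IsCurveIn (F : E2 → E3) (S : Set E2) (g : ℝ → E2) (c : ℝ → E3) (J : Set ℝ) : Prop where
  isometric : IsometricImmersionOn 2 F S
  regular : IsRegularDomain S
  isOpen : IsOpen J
  contDiffOn : ContDiffOn ℝ 2 g J
  unit_speed : ∀ s ∈ J, ‖deriv g s‖ = 1
  mapsTo : MapsTo g J S
  map_eq : ∀ s ∈ J, F (g s) = c s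

namespace IsCurveIn

variable (h : IsCurveIn F S g c J) {s : ℝ} (hs : s ∈ J)
include h hs

lemma hasDerivAt_planar : HasDerivAt g (deriv g s) s :=
  ((h.contDiffOn.contDiffAt (h.isOpen.mem_nhds hs)).differentiableAt (by simp)).hasDerivAt

lemma hasDerivAt_space : HasDerivAt c (fderivWithin ℝ F S (g s) (deriv g s)) s := by
  have k1 := (h.isometric.hasFDerivWithinAt (h.mapsTo hs)).comp_hasDerivWithinAt s
    (h.hasDerivAt_planar hs).hasDerivWithinAt h.mapsTo
  exact (k1.congr (fun t ht => (h.map_eq t ht).symm) (h.map_eq s hs).symm).hasDerivAt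
    (h.isOpen.mem_nhds hs)

lemma deriv_space : deriv c s = fderivWithin ℝ F S (g s) (deriv g s) :=
  (h.hasDerivAt_space hs).deriv

lemma conormal_eq : conormal c (fun t => unitNormal F S (g t)) s =
    fderivWithin ℝ F S (g s) (rot (deriv g s)) := by
  rw [conormal, h.deriv_space hs]
  exact cross_normal_map (h.isometric.2 _ (h.mapsTo hs)) (h.unit_speed s hs)

/-- The components of the acceleration. -/
lemma deriv_deriv_space : deriv (deriv c) s =
    planarCurvature g s • fderivWithin ℝ F S (g s) (rot (deriv g s)) +
      sff F S (g s) (deriv g s) (deriv g s) := by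
  have hJ := h.isOpen.mem_nhds hs
  have hg2 := hasDerivAt_deriv_planar
    (((h.contDiffOn.deriv_of_isOpen (m := 1) h.isOpen (by norm_num)).contDiffAt hJ).differentiableAt
      (by simp)) (by filter_upwards [hJ] with t ht using h.unit_speed t ht)
  have k1 := (h.isometric.hasFDerivWithinAt_sff h.regular (h.mapsTo hs)).comp_hasDerivWithinAt s
    (h.hasDerivAt_planar hs).hasDerivWithinAt h.mapsTo
  have k2 := (k1.hasDerivAt hJ).clm_apply hg2
  have k3 := k2.congr_of_eventuallyEq (f₁ := deriv c)
    (by filter_upwards [hJ] with t ht using h.deriv_space ht)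
  rw [k3.deriv, map_smul]
  simp [add_comm]

lemma inner_deriv_deriv_space : ⟪deriv (deriv c) s,
    fderivWithin ℝ F S (g s) (rot (deriv g s))⟫ = planarCurvature g s := by
  rw [h.deriv_deriv_space hs, inner_add_left, inner_smul_left,
    h.isometric.inner_sff h.regular (h.mapsTo hs), h.isometric.inner_fderivWithin (h.mapsTo hs),
    inner_rot_rot, real_inner_self_eq_norm_sq, h.unit_speed s hs]
  simp

/-- The geodesic curvature is intrinsic. -/
lemma geodesicCurvature_eq : geodesicCurvature c (fun t => unitNormal F S (g t)) s =
    planarCurvature g s := by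
  rw [geodesicCurvature, h.conormal_eq hs, h.inner_deriv_deriv_space hs]

lemma ridgeMap_eq : ridgeMap g c (fun t => unitNormal F S (g t)) s = fderivWithin ℝ F S (g s) := by
  ext1 v
  rw [ridgeMap_apply, h.conormal_eq hs, h.deriv_space hs, ← map_smul, ← map_smul, ← map_add,
    real_inner_comm, real_inner_comm v, ← expand_rot (h.unit_speed s hs)]

omit hs in
lemma contDiffOn_normal {m n : WithTop ℕ∞} (hF : IsometricImmersionOn n F S) (hmn : m + 1 ≤ n)
    (hg : ContDiffOn ℝ m g J) : ContDiffOn ℝ m (fun t => unitNormal F S (g t)) J :=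
  (hF.contDiffOn_unitNormal h.regular hmn).comp hg h.mapsTo

end IsCurveIn

/-- Directions in which the second fundamental form vanishes do not turn the normal. -/
lemma IsometricImmersionOn.fderivWithin_unitNormal_eq_zero (hF : IsometricImmersionOn 2 F S)
    (hS : IsRegularDomain S) {x : E2} (hx : x ∈ S) {w : E2} (hw : sff F S x w = 0) :
    fderivWithin ℝ (unitNormal F S) S x w = 0 := by
  have hN := ((hF.contDiffOn_unitNormal (m := 1) hS (by norm_num)).differentiableOn
    (by simp) x hx).hasFDerivWithinAt
  have h1 : ∀ c, ⟪fderivWithin ℝ (unitNormal F S) S x w, fderivWithin ℝ F S x c⟫ = 0 := by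
    intro c
    rw [hF.inner_fderivWithin_unitNormal hS hx, hw]; simp
  rw [hF.eq_smul_unitNormal hx h1]
  have h2 : HasFDerivWithinAt (fun y => ⟪unitNormal F S y, unitNormal F S y⟫)
      (0 : E2 →L[ℝ] ℝ) S x :=
    (hasFDerivWithinAt_const (1 : ℝ) x S).congr
      (fun y hy => (hF.isONFrame hy norm_e1).nn) ((hF.isONFrame hx norm_e1).nn)
  have h3 := congrArg (fun L : E2 →L[ℝ] ℝ => L w) ((hS.uniqueDiffOn x hx).eq (hN.inner ℝ hN) h2)
  simp [fderivInnerCLM_apply] at h3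
  rw [real_inner_comm] at h3
  rw [show ⟪fderivWithin ℝ (unitNormal F S) S x w, unitNormal F S x⟫ = 0 by linarith, zero_smul]

/-- An isometric immersion has local left inverses. -/
lemma IsometricImmersionOn.exists_leftInverse {n : WithTop ℕ∞} (hn : 1 ≤ n)
    (hF : IsometricImmersionOn n F S) (hS : IsOpen S) {x₀ : E2} (hx₀ : x₀ ∈ S) :
    ∃ l : E3 → E2, ContDiffAt ℝ n l (F x₀) ∧ ∀ᶠ x in 𝓝 x₀, l (F x) = x := by
  have hn0 : n ≠ 0 := (lt_of_lt_of_le zero_lt_one hn).ne'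
  have hFc : ContDiffAt ℝ n F x₀ := hF.1.contDiffAt (hS.mem_nhds hx₀)
  set P : E3 →L[ℝ] E2 := ContinuousLinearMap.adjoint (fderivWithin ℝ F S x₀) with hP
  have hc : ContDiffAt ℝ n (fun x => P (F x)) x₀ := P.contDiff.contDiffAt.comp x₀ hFc
  have hd : fderiv ℝ (fun x => P (F x)) x₀ = P.comp (fderivWithin ℝ F S x₀) := by
    rw [fderivWithin_of_isOpen hS hx₀]
    exact (P.hasFDerivAt.comp x₀ (hFc.differentiableAt hn0).hasFDerivAt).fderiv
  obtain ⟨j, hjc, -, hjl, -, -⟩ := exists_localInverse rfl hn hc (by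
    intro v hv
    rw [hd] at hv
    have h1 : ⟪P (fderivWithin ℝ F S x₀ v), v⟫ = 0 := by
      have : P (fderivWithin ℝ F S x₀ v) = 0 := hv
      rw [this, inner_zero_left]
    rw [hP, ContinuousLinearMap.adjoint_inner_left, hF.inner_fderivWithin hx₀] at h1
    exact inner_self_eq_zero.1 h1)
  exact ⟨fun z => j (P z), ContDiffAt.comp (F x₀) hjc P.contDiff.contDiffAt, hjl⟩

end CurveInDomain

/-! ### Developable surfaces -/

section Surface

variable {X : Type*} [TopologicalSpace X] {pos normal : X → E3}

lemma IsPlanarChart.contDiffAt_symm {n : WithTop ℕ∞} (hn : 1 ≤ n) {φ : OpenPartialHomeomorph E2 X}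
    (hφ : IsPlanarChart n pos normal φ) {Y : Type*} [NormedAddCommGroup Y] [NormedSpace ℝ Y]
    {γ : Y → X} {s : Set Y} {y : Y} (hγ : ContinuousWithinAt γ s y)
    (hmem : γ y ∈ φ.target) :
    ∃ l : E3 → E2, ContDiffAt ℝ n l (pos (γ y)) ∧
      ∀ᶠ z in 𝓝[s] y, γ z ∈ φ.target ∧ φ.symm (γ z) = l (pos (γ z)) := by
  have hx₀ : φ.symm (γ y) ∈ φ.source := φ.map_target hmem
  obtain ⟨l, hl, hlx⟩ := hφ.1.exists_leftInverse hn φ.open_source hx₀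
  simp only [Function.comp_apply, φ.right_inv hmem] at hl
  refine ⟨l, hl, ?_⟩
  have h1 : ∀ᶠ z in 𝓝[s] y, γ z ∈ φ.target := hγ (φ.open_target.mem_nhds hmem)
  have h2 : Tendsto (fun z => φ.symm (γ z)) (𝓝[s] y) (𝓝 (φ.symm (γ y))) :=
    (φ.continuousAt_symm hmem).tendsto.comp hγ
  filter_upwards [h1, h2.eventually hlx] with z h3 h4
  simp only [Function.comp_apply, φ.right_inv h3] at h4
  exact ⟨h3, h4.symm⟩

lemma IsDevelopable.isLocallyInjective (hM : IsDevelopable 3 pos normal) :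
    IsLocallyInjective pos := by
  intro p
  obtain ⟨φ, hp, hφ⟩ := hM p
  obtain ⟨l, -, hl⟩ := hφ.1.exists_leftInverse (by norm_num) φ.open_source (φ.map_target hp)
  obtain ⟨W, hWsub, hWo, hW⟩ := eventually_nhds_iff.1
    (hl.and (φ.open_source.mem_nhds (φ.map_target hp)))
  refine ⟨φ '' W, φ.isOpen_image_of_subset_source hWo fun x hx => (hWsub x hx).2,
    ⟨_, hW, φ.right_inv hp⟩, ?_⟩
  rintro _ ⟨x, hx, rfl⟩ _ ⟨y, hy, rfl⟩ he
  have h1 := (hWsub x hx).1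
  have h2 := (hWsub y hy).1
  simp only [Function.comp_apply] at h1 h2
  rw [← h1, he, h2]

/-- The normal of a developable surface is constant along the segments in the surface: the normal
curvature vanishes in their direction. -/
lemma IsDevelopable.normal_eq_of_isRulingSegment (hM : IsDevelopable 3 pos normal)
    {σ : ℝ → X} {p q : X} (hσ : IsRulingSegment pos σ p q) : normal p = normal q := by
  set v := pos q - pos p with hv
  have hline : ∀ t, HasDerivAt (fun t : ℝ => pos p + t • v) v t := fun t => by
    simpa using (((hasDerivAt_id t).smul_const v).const_add (pos p))
  have hcont : ContinuousOn (fun t => normal (σ t)) (Icc 0 1) := by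
    intro t ht
    obtain ⟨φ, hp, hφ⟩ := hM (σ t)
    have h1 : Tendsto (fun z => φ.symm (σ z)) (𝓝[Icc 0 1] t) (𝓝 (φ.symm (σ t))) :=
      (φ.continuousAt_symm hp).tendsto.comp (hσ.continuousOn t ht)
    have h2 : ContinuousAt (unitNormal (pos ∘ φ) φ.source) (φ.symm (σ t)) :=
      ((hφ.1.contDiffOn_unitNormal (m := 2) φ.open_source.isRegularDomain
        (by norm_num)).continuousOn.continuousAt (φ.open_source.mem_nhds (φ.map_target hp)))
    have h3 : ∀ z, σ z ∈ φ.target → normal (σ z) =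
        unitNormal (pos ∘ φ) φ.source (φ.symm (σ z)) := fun z hz => by
      rw [← hφ.2 _ (φ.map_target hz), φ.right_inv hz]
    have h4 : ContinuousWithinAt (fun z => unitNormal (pos ∘ φ) φ.source (φ.symm (σ z)))
        (Icc 0 1) t := h2.tendsto.comp h1
    refine h4.congr_of_eventuallyEq ?_ (h3 t hp)
    filter_upwards [hσ.continuousOn t ht (φ.open_target.mem_nhds hp)] with z hz using h3 z hz
  have hderiv : ∀ t ∈ Ioo (0 : ℝ) 1, HasDerivAt (fun t => normal (σ t)) 0 t := by
    intro t ht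
    have htn : Icc (0 : ℝ) 1 ∈ 𝓝 t := Icc_mem_nhds ht.1 ht.2
    have htI : t ∈ Icc (0 : ℝ) 1 := Ioo_subset_Icc_self ht
    obtain ⟨φ, hp, hφ⟩ := hM (σ t)
    set f := pos ∘ φ with hf
    set S := φ.source with hS
    have hR : IsRegularDomain S := φ.open_source.isRegularDomain
    have hF : IsometricImmersionOn 2 f S := hφ.1.of_le (by norm_num)
    obtain ⟨l, hl, hlx⟩ := hφ.contDiffAt_symm (by norm_num) (hσ.continuousOn t htI) hp
    rw [nhdsWithin_eq_nhds.2 htn] at hlx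
    set a : ℝ → E2 := fun τ => l (pos p + τ • v) with ha
    have hal : ∀ᶠ τ in 𝓝 t, σ τ ∈ φ.target ∧ φ.symm (σ τ) = a τ := by
      filter_upwards [hlx, htn] with τ h1 h2
      rw [ha]; simp only
      rw [← hσ.straight τ h2]; exact h1
    rw [hσ.straight t htI] at hl
    have hac : ContDiffAt ℝ 3 a t := ContDiffAt.comp t hl (by fun_prop)
    have hfa : ∀ᶠ τ in 𝓝 t, a τ ∈ S ∧ f (a τ) = pos p + τ • v ∧
        normal (σ τ) = unitNormal f S (a τ) := by
      filter_upwards [hal, htn] with τ h1 h2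
      have h3 : a τ ∈ S := by rw [← h1.2]; exact φ.map_target h1.1
      refine ⟨h3, ?_, ?_⟩
      · rw [hf, Function.comp_apply, ← h1.2, φ.right_inv h1.1, hσ.straight τ h2]
      · rw [← hφ.2 _ h3, ← h1.2, φ.right_inv h1.1]
    have hatS : a t ∈ S := hfa.self_of_nhds.1
    have had : ∀ᶠ τ in 𝓝 t, HasDerivAt a (deriv a τ) τ :=
      (hac.eventually (by simp)).mono fun x hx => (hx.differentiableAt (by simp)).hasDerivAt
    have hv1 : ∀ᶠ τ in 𝓝 t, fderivWithin ℝ f S (a τ) (deriv a τ) = v := by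
      filter_upwards [hfa.eventually_nhds, had] with τ h1 h2
      have h3 := ((hF.hasFDerivWithinAt h1.self_of_nhds.1).hasFDerivAt
        (φ.open_source.mem_nhds h1.self_of_nhds.1)).comp_hasDerivAt τ h2
      exact h3.unique ((hline τ).congr_of_eventuallyEq (h1.mono fun z hz => hz.2.1))
    have ha2 : HasDerivAt (deriv a) (deriv (deriv a) t) t := by
      have : ContDiffAt ℝ 2 (deriv a) t := by
        have h := (hac.fderiv_right (m := 2) (by norm_num)).clm_apply
          (contDiffAt_const (c := (1 : ℝ)))
        simpa using h
      exact (this.differentiableAt (by simp)).hasDerivAt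
    have hG := ((hF.hasFDerivWithinAt_sff hR hatS).hasFDerivAt (φ.open_source.mem_nhds hatS))
    have k1 := ((hG.comp_hasDerivAt t had.self_of_nhds).clm_apply ha2).unique
      ((hasDerivAt_const t v).congr_of_eventuallyEq hv1)
    have k2 : ⟪sff f S (a t) (deriv a t) (deriv a t), unitNormal f S (a t)⟫ = 0 := by
      have := congrArg (fun z => ⟪z, unitNormal f S (a t)⟫) k1
      simpa [inner_add_left, real_inner_comm (unitNormal f S (a t)) (fderivWithin ℝ f S (a t) _),
        hF.inner_unitNormal_fderivWithin hatS] using this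
    have k3 : sff f S (a t) (deriv a t) = 0 := by
      ext1 b; exact hF.sff_eq_zero hR hatS k2 b
    have k4 := hF.fderivWithin_unitNormal_eq_zero hR hatS k3
    have hN := (((hF.contDiffOn_unitNormal (m := 1) hR (by norm_num)).differentiableOn
      (by simp) _ hatS).hasFDerivWithinAt.hasFDerivAt
        (φ.open_source.mem_nhds hatS)).comp_hasDerivAt t had.self_of_nhds
    rw [k4] at hN
    exact hN.congr_of_eventuallyEq (hfa.mono fun τ h1 => h1.2.2)
  have key : normal (σ 0) = normal (σ 1) := by
    ext i
    have hc : ContinuousOn (fun t => normal (σ t) i) (Icc 0 1) :=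
      (EuclideanSpace.proj (𝕜 := ℝ) i).continuous.comp_continuousOn hcont
    obtain ⟨t, -, ht⟩ := exists_hasDerivAt_eq_slope (fun t => normal (σ t) i) (fun _ => 0)
      zero_lt_one hc fun t ht => by
        have := (EuclideanSpace.proj (𝕜 := ℝ) i).hasFDerivAt.comp_hasDerivAt t (hderiv t ht)
        exact this.congr_deriv (map_zero _)
    simp only [sub_zero, div_one] at ht
    linarith
  rwa [hσ.source, hσ.target] at key

end Surface

/-! ### Curves on developable surfaces -/

section CurveOnSurface

variable {X : Type*} [TopologicalSpace X] {pos normal : X → E3} {γ : ℝ → X} {I : Set ℝ}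

lemma IsCurveOn.of_le {m n : WithTop ℕ∞} (hγ : IsCurveOn n pos γ I) (h : m ≤ n) :
    IsCurveOn m pos γ I :=
  ⟨hγ.isOpen, hγ.ordConnected, hγ.continuousOn, hγ.contDiffOn.of_le h, hγ.unit_speed⟩

/-- In a planar chart, a curve on the surface is a plane curve of the same class, at most `C³`. -/
lemma IsCurveOn.exists_chart (hM : IsDevelopable 3 pos normal) (hγ : IsCurveOn 3 pos γ I) {s₀ : ℝ}
    (hs₀ : s₀ ∈ I) : ∃ (φ : OpenPartialHomeomorph E2 X) (J : Set ℝ), s₀ ∈ J ∧ J ⊆ I ∧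
      IsPlanarChart 3 pos normal φ ∧ (∀ s ∈ J, γ s ∈ φ.target) ∧
      ContDiffOn ℝ 3 (fun s => φ.symm (γ s)) J ∧
      IsCurveIn (pos ∘ φ) φ.source (fun s => φ.symm (γ s)) (pos ∘ γ) J ∧
      ∀ s ∈ J, normal (γ s) = unitNormal (pos ∘ φ) φ.source (φ.symm (γ s)) := by
  obtain ⟨φ, hp, hφ⟩ := hM (γ s₀)
  have hIn : I ∈ 𝓝 s₀ := hγ.isOpen.mem_nhds hs₀
  obtain ⟨l, hl, hlx⟩ := hφ.contDiffAt_symm (s := I) (by norm_num) (hγ.continuousOn s₀ hs₀) hp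
  rw [nhdsWithin_eq_nhds.2 hIn] at hlx
  have hcd : ContDiffAt ℝ 3 (pos ∘ γ) s₀ := hγ.contDiffOn.contDiffAt hIn
  have hpc : ContDiffAt ℝ 3 (fun s => φ.symm (γ s)) s₀ :=
    (ContDiffAt.comp s₀ hl hcd).congr_of_eventuallyEq (hlx.mono fun s hs => hs.2)
  obtain ⟨J, hJ, hJo, hJ0⟩ := eventually_nhds_iff.1
    (((hpc.eventually (by simp)).and hlx).and hIn)
  have hJsub : J ⊆ I := fun s hs => (hJ s hs).2
  have htar : ∀ s ∈ J, γ s ∈ φ.target := fun s hs => (hJ s hs).1.2.1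
  have hcdJ : ContDiffOn ℝ 3 (fun s => φ.symm (γ s)) J :=
    fun s hs => (hJ s hs).1.1.contDiffWithinAt
  have hF : IsometricImmersionOn 2 (pos ∘ φ) φ.source := hφ.1.of_le (by norm_num)
  have hmaps : MapsTo (fun s => φ.symm (γ s)) J φ.source := fun s hs => φ.map_target (htar s hs)
  have heq : ∀ s ∈ J, (pos ∘ φ) (φ.symm (γ s)) = (pos ∘ γ) s := fun s hs => by
    simp only [Function.comp_apply, φ.right_inv (htar s hs)]
  refine ⟨φ, J, hJ0, hJsub, hφ, htar, hcdJ,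
    ⟨hF, φ.open_source.isRegularDomain, hJo, hcdJ.of_le (by norm_num), ?_, hmaps, heq⟩, ?_⟩
  · intro s hs
    have k1 := ((hcdJ.contDiffAt (hJo.mem_nhds hs)).differentiableAt (by simp)).hasDerivAt
    have k2 := (hF.hasFDerivWithinAt (hmaps hs)).comp_hasDerivWithinAt s
      k1.hasDerivWithinAt hmaps
    have k3 := (k2.congr (fun t ht => (heq t ht).symm) (heq s hs).symm).hasDerivAt
      (hJo.mem_nhds hs)
    have k4 := hγ.unit_speed s (hJsub hs)
    rwa [k3.deriv, hF.2 _ (hmaps hs)] at k4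
  · intro s hs
    rw [← hφ.2 _ (hmaps hs), φ.right_inv (htar s hs)]

lemma IsCurveOn.contDiffOn_normal (hM : IsDevelopable 3 pos normal) (hγ : IsCurveOn 3 pos γ I) :
    ContDiffOn ℝ 2 (normal ∘ γ) I := by
  intro s₀ hs₀
  obtain ⟨φ, J, hJ0, -, hφ, -, hp, hcur, hn⟩ := hγ.exists_chart hM hs₀
  have k1 := hcur.contDiffOn_normal (m := 2) hφ.1 (by norm_num) (hp.of_le (by norm_num))
  exact ((k1.congr hn).contDiffAt (hcur.isOpen.mem_nhds hJ0)).contDiffWithinAt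

lemma IsCurveOn.isUnitNormalAlong (hM : IsDevelopable 3 pos normal) (hγ : IsCurveOn 3 pos γ I) :
    IsUnitNormalAlong (pos ∘ γ) (normal ∘ γ) I := by
  refine ⟨hγ.isOpen, hγ.contDiffOn.of_le (by norm_num),
    (hγ.contDiffOn_normal hM).of_le (by norm_num), ?_, ?_, ?_⟩
  · intro s hs
    rw [real_inner_self_eq_norm_sq, hγ.unit_speed s hs]; norm_num
  · intro s hs
    obtain ⟨φ, J, hJ0, -, hφ, -, -, hcur, hn⟩ := hγ.exists_chart hM hs
    rw [Function.comp_apply, hn s hJ0]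
    exact (hcur.isometric.isONFrame (hcur.mapsTo hJ0) norm_e1).nn
  · intro s hs
    obtain ⟨φ, J, hJ0, -, hφ, -, -, hcur, hn⟩ := hγ.exists_chart hM hs
    rw [Function.comp_apply, hn s hJ0, hcur.deriv_space hJ0, real_inner_comm]
    exact hcur.isometric.inner_unitNormal_fderivWithin (hcur.mapsTo hJ0) _

lemma conormal_congr {c n n' : ℝ → E3} {s : ℝ} (h : n =ᶠ[𝓝 s] n') :
    conormal c n =ᶠ[𝓝 s] conormal c n' := by
  filter_upwards [h] with t ht
  rw [conormal, conormal, ht]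

lemma geodesicCurvature_congr {c n n' : ℝ → E3} {s : ℝ} (h : n =ᶠ[𝓝 s] n') :
    geodesicCurvature c n s = geodesicCurvature c n' s := by
  rw [geodesicCurvature, geodesicCurvature, (conormal_congr h).self_of_nhds]

lemma normalCurvature_congr {c n n' : ℝ → E3} {s : ℝ} (h : n =ᶠ[𝓝 s] n') :
    normalCurvature c n s = normalCurvature c n' s := by
  rw [normalCurvature, normalCurvature, h.self_of_nhds]

lemma relativeTorsion_congr {c n n' : ℝ → E3} {s : ℝ} (h : n =ᶠ[𝓝 s] n') :
    relativeTorsion c n s = relativeTorsion c n' s := by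
  rw [relativeTorsion, relativeTorsion, (conormal_congr h).deriv_eq, h.self_of_nhds]

/-- Near each of its points, a curve without vanishing normal curvature is contained in a strip of
its rulings that lies on the surface. -/
lemma IsCurveOn.exists_local_lift (hM : IsDevelopable 3 pos normal) (hγ : IsCurveOn 3 pos γ I)
    (hne : ∀ s ∈ I, normalCurvature (pos ∘ γ) (normal ∘ γ) s ≠ 0) {s₀ : ℝ} (hs₀ : s₀ ∈ I) :
    ∃ r > 0, ∃ k : ℝ × ℝ → X, ContinuousOn k (Metric.ball (s₀, (0 : ℝ)) r) ∧
      (∀ y ∈ Metric.ball (s₀, (0 : ℝ)) r, pos (k y) = (pos ∘ γ) y.1 +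
        y.2 • (conormal (pos ∘ γ) (normal ∘ γ) y.1 -
          (relativeTorsion (pos ∘ γ) (normal ∘ γ) y.1 /
            normalCurvature (pos ∘ γ) (normal ∘ γ) y.1) • deriv (pos ∘ γ) y.1)) ∧
      ∀ s, (s, (0 : ℝ)) ∈ Metric.ball (s₀, (0 : ℝ)) r → k (s, 0) = γ s := by
  obtain ⟨φ, J, hJ0, hJI, hφ, htar, hp, hcur, hn⟩ := hγ.exists_chart hM hs₀
  set c := pos ∘ γ with hc
  set n := normal ∘ γ with hnn
  set p : ℝ → E2 := fun s => φ.symm (γ s) with hpdef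
  have hu := hγ.isUnitNormalAlong hM
  have hng : ∀ s ∈ J, n =ᶠ[𝓝 s] fun t => unitNormal (pos ∘ φ) φ.source (p t) := by
    intro s hs
    filter_upwards [hcur.isOpen.mem_nhds hs] with t ht using hn t ht
  have hdata : IsRidgeData p c n J :=
    ⟨hcur.isOpen, hp, hγ.contDiffOn.mono hJI, (hγ.contDiffOn_normal hM).mono hJI,
      hcur.unit_speed, fun s hs => hu.tangent_unit s (hJI hs),
      fun s hs => hu.normal_unit s (hJI hs),
      fun s hs => hu.tangent_normal s (hJI hs),
      fun s hs => by rw [geodesicCurvature_congr (hng s hs), hcur.geodesicCurvature_eq hs],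
      fun s hs => hne s (hJI hs)⟩
  have hfr := hdata.isRidgeFrame
  have hL : ∀ s ∈ J, fderivWithin ℝ (pos ∘ φ) φ.source (p s) = ridgeMap p c n s := by
    intro s hs
    rw [← hcur.ridgeMap_eq hs]
    ext1 v
    rw [ridgeMap_apply, ridgeMap_apply, (conormal_congr (hng s hs)).self_of_nhds]
  have hJn := hcur.isOpen.mem_nhds hJ0
  have hU := hfr.eventually_eq_ruledStrip hJ0 φ.open_source hcur.isometric (hcur.mapsTo hJ0)
    (by filter_upwards [hJn] with s hs using hcur.map_eq s hs)
    (by filter_upwards [hJn] with s hs using hL s hs)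
  have hΦ0 : ContinuousAt (rulingMap p (ridgeRuling p c n)) (s₀, 0) :=
    (hfr.contDiffAt_rulingMap hJ0 0).continuousAt
  have hsrc : ∀ᶠ y in 𝓝 (s₀, (0 : ℝ)), rulingMap p (ridgeRuling p c n) y ∈ φ.source := by
    refine hΦ0 (φ.open_source.mem_nhds ?_)
    rw [rulingMap_zero]; exact hcur.mapsTo hJ0
  have hfst : ∀ᶠ y in 𝓝 (s₀, (0 : ℝ)), y.1 ∈ J := continuous_fst.continuousAt.eventually hJn
  obtain ⟨r, hr, hball⟩ := Metric.eventually_nhds_iff_ball.1 (hU.and (hsrc.and hfst))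
  refine ⟨r, hr, fun y => φ (rulingMap p (ridgeRuling p c n) y), ?_, ?_, ?_⟩
  · intro y hy
    obtain ⟨-, h2, h3⟩ := hball y hy
    exact ((φ.continuousAt h2).comp
      (hfr.contDiffAt_rulingMap h3 y.2).continuousAt).continuousWithinAt
  · intro y hy
    obtain ⟨h1, -, h3⟩ := hball y hy
    rw [← hdata.ruledStrip_eq h3, ← h1]; rfl
  · intro s hs
    obtain ⟨-, -, h3⟩ := hball _ hs
    simp only [rulingMap_zero]
    exact φ.right_inv (htar s h3)

/-- Local lifts along a locally injective map into space, which agree on a set `Z`, fit together to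
a lift on a neighbourhood of `Z`. On a ball around a point of `Z`, lifts are unique; the radii are
cut down to a third, so that of two intersecting balls one lies in the domain of both lifts. -/
lemma exists_lift_of_local [T2Space X] (hinj : IsLocallyInjective pos) {E : Type*}
    [NormedAddCommGroup E] [NormedSpace ℝ E] {Z : Set E} {b : E → X} {G : E → E3}
    (hloc : ∀ z ∈ Z, ∃ r > 0, ∃ k : E → X, ContinuousOn k (Metric.ball z r) ∧
      (∀ y ∈ Metric.ball z r, pos (k y) = G y) ∧ ∀ z' ∈ Z, z' ∈ Metric.ball z r → k z' = b z') :
    ∃ (V : Set E) (k : E → X), IsOpen V ∧ Z ⊆ V ∧ ContinuousOn k V ∧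
      (∀ y ∈ V, pos (k y) = G y) ∧ ∀ z ∈ Z, k z = b z := by
  classical
  rcases Z.eq_empty_or_nonempty with rfl | ⟨z₀, hz₀⟩
  · exact ⟨∅, b, isOpen_empty, Subset.rfl, continuousOn_empty _, by simp, by simp⟩
  have : Nonempty X := ⟨b z₀⟩
  choose! r hr k hkc hkG hkb using hloc
  have agree : ∀ z ∈ Z, ∀ z' ∈ Z, r z' ≤ r z → ∀ y ∈ Metric.ball z (r z / 3),
      y ∈ Metric.ball z' (r z' / 3) → k z y = k z' y := by
    intro z hz z' hz' hle y hy hy'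
    have hsub : Metric.ball z' (r z' / 3) ⊆ Metric.ball z (r z) := by
      intro w hw
      rw [Metric.mem_ball] at *
      have h1 := dist_triangle w z' z
      have h2 := dist_triangle_left z' z y
      linarith
    have hsub' : Metric.ball z' (r z' / 3) ⊆ Metric.ball z' (r z') :=
      Metric.ball_subset_ball (by have := hr z' hz'; linarith)
    have hz'm : z' ∈ Metric.ball z' (r z' / 3) :=
      Metric.mem_ball_self (by have := hr z' hz'; positivity)
    refine (T2Space.isSeparatedMap pos).eqOn_of_comp_eqOn hinj
      (convex_ball z' (r z' / 3)).isPreconnected ((hkc z hz).mono hsub) ((hkc z' hz').mono hsub')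
      (fun w hw => ?_) hz'm ?_ hy'
    · simp only [Function.comp_apply, hkG z hz w (hsub hw), hkG z' hz' w (hsub' hw)]
    · rw [hkb z hz z' hz' (hsub hz'm), hkb z' hz' z' hz' (hsub' hz'm)]
  have agree' : ∀ z ∈ Z, ∀ z' ∈ Z, ∀ y ∈ Metric.ball z (r z / 3),
      y ∈ Metric.ball z' (r z' / 3) → k z y = k z' y := by
    intro z hz z' hz' y hy hy'
    rcases le_total (r z') (r z) with hle | hle
    · exact agree z hz z' hz' hle y hy hy'
    · exact (agree z' hz' z hz hle y hy' hy).symm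
  set κ : E → X := fun y => if h : ∃ z ∈ Z, y ∈ Metric.ball z (r z / 3) then k h.choose y
    else b y with hκ
  have hκe : ∀ z ∈ Z, ∀ y ∈ Metric.ball z (r z / 3), κ y = k z y := by
    intro z hz y hy
    have h : ∃ z ∈ Z, y ∈ Metric.ball z (r z / 3) := ⟨z, hz, hy⟩
    rw [hκ]; simp only [dif_pos h]
    exact agree' _ h.choose_spec.1 z hz y h.choose_spec.2 hy
  have hself : ∀ z ∈ Z, z ∈ Metric.ball z (r z / 3) := fun z hz =>
    Metric.mem_ball_self (by have := hr z hz; positivity)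
  have hsub : ∀ z ∈ Z, Metric.ball z (r z / 3) ⊆ Metric.ball z (r z) := fun z hz =>
    Metric.ball_subset_ball (by have := hr z hz; linarith)
  refine ⟨⋃ z ∈ Z, Metric.ball z (r z / 3), κ, isOpen_biUnion fun z _ => Metric.isOpen_ball,
    fun z hz => mem_biUnion hz (hself z hz), ?_, ?_, ?_⟩
  · intro y hy
    obtain ⟨z, hz, hyz⟩ := mem_iUnion₂.1 hy
    have h1 : ContinuousAt (k z) y := ((hkc z hz).mono (hsub z hz)).continuousAt
      (Metric.isOpen_ball.mem_nhds hyz)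
    refine (h1.congr_of_eventuallyEq ?_).continuousWithinAt
    filter_upwards [Metric.isOpen_ball.mem_nhds hyz] with w hw using hκe z hz w hw
  · intro y hy
    obtain ⟨z, hz, hyz⟩ := mem_iUnion₂.1 hy
    rw [hκe z hz y hyz, hkG z hz y (hsub z hz hyz)]
  · intro z hz
    rw [hκe z hz z (hself z hz), hkb z hz z hz (hsub z hz (hself z hz))]

/-- A curve without vanishing normal curvature is contained in a strip of its rulings that lies
on the surface. -/
lemma IsCurveOn.exists_lift [T2Space X] (hM : IsDevelopable 3 pos normal)
    (hγ : IsCurveOn 3 pos γ I)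
    (hne : ∀ s ∈ I, normalCurvature (pos ∘ γ) (normal ∘ γ) s ≠ 0) :
    ∃ (V : Set (ℝ × ℝ)) (k : ℝ × ℝ → X), IsOpen V ∧ (∀ s ∈ I, (s, (0 : ℝ)) ∈ V) ∧
      ContinuousOn k V ∧
      (∀ y ∈ V, pos (k y) = (pos ∘ γ) y.1 +
        y.2 • (conormal (pos ∘ γ) (normal ∘ γ) y.1 -
          (relativeTorsion (pos ∘ γ) (normal ∘ γ) y.1 /
            normalCurvature (pos ∘ γ) (normal ∘ γ) y.1) • deriv (pos ∘ γ) y.1)) ∧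
      ∀ s ∈ I, k (s, 0) = γ s := by
  obtain ⟨V, k, hV, hZ, hk, hG, hb⟩ := exists_lift_of_local (Z := (fun s : ℝ => (s, (0 : ℝ))) '' I)
    (b := fun y => γ y.1) hM.isLocallyInjective (by
      rintro _ ⟨s, hs, rfl⟩
      obtain ⟨r, hr, k, h1, h2, h3⟩ := hγ.exists_local_lift hM hne hs
      refine ⟨r, hr, k, h1, h2, ?_⟩
      rintro _ ⟨t, ht, rfl⟩ hmem
      exact h3 t hmem)
  exact ⟨V, k, hV, fun s hs => hZ ⟨s, hs, rfl⟩, hk, hG, fun s hs => hb _ ⟨s, hs, rfl⟩⟩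

end CurveOnSurface

/-! ### The correspondence between the two curves -/

section Link

lemma IsUnitNormalAlong.deriv_normal_ne_zero {c n : ℝ → E3} {J : Set ℝ}
    (h : IsUnitNormalAlong c n J) {s : ℝ} (hs : s ∈ J) (hne : normalCurvature c n s ≠ 0) :
    deriv n s ≠ 0 := by
  intro h0
  rw [(h.hasDerivAt_normal hs).deriv] at h0
  have f := h.isONFrame hs
  have := congrArg (fun v => ⟪v, deriv c s⟫) h0
  simp only [inner_sub_left, inner_smul_left, f.TT, real_inner_comm (deriv c s) (conormal c n s),
    f.Tu, inner_zero_left] at this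
  exact hne (by simpa using this)

/-- A continuous reparametrization of a regular `C²` curve to a `C²` curve is `C²`: the parameter
is locally a `C²` function of a component of the curve. -/
lemma contDiffOn_of_comp_eq {n₁ n₂ : ℝ → E3} {s₂ : ℝ → ℝ} {I₁ I₂ : Set ℝ} (hI₁ : IsOpen I₁)
    (hI₂ : IsOpen I₂) (h1 : ContDiffOn ℝ 2 n₁ I₁) (h2 : ContDiffOn ℝ 2 n₂ I₂)
    (hne : ∀ s ∈ I₂, deriv n₂ s ≠ 0) (hs : ContinuousOn s₂ I₁) (hmaps : MapsTo s₂ I₁ I₂)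
    (he : ∀ s ∈ I₁, n₁ s = n₂ (s₂ s)) : ContDiffOn ℝ 2 s₂ I₁ := by
  intro s hsI
  refine ContDiffAt.contDiffWithinAt ?_
  have hI1n := hI₁.mem_nhds hsI
  have hI2n := hI₂.mem_nhds (hmaps hsI)
  set e := deriv n₂ (s₂ s) with he'
  have h2c : ContDiffAt ℝ 2 n₂ (s₂ s) := h2.contDiffAt hI2n
  have hk : ContDiffAt ℝ 2 (fun t => ⟪n₂ t, e⟫) (s₂ s) := h2c.inner ℝ contDiffAt_const
  have hkd : HasDerivAt (fun t => ⟪n₂ t, e⟫) ⟪e, e⟫ (s₂ s) := by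
    have := (h2c.differentiableAt (by simp)).hasDerivAt.inner ℝ (hasDerivAt_const (s₂ s) e)
    exact this.congr_deriv (by rw [inner_zero_right, zero_add])
  obtain ⟨j, hjc, -, hjl, -, -⟩ := exists_localInverse rfl (by norm_num) hk (by
    intro v hv
    have : fderiv ℝ (fun t => ⟪n₂ t, e⟫) (s₂ s) v = v * ⟪e, e⟫ := by
      rw [hkd.hasFDerivAt.fderiv]; simp
    rw [this] at hv
    exact (mul_eq_zero.1 hv).resolve_right (inner_self_ne_zero.2 (hne _ (hmaps hsI))))
  have h3 : ContDiffAt ℝ 2 (fun t => ⟪n₁ t, e⟫) s :=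
    (h1.contDiffAt hI1n).inner ℝ contDiffAt_const
  have hj' : ContDiffAt ℝ 2 j ⟪n₁ s, e⟫ := by rw [he s hsI]; exact hjc
  refine (ContDiffAt.comp s hj' h3).congr_of_eventuallyEq ?_
  filter_upwards [(hs.continuousAt hI1n).eventually hjl, hI1n] with t ht htI
  simp only [Function.comp_apply, he t htI]
  exact ht.symm

end Link

/-! ### The reflected normal -/

section FoldedNormal

variable {c n : ℝ → E3} {J : Set ℝ} {s : ℝ}

/-- The cosine of the folding angle, which is twice the angle between the conormal and the
principal normal. -/
noncomputable def foldCos (c n : ℝ → E3) (s : ℝ) : ℝ :=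
  (geodesicCurvature c n s ^ 2 - normalCurvature c n s ^ 2) /
    (geodesicCurvature c n s ^ 2 + normalCurvature c n s ^ 2)

/-- The sine of the folding angle, which is twice the angle between the conormal and the
principal normal. -/
noncomputable def foldSin (c n : ℝ → E3) (s : ℝ) : ℝ :=
  2 * geodesicCurvature c n s * normalCurvature c n s /
    (geodesicCurvature c n s ^ 2 + normalCurvature c n s ^ 2)

/-- The other unit normal of `c` for which the geodesic curvature is the same: the frame is turned
about the tangent by the folding angle. This reflects the conormal in the osculating plane. -/
noncomputable def foldedNormal (c n : ℝ → E3) (s : ℝ) : E3 :=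
  foldCos c n s • n s - foldSin c n s • conormal c n s

lemma cross_conormal_tangent (hT : ⟪deriv c s, deriv c s⟫ = 1) (hTn : ⟪deriv c s, n s⟫ = 0) :
    cross (conormal c n s) (deriv c s) = - n s := by
  rw [conormal, cross_cross, hT, real_inner_comm, hTn]; simp

lemma conormal_foldedNormal (h : IsUnitNormalAlong c n J) (hs : s ∈ J) :
    conormal c (foldedNormal c n) s = foldCos c n s • conormal c n s + foldSin c n s • n s := by
  have e1 := cross_conormal_tangent (h.tangent_unit s hs) (h.tangent_normal s hs)
  have e2 : conormal c (foldedNormal c n) s =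
      foldCos c n s • cross (n s) (deriv c s) -
        foldSin c n s • cross (conormal c n s) (deriv c s) := by
    rw [conormal, foldedNormal, ← crossL_apply, ← crossL_apply, ← crossL_apply, map_sub, map_smul,
      map_smul]
    rfl
  rw [e2, e1, smul_neg, sub_neg_eq_add]; rfl

lemma curvature_sq_pos (hne : normalCurvature c n s ≠ 0) :
    0 < geodesicCurvature c n s ^ 2 + normalCurvature c n s ^ 2 := by positivity

lemma foldCos_sq_add_foldSin_sq (hne : normalCurvature c n s ≠ 0) :
    foldCos c n s ^ 2 + foldSin c n s ^ 2 = 1 := by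
  have := (curvature_sq_pos hne).ne'
  rw [foldCos, foldSin]; field_simp; ring

lemma contDiffOn_foldCos (hJ : IsOpen J) (hc : ContDiffOn ℝ 4 c J) (hn : ContDiffOn ℝ 2 n J)
    (hne : ∀ s ∈ J, normalCurvature c n s ≠ 0) : ContDiffOn ℝ 2 (foldCos c n) J := by
  have h1 : ContDiffOn ℝ 2 (geodesicCurvature c n) J :=
    contDiffOn_geodesicCurvature hJ (hc.of_le (by norm_num)) hn
  have h2 : ContDiffOn ℝ 2 (normalCurvature c n) J :=
    contDiffOn_normalCurvature hJ (hc.of_le (by norm_num)) hn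
  exact ((h1.pow 2).sub (h2.pow 2)).div ((h1.pow 2).add (h2.pow 2))
    fun s hs => (curvature_sq_pos (hne s hs)).ne'

lemma contDiffOn_foldSin (hJ : IsOpen J) (hc : ContDiffOn ℝ 4 c J) (hn : ContDiffOn ℝ 2 n J)
    (hne : ∀ s ∈ J, normalCurvature c n s ≠ 0) : ContDiffOn ℝ 2 (foldSin c n) J := by
  have h1 : ContDiffOn ℝ 2 (geodesicCurvature c n) J :=
    contDiffOn_geodesicCurvature hJ (hc.of_le (by norm_num)) hn
  have h2 : ContDiffOn ℝ 2 (normalCurvature c n) J :=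
    contDiffOn_normalCurvature hJ (hc.of_le (by norm_num)) hn
  exact ((contDiffOn_const.mul h1).mul h2).div ((h1.pow 2).add (h2.pow 2))
    fun s hs => (curvature_sq_pos (hne s hs)).ne'

lemma contDiffOn_foldedNormal (hJ : IsOpen J) (hc : ContDiffOn ℝ 4 c J) (hn : ContDiffOn ℝ 2 n J)
    (hne : ∀ s ∈ J, normalCurvature c n s ≠ 0) : ContDiffOn ℝ 2 (foldedNormal c n) J :=
  ((contDiffOn_foldCos hJ hc hn hne).smul hn).sub ((contDiffOn_foldSin hJ hc hn hne).smul
    (contDiffOn_conormal hJ (hc.of_le (by norm_num)) hn))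

lemma IsUnitNormalAlong.foldedNormal (h : IsUnitNormalAlong c n J) (hc : ContDiffOn ℝ 4 c J)
    (hn : ContDiffOn ℝ 2 n J) (hne : ∀ s ∈ J, normalCurvature c n s ≠ 0) :
    IsUnitNormalAlong c (foldedNormal c n) J := by
  refine ⟨h.isOpen, h.contDiffOn_curve,
    (contDiffOn_foldedNormal h.isOpen hc hn hne).of_le (by norm_num), h.tangent_unit, ?_, ?_⟩
  · intro s hs
    have f := h.isONFrame hs
    rw [CurvedFolding.foldedNormal]
    simp only [inner_sub_left, inner_sub_right, inner_smul_left, inner_smul_right, f.uu, f.nn,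
      f.un, real_inner_comm (conormal c n s) (n s)]
    have := foldCos_sq_add_foldSin_sq (hne s hs)
    simp only [conj_trivial]; linear_combination this
  · intro s hs
    have f := h.isONFrame hs
    rw [CurvedFolding.foldedNormal]
    simp only [inner_sub_right, inner_smul_right, f.Tn, f.Tu]; simp

lemma geodesicCurvature_foldedNormal (h : IsUnitNormalAlong c n J) (hs : s ∈ J)
    (hne : normalCurvature c n s ≠ 0) :
    geodesicCurvature c (foldedNormal c n) s = geodesicCurvature c n s := by
  have hp := (curvature_sq_pos hne).ne'
  rw [geodesicCurvature, conormal_foldedNormal h hs, inner_add_right, inner_smul_right,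
    inner_smul_right]
  change foldCos c n s * geodesicCurvature c n s + foldSin c n s * normalCurvature c n s = _
  rw [foldCos, foldSin]; field_simp; ring

lemma normalCurvature_foldedNormal (hne : normalCurvature c n s ≠ 0) :
    normalCurvature c (foldedNormal c n) s = - normalCurvature c n s := by
  have hp := (curvature_sq_pos hne).ne'
  rw [normalCurvature, foldedNormal, inner_sub_right, inner_smul_right,
    inner_smul_right]
  change foldCos c n s * normalCurvature c n s - foldSin c n s * geodesicCurvature c n s = _
  rw [foldCos, foldSin]; field_simp; ring

/-- Turning the frame adds the derivative of the turning angle to the relative torsion. -/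
lemma relativeTorsion_foldedNormal (h : IsUnitNormalAlong c n J) (hs : s ∈ J)
    (hne : normalCurvature c n s ≠ 0) {kg' kn' : ℝ}
    (hkg : HasDerivAt (geodesicCurvature c n) kg' s)
    (hkn : HasDerivAt (normalCurvature c n) kn' s) :
    relativeTorsion c (foldedNormal c n) s = relativeTorsion c n s +
      2 * (geodesicCurvature c n s * kn' - normalCurvature c n s * kg') /
        (geodesicCurvature c n s ^ 2 + normalCurvature c n s ^ 2) := by
  have hp := (curvature_sq_pos hne).ne'
  have f := h.isONFrame hs
  have hC := ((hkg.pow 2).sub (hkn.pow 2)).div ((hkg.pow 2).add (hkn.pow 2)) hp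
  have hS := ((hkg.const_mul 2).mul hkn).div ((hkg.pow 2).add (hkn.pow 2)) hp
  have hu := (hC.smul (h.hasDerivAt_conormal hs)).add (hS.smul (h.hasDerivAt_normal hs))
  have he : conormal c (foldedNormal c n) =ᶠ[𝓝 s]
      fun t => foldCos c n t • conormal c n t + foldSin c n t • n t := by
    filter_upwards [h.isOpen.mem_nhds hs] with t ht using conormal_foldedNormal h ht
  rw [relativeTorsion, (hu.congr_of_eventuallyEq he).deriv, foldedNormal]
  simp only [inner_add_left, inner_sub_left, inner_sub_right, inner_smul_left, inner_smul_right,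
    f.uu, f.nn, f.un, f.Tu, f.Tn, real_inner_comm (conormal c n s) (n s), conj_trivial,
    Pi.pow_apply, Pi.sub_apply, Pi.add_apply, Pi.mul_apply, Pi.div_apply]
  rw [foldCos, foldSin]
  field_simp
  ring

/-- Apart from the conormal itself, the reflected conormal is the only one that gives the same
geodesic curvature. -/
lemma eq_or_eq_foldedConormal (h : IsUnitNormalAlong c n J) (hs : s ∈ J)
    (hne : normalCurvature c n s ≠ 0) {u : E3} (hu : ⟪u, u⟫ = 1) (huT : ⟪u, deriv c s⟫ = 0)
    (hk : ⟪deriv (deriv c) s, u⟫ = geodesicCurvature c n s) :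
    u = conormal c n s ∨ u = conormal c (foldedNormal c n) s := by
  have hp := (curvature_sq_pos hne).ne'
  have f := h.isONFrame hs
  have e1 := f.expand u
  rw [huT, zero_smul, zero_add] at e1
  set x := ⟪u, conormal c n s⟫
  set y := ⟪u, n s⟫
  set kg := geodesicCurvature c n s with hkg
  set kn := normalCurvature c n s with hkn
  have e2 : x * x + y * y = 1 := by
    rw [f.inner_eq, huT] at hu; simpa using hu
  have e3 : kg * x + kn * y = kg := by
    rw [e1, inner_add_right, inner_smul_right, inner_smul_right] at hk
    have : x * kg + y * kn = kg := hk
    linarith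
  have e4 : (1 - x) * (kn ^ 2 * (1 + x) - kg ^ 2 * (1 - x)) = 0 := by
    have : kn * y = kg * (1 - x) := by linarith
    have h5 : kn ^ 2 * y ^ 2 = kg ^ 2 * (1 - x) ^ 2 := by rw [← mul_pow, this, mul_pow]
    linear_combination h5 - kn ^ 2 * e2
  rcases mul_eq_zero.1 e4 with h0 | h0
  · left
    have hx : x = 1 := by linarith
    have hy : y = 0 := by
      rw [hx] at e3
      have : kn * y = 0 := by linarith
      exact (mul_eq_zero.1 this).resolve_left hne
    rw [e1, hx, hy]; simp
  · right
    have hx : x = foldCos c n s := by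
      rw [foldCos, eq_div_iff hp]; linear_combination h0
    have hy : y = foldSin c n s := by
      have : kn * y = kn * foldSin c n s := by
        have : kn * y = kg * (1 - x) := by linarith
        rw [this, hx, foldCos, foldSin, ← hkg, ← hkn]; field_simp; ring
      exact mul_left_cancel₀ hne this
    rw [conormal_foldedNormal h hs, e1, hx, hy]

/-- The two conormals are different. -/
lemma conormal_foldedNormal_ne (h : IsUnitNormalAlong c n J) (hs : s ∈ J)
    (hne : normalCurvature c n s ≠ 0) :
    conormal c (foldedNormal c n) s ≠ conormal c n s := by
  intro he
  have hp := (curvature_sq_pos hne).ne'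
  have f := h.isONFrame hs
  have h1 := congrArg (fun v => ⟪v, conormal c n s⟫) he
  rw [conormal_foldedNormal h hs] at h1
  simp only [inner_add_left, inner_smul_left, f.uu, real_inner_comm (conormal c n s) (n s), f.un,
    conj_trivial, mul_one, mul_zero, add_zero] at h1
  rw [foldCos, div_eq_one_iff_eq hp] at h1
  have : normalCurvature c n s ^ 2 = 0 := by linarith
  exact hne (pow_eq_zero_iff (by norm_num) |>.1 this)

end FoldedNormal

/-! ### The two sides of a proper fold -/

section Fold

variable {g : ℝ → E2} {c n : ℝ → E3} {J : Set ℝ} {ε : ℝ} {A B A' B' : Set E2} {F F' : E2 → E3}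

/-- A ridge `c` with a unit normal field `n` for which neither the geodesic nor the normal curvature
vanishes, and an embedded foldline `g` for it. -/
structure IsFoldData (g : ℝ → E2) (c n : ℝ → E3) (J : Set ℝ) : Prop where
  isUnitNormalAlong : IsUnitNormalAlong c n J
  contDiffOn_space : ContDiffOn ℝ 4 c J
  contDiffOn_normal : ContDiffOn ℝ 2 n J
  foldline : IsFoldline g J (geodesicCurvature c n)
  embedded : IsEmbeddedArc g J
  geodesicCurvature_ne : ∀ s ∈ J, geodesicCurvature c n s ≠ 0
  normalCurvature_ne : ∀ s ∈ J, normalCurvature c n s ≠ 0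

namespace IsFoldData

variable (h : IsFoldData g c n J)
include h

lemma isRidgeData : IsRidgeData g c n J :=
  ⟨h.embedded.isOpen, h.foldline.contDiffOn.of_le (by norm_num),
    h.contDiffOn_space.of_le (by norm_num), h.contDiffOn_normal, h.foldline.unit_speed,
    h.isUnitNormalAlong.tangent_unit, h.isUnitNormalAlong.normal_unit,
    h.isUnitNormalAlong.tangent_normal, h.foldline.curvature, h.normalCurvature_ne⟩

lemma isUnitNormalAlong_folded : IsUnitNormalAlong c (foldedNormal c n) J :=
  h.isUnitNormalAlong.foldedNormal h.contDiffOn_space h.contDiffOn_normal h.normalCurvature_ne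

lemma isRidgeData_folded : IsRidgeData g c (foldedNormal c n) J :=
  have hu := h.isUnitNormalAlong_folded
  ⟨h.embedded.isOpen, h.foldline.contDiffOn.of_le (by norm_num),
    h.contDiffOn_space.of_le (by norm_num), contDiffOn_foldedNormal h.embedded.isOpen
      h.contDiffOn_space h.contDiffOn_normal h.normalCurvature_ne, h.foldline.unit_speed,
    hu.tangent_unit, hu.normal_unit, hu.tangent_normal,
    fun s hs => by rw [h.foldline.curvature s hs, geodesicCurvature_foldedNormal
      h.isUnitNormalAlong hs (h.normalCurvature_ne s hs)],
    fun s hs => by rw [normalCurvature_foldedNormal (h.normalCurvature_ne s hs)]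
                   exact neg_ne_zero.2 (h.normalCurvature_ne s hs)⟩

lemma isCurveIn (hsh : IsSheet g J ε A B) (hε : ε = 1 ∨ ε = -1)
    (hF : IsometricImmersionOn 2 F (A ∪ g '' J)) (hFc : ∀ s ∈ J, F (g s) = c s) :
    IsCurveIn F (A ∪ g '' J) g c J :=
  ⟨hF, hsh.isRegularDomain h.embedded hε, h.embedded.isOpen, h.embedded.contDiffOn,
    h.embedded.unit_speed, fun s hs => Or.inr ⟨s, hs, rfl⟩, hFc⟩

omit h in
lemma fderivWithin_eq_ridgeMap {S : Set E2} {n' : ℝ → E3} (hcur : IsCurveIn F S g c J) {s : ℝ}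
    (hs : s ∈ J) (hu : fderivWithin ℝ F S (g s) (rot (deriv g s)) = conormal c n' s) :
    fderivWithin ℝ F S (g s) = ridgeMap g c n' s := by
  rw [← hcur.ridgeMap_eq hs]
  ext1 v
  rw [ridgeMap_apply, ridgeMap_apply, hcur.conormal_eq hs, hu]

/-- Along the ridge there are two possibilities for the tangent plane of a side: the one given by
`n`, and its mirror image. -/
lemma conormal_eq_or_eq {S : Set E2} (hcur : IsCurveIn F S g c J) {s : ℝ} (hs : s ∈ J) :
    fderivWithin ℝ F S (g s) (rot (deriv g s)) = conormal c n s ∨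
      fderivWithin ℝ F S (g s) (rot (deriv g s)) = conormal c (foldedNormal c n) s := by
  refine eq_or_eq_foldedConormal h.isUnitNormalAlong hs (h.normalCurvature_ne s hs) ?_ ?_ ?_
  · rw [hcur.isometric.inner_fderivWithin (hcur.mapsTo hs), inner_rot_rot,
      real_inner_self_eq_norm_sq, hcur.unit_speed s hs]; norm_num
  · rw [hcur.deriv_space hs, hcur.isometric.inner_fderivWithin (hcur.mapsTo hs), inner_rot_self]
  · rw [hcur.inner_deriv_deriv_space hs, h.foldline.curvature s hs]

/-- A side tangent to the surface has the differential given by the normal of the surface. -/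
lemma fderivWithin_of_inner_eq_zero {S : Set E2} (hcur : IsCurveIn F S g c J) {s : ℝ}
    (hs : s ∈ J) (hn : ∀ v, ⟪fderivWithin ℝ F S (g s) v, n s⟫ = 0) :
    fderivWithin ℝ F S (g s) = ridgeMap g c n s := by
  refine fderivWithin_eq_ridgeMap hcur hs ((h.conormal_eq_or_eq hcur hs).resolve_right fun he => ?_)
  have f := h.isUnitNormalAlong.isONFrame hs
  have hkg := h.geodesicCurvature_ne s hs
  have hkn := h.normalCurvature_ne s hs
  have h1 := hn (rot (deriv g s))
  rw [he, conormal_foldedNormal h.isUnitNormalAlong hs, inner_add_left, inner_smul_left,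
    inner_smul_left, f.un, f.nn, foldSin] at h1
  have h2 := (curvature_sq_pos hkn).ne'
  simp [hkg, hkn, h2] at h1

/-- At a crease, the second side has the mirror image of the tangent plane of the first. -/
lemma fderivWithin_of_not_differentiableAt (hsh : IsSheet g J ε A B) (hε : ε = 1 ∨ ε = -1)
    (hFA : IsometricImmersionOn 2 F (A ∪ g '' J)) (hFB : IsometricImmersionOn 2 F (B ∪ g '' J))
    (hFc : ∀ s ∈ J, F (g s) = c s) {s : ℝ} (hs : s ∈ J)
    (hA : fderivWithin ℝ F (A ∪ g '' J) (g s) = ridgeMap g c n s)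
    (hnd : ¬ DifferentiableAt ℝ F (g s)) :
    fderivWithin ℝ F (B ∪ g '' J) (g s) = ridgeMap g c (foldedNormal c n) s := by
  have hε' : -ε = 1 ∨ -ε = -1 := by rcases hε with rfl | rfl <;> simp
  have hcur := h.isCurveIn hsh.swap hε' hFB hFc
  refine fderivWithin_eq_ridgeMap hcur hs ((h.conormal_eq_or_eq hcur hs).resolve_left fun he => ?_)
  have hB := fderivWithin_eq_ridgeMap hcur hs he
  have k1 := hFA.hasFDerivWithinAt (x := g s) (Or.inr ⟨s, hs, rfl⟩)
  have k2 := hFB.hasFDerivWithinAt (x := g s) (Or.inr ⟨s, hs, rfl⟩)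
  rw [hA] at k1
  rw [hB] at k2
  refine hnd ((k1.union k2).hasFDerivAt ?_).differentiableAt
  refine mem_of_superset (hsh.isOpen_sheet.mem_nhds (Or.inl (Or.inr ⟨s, hs, rfl⟩))) ?_
  rintro x ((hx | hx) | hx)
  exacts [Or.inl (Or.inl hx), Or.inl (Or.inr hx), Or.inr (Or.inl hx)]

omit h in
/-- The differential along the ridge determines the unit normal. -/
lemma unitNormal_eq {S : Set E2} {n' : ℝ → E3} (hn' : IsUnitNormalAlong c n' J)
    (hcur : IsCurveIn F S g c J) {s : ℝ} (hs : s ∈ J)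
    (hd : fderivWithin ℝ F S (g s) = ridgeMap g c n' s) : unitNormal F S (g s) = n' s := by
  have hT := hn'.tangent_unit s hs
  have h1 := cross_conormal_tangent hT (hn'.tangent_normal s hs)
  have h2 := cross_conormal_tangent (n := fun t => unitNormal F S (g t)) hT (by
    rw [hcur.deriv_space hs, real_inner_comm]
    exact hcur.isometric.inner_unitNormal_fderivWithin (hcur.mapsTo hs) _)
  have hu : ⟪deriv g s, deriv g s⟫ = 1 := by
    rw [real_inner_self_eq_norm_sq, hcur.unit_speed s hs]; norm_num
  have h3 : conormal c (fun t => unitNormal F S (g t)) s = conormal c n' s := by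
    rw [hcur.conormal_eq hs, hd, ridgeMap_apply, inner_self_rot, inner_rot_rot, hu]; simp
  rw [h3, h1] at h2
  exact (neg_injective h2).symm

end IsFoldData

variable {X : Type*} [TopologicalSpace X] {pos normal : X → E3} {γ : ℝ → X}

/-- A side that is laid onto the surface is tangent to it. -/
lemma inner_fderivWithin_normal_eq_zero {S : Set E2} (hM : IsDevelopable 3 pos normal)
    (hF : IsometricImmersionOn 2 F S) (hS : IsRegularDomain S) {ψ : E2 → X}
    (hψ : ContinuousOn ψ S) (hFψ : ∀ x ∈ S, F x = pos (ψ x)) {x : E2} (hx : x ∈ S) (v : E2) :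
    ⟪fderivWithin ℝ F S x v, normal (ψ x)⟫ = 0 := by
  obtain ⟨φ, hp, hφ⟩ := hM (ψ x)
  obtain ⟨l, hl, hlx⟩ := hφ.contDiffAt_symm (by norm_num) (hψ x hx) hp
  have hsrc := φ.map_target hp
  have hf : IsometricImmersionOn 2 (pos ∘ φ) φ.source := hφ.1.of_le (by norm_num)
  have e0 : l (pos (ψ x)) = φ.symm (ψ x) := (hlx.self_of_nhdsWithin hx).2.symm
  have k1 : HasFDerivAt (pos ∘ φ) (fderivWithin ℝ (pos ∘ φ) φ.source (φ.symm (ψ x)))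
      (l (pos (ψ x))) := by
    rw [e0]
    exact (hf.hasFDerivWithinAt hsrc).hasFDerivAt (φ.open_source.mem_nhds hsrc)
  have k2 : HasFDerivAt l (fderiv ℝ l (pos (ψ x))) (F x) := by
    rw [hFψ x hx]; exact (hl.differentiableAt (by simp)).hasFDerivAt
  have k3 := k2.comp_hasFDerivWithinAt x (hF.hasFDerivWithinAt hx)
  have k4 : HasFDerivWithinAt (fun z => (pos ∘ φ) (l (F z)))
      ((fderivWithin ℝ (pos ∘ φ) φ.source (φ.symm (ψ x))).comp
        ((fderiv ℝ l (pos (ψ x))).comp (fderivWithin ℝ F S x))) S x := by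
    refine HasFDerivAt.comp_hasFDerivWithinAt (g := pos ∘ φ) (f := fun z => l (F z)) x ?_ k3
    rw [hFψ x hx]; exact k1
  have hev : ∀ z, z ∈ S → ψ z ∈ φ.target ∧ φ.symm (ψ z) = l (pos (ψ z)) →
      F z = (pos ∘ φ) (l (F z)) := fun z hz h => by
    rw [hFψ z hz, ← h.2, Function.comp_apply, φ.right_inv h.1]
  have k5 := k4.congr_of_eventuallyEq
    (by filter_upwards [hlx, self_mem_nhdsWithin] with z hz hzS using hev z hzS hz)
    (hev x hx (hlx.self_of_nhdsWithin hx))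
  rw [(hS.uniqueDiffOn x hx).eq (hF.hasFDerivWithinAt hx) k5, ContinuousLinearMap.comp_apply]
  have k6 := hφ.2 _ hsrc
  rw [φ.right_inv hp] at k6
  rw [k6, real_inner_comm]
  exact hf.inner_unitNormal_fderivWithin hsrc _

namespace IsFoldData

variable (h : IsFoldData g c n J)
include h

lemma fderivWithin_of_isConsistent (hM : IsDevelopable 3 pos normal)
    (hn : ∀ s ∈ J, normal (γ s) = n s) (hε : ε = 1 ∨ ε = -1)
    (hF : IsProperFold g c J ε A B F) (hcons : IsConsistent pos γ g J A F) {s : ℝ} (hs : s ∈ J) :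
    fderivWithin ℝ F (A ∪ g '' J) (g s) = ridgeMap g c n s := by
  have hcur := h.isCurveIn hF.isSheet hε hF.isometric_A hF.onto
  obtain ⟨ψ, hψ, hψγ, hFψ⟩ := hcons
  refine h.fderivWithin_of_inner_eq_zero hcur hs fun v => ?_
  rw [← hn s hs, ← hψγ s hs]
  exact inner_fderivWithin_normal_eq_zero hM hF.isometric_A hcur.regular hψ hFψ (hcur.mapsTo hs) v

lemma fderivWithin_of_isConsistent' (hM : IsDevelopable 3 pos normal)
    (hn : ∀ s ∈ J, normal (γ s) = n s) (hε : ε = 1 ∨ ε = -1)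
    (hF : IsProperFold g c J ε A B F) (hcons : IsConsistent pos γ g J A F) {s : ℝ} (hs : s ∈ J) :
    fderivWithin ℝ F (B ∪ g '' J) (g s) = ridgeMap g c (foldedNormal c n) s :=
  h.fderivWithin_of_not_differentiableAt hF.isSheet hε hF.isometric_A hF.isometric_B hF.onto hs
    (h.fderivWithin_of_isConsistent hM hn hε hF hcons hs) (hF.crease s hs)

lemma ridgeNormal_eq (hM : IsDevelopable 3 pos normal)
    (hn : ∀ s ∈ J, normal (γ s) = n s) (hε : ε = 1 ∨ ε = -1)
    (hF : IsProperFold g c J ε A B F) (hcons : IsConsistent pos γ g J A F) {s : ℝ} (hs : s ∈ J) :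
    ridgeNormal g J B F s = foldedNormal c n s :=
  unitNormal_eq h.isUnitNormalAlong_folded
    (h.isCurveIn hF.isSheet.swap (by rcases hε with rfl | rfl <;> simp) hF.isometric_B hF.onto) hs
    (h.fderivWithin_of_isConsistent' hM hn hε hF hcons hs)

/-- Near the foldline, a proper fold is given by the two developable strips that its normals along
the ridge determine. -/
lemma eventually_eq (hM : IsDevelopable 3 pos normal)
    (hn : ∀ s ∈ J, normal (γ s) = n s) (hε : ε = 1 ∨ ε = -1)
    (hF : IsProperFold g c J ε A B F) (hcons : IsConsistent pos γ g J A F)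
    (hF' : IsProperFold g c J ε A' B' F') (hcons' : IsConsistent pos γ g J A' F') {s : ℝ}
    (hs : s ∈ J) : ∀ᶠ x in 𝓝 (g s), F x = F' x := by
  have hε' : -ε = 1 ∨ -ε = -1 := by rcases hε with rfl | rfl <;> simp
  have hRA := h.isRidgeData.isRidgeFrame
  have hRB := h.isRidgeData_folded.isRidgeFrame
  have he := h.embedded
  obtain ⟨UA, -, -, hmA⟩ := hRA.eventually_injOn_rulingMap hs
  obtain ⟨UB, -, -, hmB⟩ := hRB.eventually_injOn_rulingMap hs
  have a1 := hF.isSheet.eventually_eq_ruledStrip he hε hRA hF.isometric_A hF.onto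
    (fun s hs => h.fderivWithin_of_isConsistent hM hn hε hF hcons hs) hs
  have a2 := hF'.isSheet.eventually_eq_ruledStrip he hε hRA hF'.isometric_A hF'.onto
    (fun s hs => h.fderivWithin_of_isConsistent hM hn hε hF' hcons' hs) hs
  have a3 := hF.isSheet.swap.eventually_rulingMap_mem he hε' hRA hs
  have b1 := hF.isSheet.swap.eventually_eq_ruledStrip he hε' hRB hF.isometric_B hF.onto
    (fun s hs => h.fderivWithin_of_isConsistent' hM hn hε hF hcons hs) hs
  have b2 := hF'.isSheet.swap.eventually_eq_ruledStrip he hε' hRB hF'.isometric_B hF'.onto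
    (fun s hs => h.fderivWithin_of_isConsistent' hM hn hε hF' hcons' hs) hs
  have b3 := hF.isSheet.eventually_rulingMap_mem he hε hRB hs
  have hA : ∀ᶠ x in 𝓝 (g s), ∃ y, rulingMap g (ridgeRuling g c n) y = x ∧
      (0 ≤ ε * y.2 → F x = F' x) ∧ (0 < -ε * y.2 → x ∈ B) := by
    rw [← hmA, eventually_map]
    filter_upwards [a1, a2, a3] with y h1 h2 h3
    exact ⟨y, rfl, fun h0 => by rw [h1 h0, h2 h0], h3.2⟩
  have hB : ∀ᶠ x in 𝓝 (g s), ∃ y, rulingMap g (ridgeRuling g c (foldedNormal c n)) y = x ∧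
      (0 ≤ -ε * y.2 → F x = F' x) ∧ (0 < ε * y.2 → x ∈ A) := by
    rw [← hmB, eventually_map]
    filter_upwards [b1, b2, b3] with y h1 h2 h3
    exact ⟨y, rfl, fun h0 => by rw [h1 h0, h2 h0], h3.2⟩
  filter_upwards [hA, hB] with x ⟨y, _, h1, h2⟩ ⟨z, _, h3, h4⟩
  -- if the coordinate on the first strip has the wrong sign, the point is in `B`, so that its
  -- coordinate on the second strip has the right one
  rcases le_or_gt 0 (ε * y.2) with h0 | h0
  · exact h1 h0
  · refine h3 (not_lt.1 fun hz => ?_)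
    exact disjoint_left.1 hF.disjoint (h4 (by linarith)) (h2 (by linarith))

end IsFoldData

end Fold

/-! ### Existence of the fold -/

section Existence

variable {g : ℝ → E2} {c n : ℝ → E3} {J : Set ℝ} {ε : ℝ}

/-- The derivative within `S` is that of the extension `f` to the open set `O`. -/
lemma IsometricImmersionOn.restrict {m : WithTop ℕ∞} (hm : m ≠ 0) {f F : E2 → E3} {O S : Set E2}
    (hf : IsometricImmersionOn m f O) (hO : IsOpen O) (hS : UniqueDiffOn ℝ S) (hSO : S ⊆ O)
    (he : EqOn F f S) : IsometricImmersionOn m F S ∧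
      ∀ x ∈ S, fderivWithin ℝ F S x = fderivWithin ℝ f O x := by
  have key : ∀ x ∈ S, fderivWithin ℝ F S x = fderivWithin ℝ f O x := by
    intro x hx
    have h1 : DifferentiableAt ℝ f x :=
      (hf.1.contDiffAt (hO.mem_nhds (hSO hx))).differentiableAt hm
    rw [fderivWithin_congr he (he hx), h1.fderivWithin (hS x hx),
      fderivWithin_of_isOpen hO (hSO hx)]
  exact ⟨⟨(hf.1.mono hSO).congr he, fun x hx v => by rw [key x hx]; exact hf.2 x (hSO hx) v⟩, key⟩

section Sheet

variable {L : ℝ → E2 →L[ℝ] E3} {ρ : ℝ → E2} {V : Set (ℝ × ℝ)}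

lemma IsRulingDomain.continuousOn_rulingCoord (hV : IsRulingDomain g ρ J V)
    (h : IsRidgeFrame g c L ρ J) : ContinuousOn (rulingCoord g ρ V) (rulingMap g ρ '' V) := by
  rintro _ ⟨y, hy, rfl⟩
  exact (hV.rulingCoord_spec h hy).1.continuousAt.continuousWithinAt

/-- Along the foldline, the coordinate on the rulings grows to the left. -/
lemma IsRulingDomain.eventually_rulingCoord (hV : IsRulingDomain g ρ J V)
    (h : IsRidgeFrame g c L ρ J) {s : ℝ} (hs : s ∈ J) :
    ∀ᶠ t in 𝓝[≠] (0 : ℝ), 0 < t * (rulingCoord g ρ V (g s + t • rot (deriv g s))).2 := by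
  have hd : HasFDerivAt (rulingCoord g ρ V) (fderiv ℝ (rulingCoord g ρ V) (g s)) (g s) := by
    have := (hV.rulingCoord_spec h (hV.mem s hs)).1.differentiableAt (by simp)
    rw [rulingMap_zero] at this
    exact this.hasFDerivAt
  set D := fderiv ℝ (rulingCoord g ρ V) (g s) with hD
  have h1 : HasFDerivAt (fun x => rulingMap g ρ (rulingCoord g ρ V x))
      ((fderiv ℝ (rulingMap g ρ) (s, 0)).comp D) (g s) := by
    refine HasFDerivAt.comp (g := rulingMap g ρ) (g s) ?_ hd
    rw [hV.rulingCoord_planar hs]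
    exact ((h.contDiffAt_rulingMap hs 0).differentiableAt (by simp)).hasFDerivAt
  have h2 : (fun x => rulingMap g ρ (rulingCoord g ρ V x)) =ᶠ[𝓝 (g s)] id := by
    filter_upwards [(hV.isOpen_image h).mem_nhds (hV.mem_image hs)] with x hx
    obtain ⟨z, hz, rfl⟩ := hx
    simp only [id, hV.rulingCoord_rulingMap hz]
  have h3 := congrArg (fun M : E2 →L[ℝ] E2 => ⟪M (rot (deriv g s)), rot (deriv g s)⟫)
    (h1.unique ((hasFDerivAt_id (𝕜 := ℝ) (g s)).congr_of_eventuallyEq h2))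
  have hu : ⟪deriv g s, deriv g s⟫ = 1 := by
    rw [real_inner_self_eq_norm_sq, h.unit_speed s hs]; norm_num
  have h4 : (D (rot (deriv g s))).2 = 1 := by
    simp only [ContinuousLinearMap.comp_apply, ContinuousLinearMap.id_apply] at h3
    rw [show D (rot (deriv g s)) = ((D (rot (deriv g s))).1, (D (rot (deriv g s))).2) from rfl,
      h.fderiv_rulingMap hs, inner_rot_rot, hu] at h3
    simpa [inner_add_left, inner_smul_left, inner_self_rot, h.inner_ruling s hs] using h3
  have h5 : HasDerivAt (fun t : ℝ => (rulingCoord g ρ V (g s + t • rot (deriv g s))).2) 1 0 := by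
    have e1 : HasDerivAt (fun t : ℝ => g s + t • rot (deriv g s)) (rot (deriv g s)) 0 := by
      simpa using ((hasDerivAt_id (0 : ℝ)).smul_const (rot (deriv g s))).const_add (g s)
    have e2 : HasFDerivAt (fun x => (rulingCoord g ρ V x).2)
        ((ContinuousLinearMap.snd ℝ ℝ ℝ).comp D) (g s + (0 : ℝ) • rot (deriv g s)) := by
      rw [zero_smul, add_zero]; exact hd.snd
    have := e2.comp_hasDerivAt 0 e1
    exact this.congr_deriv h4
  have h6 := hasDerivAt_iff_tendsto_slope_zero.1 h5
  filter_upwards [h6.eventually (lt_mem_nhds zero_lt_one), self_mem_nhdsWithin] with t ht ht0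
  have ht0' : t ≠ 0 := ht0
  simp only [zero_add, zero_smul, add_zero, hV.rulingCoord_planar hs, sub_zero, smul_eq_mul] at ht
  have : t * (rulingCoord g ρ V (g s + t • rot (deriv g s))).2 = t ^ 2 *
    (t⁻¹ * (rulingCoord g ρ V (g s + t • rot (deriv g s))).2) := by field_simp
  rw [this]; positivity

/-- The sides of the foldline in a neighbourhood `O` with coordinates by rulings are told apart by
the sign of the coordinate on the rulings. -/
lemma IsRulingDomain.isSheet (hV : IsRulingDomain g ρ J V) (h : IsRidgeFrame g c L ρ J)
    (hε : ε = 1 ∨ ε = -1) {O : Set E2} (hO : IsOpen O) (hOV : O ⊆ rulingMap g ρ '' V)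
    (hgO : ∀ s ∈ J, g s ∈ O) :
    IsSheet g J ε {x ∈ O | 0 < ε * (rulingCoord g ρ V x).2}
      {x ∈ O | ε * (rulingCoord g ρ V x).2 < 0} := by
  have hεε : ε * ε = 1 := by rcases hε with rfl | rfl <;> norm_num
  have hε0 : ε ≠ 0 := by rcases hε with rfl | rfl <;> norm_num
  have hcont : ContinuousOn (fun x => ε * (rulingCoord g ρ V x).2) O :=
    continuousOn_const.mul (continuous_snd.comp_continuousOn
      ((hV.continuousOn_rulingCoord h).mono hOV))
  have hzero : ∀ x ∈ g '' J, ε * (rulingCoord g ρ V x).2 = 0 := by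
    rintro _ ⟨s, hs, rfl⟩
    rw [hV.rulingCoord_planar hs, mul_zero]
  refine ⟨hcont.isOpen_inter_preimage hO isOpen_Ioi, hcont.isOpen_inter_preimage hO isOpen_Iio,
    ?_, ?_, ?_, ?_, ?_⟩
  · convert hO using 1
    ext x
    constructor
    · rintro ((hx | ⟨s, hs, rfl⟩) | hx)
      exacts [hx.1, hgO s hs, hx.1]
    · intro hx
      rcases lt_trichotomy (ε * (rulingCoord g ρ V x).2) 0 with h0 | h0 | h0
      · exact Or.inr ⟨hx, h0⟩
      · refine Or.inl (Or.inr ?_)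
        obtain ⟨y, hy, rfl⟩ := hOV hx
        rw [hV.rulingCoord_rulingMap hy] at h0
        have hy2 : y.2 = 0 := (mul_eq_zero.1 h0).resolve_left hε0
        refine ⟨y.1, hV.fst_mem y hy, ?_⟩
        rw [← rulingMap_zero g ρ, ← hy2]
      · exact Or.inl (Or.inl ⟨hx, h0⟩)
  · exact disjoint_left.2 fun x hx hx' => lt_asymm hx.2 hx'.2
  · exact disjoint_left.2 fun x hx hx' => hx.2.ne' (hzero x hx')
  · exact disjoint_left.2 fun x hx hx' => hx.2.ne (hzero x hx')
  · intro s hs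
    have hev := hV.eventually_rulingCoord h hs
    have hOe : ∀ᶠ t : ℝ in 𝓝[≠] 0, g s + t • rot (deriv g s) ∈ O := by
      have : ContinuousAt (fun t : ℝ => g s + t • rot (deriv g s)) 0 := by fun_prop
      exact (this.mono_left nhdsWithin_le_nhds).eventually
        (hO.mem_nhds (by simpa using hgO s hs))
    have htend : ∀ a : ℝ, a ≠ 0 → Tendsto (fun t : ℝ => a * t) (𝓝[>] 0) (𝓝[≠] 0) := by
      intro a ha
      refine tendsto_nhdsWithin_iff.2 ⟨?_, ?_⟩
      · have : ContinuousAt (fun t : ℝ => a * t) 0 := by fun_prop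
        simpa using this.tendsto.mono_left nhdsWithin_le_nhds
      · filter_upwards [self_mem_nhdsWithin] with t ht
        exact mul_ne_zero ha (ne_of_gt ht)
    filter_upwards [(htend ε hε0).eventually (hev.and hOe),
      (htend (-ε) (neg_ne_zero.2 hε0)).eventually (hev.and hOe), self_mem_nhdsWithin]
      with t h1 h2 ht
    have ht : 0 < t := ht
    rw [neg_mul, neg_smul, ← sub_eq_add_neg] at h2
    refine ⟨⟨h1.2, ?_⟩, ⟨h2.2, ?_⟩⟩
    · have := h1.1
      by_contra hcon
      nlinarith
    · have := h2.1
      by_contra hcon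
      nlinarith

end Sheet

variable {X : Type*} [TopologicalSpace X] {pos : X → E3} {γ : ℝ → X}

/-- The two strips through the ridge, one on each side of the foldline, form a proper fold. It is
consistent with every surface onto which the first strip lifts. -/
lemma IsFoldData.exists_fold (h : IsFoldData g c n J) (hε : ε = 1 ∨ ε = -1)
    (hlift : ∃ (V : Set (ℝ × ℝ)) (k : ℝ × ℝ → X), IsOpen V ∧ (∀ s ∈ J, (s, (0 : ℝ)) ∈ V) ∧
      ContinuousOn k V ∧ (∀ y ∈ V, pos (k y) = c y.1 + y.2 • (conormal c n y.1 -
          (relativeTorsion c n y.1 / normalCurvature c n y.1) • deriv c y.1)) ∧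
      ∀ s ∈ J, k (s, 0) = γ s) :
    ∃ (A B : Set E2) (F : E2 → E3),
      IsProperFold g c J ε A B F ∧ IsConsistent pos γ g J A F := by
  classical
  have hε' : -ε = 1 ∨ -ε = -1 := by rcases hε with rfl | rfl <;> simp
  obtain ⟨W, k, hW, hWJ, hk, hkpos, hkγ⟩ := hlift
  have hRA := h.isRidgeData.isRidgeFrame
  have hRB := h.isRidgeData_folded.isRidgeFrame
  obtain ⟨VA', hVA'⟩ := hRA.exists_isRulingDomain h.embedded
  obtain ⟨VB, hVB⟩ := hRB.exists_isRulingDomain h.embedded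
  have hVA := hVA'.inter hW hWJ
  -- the rulings of the first strip are cut short so that the strip lifts to the surface
  set VA := VA' ∩ W with hVAdef
  set ρA := ridgeRuling g c n
  set ρB := ridgeRuling g c (foldedNormal c n)
  set fA := stripMap g c (ridgeMap g c n) ρA VA with hfA
  set fB := stripMap g c (ridgeMap g c (foldedNormal c n)) ρB VB with hfB
  set O := rulingMap g ρA '' VA ∩ rulingMap g ρB '' VB with hO
  have hOo : IsOpen O := (hVA.isOpen_image hRA).inter (hVB.isOpen_image hRB)
  have hgO : ∀ s ∈ J, g s ∈ O := fun s hs => ⟨hVA.mem_image hs, hVB.mem_image hs⟩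
  have hsh := hVA.isSheet hRA hε hOo inter_subset_left hgO
  set A := {x ∈ O | 0 < ε * (rulingCoord g ρA VA x).2} with hA
  set B := {x ∈ O | ε * (rulingCoord g ρA VA x).2 < 0} with hB
  set F := (A ∪ g '' J).piecewise fA fB with hF
  have hAO : A ∪ g '' J ⊆ O := by
    rintro x (hx | ⟨s, hs, rfl⟩)
    exacts [hx.1, hgO s hs]
  have hBO : B ∪ g '' J ⊆ O := by
    rintro x (hx | ⟨s, hs, rfl⟩)
    exacts [hx.1, hgO s hs]
  have hFA : EqOn F fA (A ∪ g '' J) := piecewise_eqOn _ _ _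
  have hFB : EqOn F fB (B ∪ g '' J) := by
    rintro x (hx | ⟨s, hs, rfl⟩)
    · refine piecewise_eq_of_notMem _ _ _ ?_
      rintro (hx' | hx')
      exacts [disjoint_left.1 hsh.disjoint hx' hx, disjoint_left.1 hsh.disjoint_B hx hx']
    · rw [hFA (Or.inr ⟨s, hs, rfl⟩), hfA, hfB, hVA.stripMap_planar hs, hVB.stripMap_planar hs]
  have hrA := hsh.isRegularDomain h.embedded hε
  have hrB := hsh.swap.isRegularDomain h.embedded hε'
  obtain ⟨hiA, hdA⟩ := (hVA.isometricImmersionOn_stripMap hRA).restrict (by simp)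
    (hVA.isOpen_image hRA) hrA.uniqueDiffOn (hAO.trans inter_subset_left) hFA
  obtain ⟨hiB, hdB⟩ := (hVB.isometricImmersionOn_stripMap hRB).restrict (by simp)
    (hVB.isOpen_image hRB) hrB.uniqueDiffOn (hBO.trans inter_subset_right) hFB
  refine ⟨A, B, F, ⟨hsh.isOpen_A, hsh.isOpen_B, hsh.isOpen_sheet, hsh.disjoint, hsh.disjoint_A,
    hsh.disjoint_B, hsh.sides, ?_, hiA, hiB, ?_, ?_⟩, ?_⟩
  · intro s hs
    rw [hFA (Or.inr ⟨s, hs, rfl⟩), hfA, hVA.stripMap_planar hs]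
  · intro s hs hd
    have e1 := hdA (g s) (Or.inr ⟨s, hs, rfl⟩)
    have e2 := hdB (g s) (Or.inr ⟨s, hs, rfl⟩)
    rw [hd.fderivWithin (hrA.uniqueDiffOn _ (Or.inr ⟨s, hs, rfl⟩))] at e1
    rw [hd.fderivWithin (hrB.uniqueDiffOn _ (Or.inr ⟨s, hs, rfl⟩))] at e2
    have e3 := hVA.fderivWithin_stripMap hRA (hVA.mem s hs)
    have e4 := hVB.fderivWithin_stripMap hRB (hVB.mem s hs)
    rw [rulingMap_zero] at e3 e4
    have e5 := congrArg (fun M : E2 →L[ℝ] E3 => M (rot (deriv g s)))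
      (e4.symm.trans (e2.symm.trans (e1.trans e3)))
    have hu : ⟪deriv g s, deriv g s⟫ = 1 := by
      rw [real_inner_self_eq_norm_sq, h.foldline.unit_speed s hs]; norm_num
    simp only [ridgeMap_apply, inner_self_rot, inner_rot_rot, hu, zero_smul, zero_add,
      one_smul] at e5
    exact conormal_foldedNormal_ne h.isUnitNormalAlong hs (h.normalCurvature_ne s hs) e5
  · intro s hs
    rw [h.foldline.curvature s hs]
    refine ⟨abs_pos.2 (h.geodesicCurvature_ne s hs), ?_⟩
    refine abs_lt_of_sq_lt_sq ?_ (norm_nonneg _)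
    rw [h.isUnitNormalAlong.norm_sq_deriv_tangent hs]
    have := h.normalCurvature_ne s hs
    have : 0 < normalCurvature c n s ^ 2 := by positivity
    linarith
  · have hmem : ∀ x ∈ A ∪ g '' J, rulingCoord g ρA VA x ∈ VA := by
      intro x hx
      obtain ⟨y, hy, rfl⟩ := (hAO hx).1
      rwa [hVA.rulingCoord_rulingMap hy]
    refine ⟨fun x => k (rulingCoord g ρA VA x), ?_, ?_, ?_⟩
    · exact hk.comp ((hVA.continuousOn_rulingCoord hRA).mono (hAO.trans inter_subset_left))
        fun x hx => (hmem x hx).2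
    · intro s hs
      simp only [hVA.rulingCoord_planar hs, hkγ s hs]
    · intro x hx
      rw [hFA hx, hkpos _ (hmem x hx).2, hfA, stripMap,
        h.isRidgeData.ruledStrip_eq (hVA.fst_mem _ (hmem x hx))]

end Existence

/-! ### Plane curves with prescribed curvature -/

section Foldline

lemma exists_primitive {n : WithTop ℕ∞} (hn : n ≠ ω) {f : ℝ → ℝ} {I : Set ℝ} (hI : IsOpen I)
    (hc : I.OrdConnected) (hf : ContDiffOn ℝ n f I) :
    ∃ F : ℝ → ℝ, ContDiffOn ℝ (n + 1) F I ∧ ∀ s ∈ I, HasDerivAt F (f s) s := by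
  rcases I.eq_empty_or_nonempty with rfl | ⟨s₀, hs₀⟩
  · exact ⟨0, by simp, by simp⟩
  have hd : ∀ s ∈ I, HasDerivAt (fun t => ∫ x in s₀..t, f x) (f s) s := by
    intro s hs
    refine intervalIntegral.integral_hasDerivAt_right ?_ ?_ ?_
    · exact (hf.continuousOn.mono (hc.uIcc_subset hs₀ hs)).intervalIntegrable
    · exact hf.continuousOn.stronglyMeasurableAtFilter hI s hs
    · exact hf.continuousOn.continuousAt (hI.mem_nhds hs)
  refine ⟨_, ?_, hd⟩
  rw [contDiffOn_succ_iff_deriv_of_isOpen hI]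
  exact ⟨fun s hs => (hd s hs).differentiableAt.differentiableWithinAt, fun h => absurd h hn,
    hf.congr fun s hs => (hd s hs).deriv⟩

/-- The plane curve with curvature `κ`: its tangent turns by the integral of `κ`. -/
lemma exists_isFoldline {κ : ℝ → ℝ} {I : Set ℝ} (hI : IsOpen I) (hc : I.OrdConnected)
    (hκ : ContDiffOn ℝ 2 κ I) : ∃ g : ℝ → E2, IsFoldline g I κ := by
  obtain ⟨θ, hθ, hθd⟩ := exists_primitive (by simp) hI hc hκ
  rw [show (2 : WithTop ℕ∞) + 1 = 3 by norm_num] at hθ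
  obtain ⟨x, hx, hxd⟩ := exists_primitive (by simp) hI hc (Real.contDiff_cos.comp_contDiffOn hθ)
  obtain ⟨y, hy, hyd⟩ := exists_primitive (by simp) hI hc (Real.contDiff_sin.comp_contDiffOn hθ)
  rw [show (3 : WithTop ℕ∞) + 1 = 4 by norm_num] at hx hy
  have hd : ∀ s ∈ I, HasDerivAt (fun s => x s • (!₂[1, 0] : E2) + y s • (!₂[0, 1] : E2))
      (Real.cos (θ s) • (!₂[1, 0] : E2) + Real.sin (θ s) • (!₂[0, 1] : E2)) s := fun s hs =>
    ((hxd s hs).smul_const _).add ((hyd s hs).smul_const _)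
  refine ⟨fun s => x s • (!₂[1, 0] : E2) + y s • (!₂[0, 1] : E2),
    (hx.smul contDiffOn_const).add (hy.smul contDiffOn_const), ?_, ?_⟩
  · intro s hs
    have : ‖deriv (fun s => x s • (!₂[1, 0] : E2) + y s • (!₂[0, 1] : E2)) s‖ ^ 2 = 1 ^ 2 := by
      rw [(hd s hs).deriv, ← real_inner_self_eq_norm_sq, inner_eq_two]
      simp [← sq]
    exact (sq_eq_sq₀ (norm_nonneg _) zero_le_one).1 this
  · intro s hs
    have h2 : HasDerivAt (deriv fun s => x s • (!₂[1, 0] : E2) + y s • (!₂[0, 1] : E2))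
        ((-Real.sin (θ s) * κ s) • (!₂[1, 0] : E2) + (Real.cos (θ s) * κ s) • (!₂[0, 1] : E2))
        s := by
      refine (((hθd s hs).cos.smul_const _).add ((hθd s hs).sin.smul_const _)).congr_of_eventuallyEq
        ?_
      filter_upwards [hI.mem_nhds hs] with t ht using (hd t ht).deriv
    rw [planarCurvature, h2.deriv, (hd s hs).deriv, inner_eq_two]
    simp [rot]
    linear_combination κ s * Real.sin_sq_add_cos_sq (θ s)

end Foldline

/-! ### The torsion of the new developable -/

section Formula

/-- The vector product with a fixed vector is antisymmetric. -/
lemma inner_cross_comm (a b d : E3) : ⟪cross a b, d⟫ = - ⟪b, cross a d⟫ := by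
  rw [inner_eq_three, inner_eq_three]; simp [cross_zero, cross_one, cross_two]; ring

lemma inner_cross_cross {a b d : E3} (ha : ⟪a, a⟫ = 1) (hb : ⟪b, a⟫ = 0) :
    ⟪cross a b, cross a d⟫ = ⟪b, d⟫ := by
  have : ⟪cross a b, cross a d⟫ = ⟪a, a⟫ * ⟪b, d⟫ - ⟪b, a⟫ * ⟪a, d⟫ := by
    simp only [inner_eq_three]; simp [cross_zero, cross_one, cross_two]; ring
  rw [this, ha, hb]; ring

variable {c₁ n₁ c₂ n₂ : ℝ → E3} {I₁ I₂ : Set ℝ} {s₂ : ℝ → ℝ} {s : ℝ}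

/-- Two curves with the same normal at corresponding points. -/
structure IsNormalLink (c₁ n₁ c₂ n₂ : ℝ → E3) (I₁ I₂ : Set ℝ) (s₂ : ℝ → ℝ) : Prop where
  isUnitNormalAlong₁ : IsUnitNormalAlong c₁ n₁ I₁
  isUnitNormalAlong₂ : IsUnitNormalAlong c₂ n₂ I₂
  mapsTo : MapsTo s₂ I₁ I₂
  contDiffOn : ContDiffOn ℝ 2 s₂ I₁
  normal_eq : ∀ s ∈ I₁, n₁ s = n₂ (s₂ s)

namespace IsNormalLink

variable (h : IsNormalLink c₁ n₁ c₂ n₂ I₁ I₂ s₂)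
include h

lemma hasDerivAt (hs : s ∈ I₁) : HasDerivAt s₂ (deriv s₂ s) s :=
  ((h.contDiffOn.contDiffAt (h.isUnitNormalAlong₁.isOpen.mem_nhds hs)).differentiableAt
    (by simp)).hasDerivAt

/-- Both curves see the same derivative of the normal. -/
lemma deriv_normal_eq (hs : s ∈ I₁) : normalCurvature c₁ n₁ s • deriv c₁ s +
    relativeTorsion c₁ n₁ s • conormal c₁ n₁ s = deriv s₂ s •
      (normalCurvature c₂ n₂ (s₂ s) • deriv c₂ (s₂ s) +
        relativeTorsion c₂ n₂ (s₂ s) • conormal c₂ n₂ (s₂ s)) := by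
  have h1 := h.isUnitNormalAlong₁.hasDerivAt_normal hs
  have h2 := (h.isUnitNormalAlong₂.hasDerivAt_normal (h.mapsTo hs)).scomp s (h.hasDerivAt hs)
  have h3 := h1.unique (h2.congr_of_eventuallyEq (by
    filter_upwards [h.isUnitNormalAlong₁.isOpen.mem_nhds hs] with t ht using h.normal_eq t ht))
  have h4 := congrArg Neg.neg h3
  convert h4 using 1 <;> module

lemma deriv_ne_zero (hs : s ∈ I₁) (hne : normalCurvature c₁ n₁ s ≠ 0) : deriv s₂ s ≠ 0 := by
  intro h0
  have f := h.isUnitNormalAlong₁.isONFrame hs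
  have h1 := congrArg (fun v => ⟪v, deriv c₁ s⟫) (h.deriv_normal_eq hs)
  simp only [h0, zero_smul, inner_zero_left, inner_add_left, inner_smul_left, f.TT,
    real_inner_comm (deriv c₁ s) (conormal c₁ n₁ s), f.Tu] at h1
  exact hne (by simpa using h1)

lemma inner_conormal_tangent (hs : s ∈ I₁) :
    ⟪deriv c₁ s, conormal c₂ n₂ (s₂ s)⟫ = - ⟪conormal c₁ n₁ s, deriv c₂ (s₂ s)⟫ := by
  rw [conormal, conormal, h.normal_eq s hs, inner_cross_comm, neg_neg]

lemma inner_conormal_conormal (hs : s ∈ I₁) :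
    ⟪conormal c₁ n₁ s, conormal c₂ n₂ (s₂ s)⟫ = ⟪deriv c₁ s, deriv c₂ (s₂ s)⟫ := by
  rw [conormal, conormal, ← h.normal_eq s hs]
  exact inner_cross_cross (h.isUnitNormalAlong₁.normal_unit s hs)
    (h.isUnitNormalAlong₁.tangent_normal s hs)

/-- The derivative of the identity `s₂' k₂ₙ = ⟨T₁, T₂⟩ k₁ₙ + ⟨u₁, T₂⟩ τ₁`. -/
lemma deriv_normalCurvature (hs : s ∈ I₁) {k₁' t₁' k₂' : ℝ}
    (hk₁ : HasDerivAt (normalCurvature c₁ n₁) k₁' s)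
    (ht₁ : HasDerivAt (relativeTorsion c₁ n₁) t₁' s)
    (hk₂ : HasDerivAt (normalCurvature c₂ n₂) k₂' (s₂ s)) :
    deriv (deriv s₂) s * normalCurvature c₂ n₂ (s₂ s) + deriv s₂ s ^ 2 * k₂' =
      ⟪deriv c₁ s, deriv c₂ (s₂ s)⟫ * k₁' + ⟪conormal c₁ n₁ s, deriv c₂ (s₂ s)⟫ * t₁' +
      deriv s₂ s * relativeTorsion c₂ n₂ (s₂ s) *
        (deriv s₂ s * geodesicCurvature c₂ n₂ (s₂ s) - geodesicCurvature c₁ n₁ s) := by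
  have hI := h.isUnitNormalAlong₁.isOpen.mem_nhds hs
  have f₁ := h.isUnitNormalAlong₁.isONFrame hs
  have f₂ := h.isUnitNormalAlong₂.isONFrame (h.mapsTo hs)
  have hT₁ := h.isUnitNormalAlong₁.hasDerivAt_tangent hs
  have hu₁ := h.isUnitNormalAlong₁.hasDerivAt_conormal hs
  have hp := h.hasDerivAt hs
  have hT₂ := (h.isUnitNormalAlong₂.hasDerivAt_tangent (h.mapsTo hs)).scomp s hp
  have hpp : HasDerivAt (deriv s₂) (deriv (deriv s₂) s) s :=
    (((h.contDiffOn.deriv_of_isOpen (m := 1) h.isUnitNormalAlong₁.isOpen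
      (by norm_num)).contDiffAt hI).differentiableAt (by simp)).hasDerivAt
  have hl := hpp.mul (hk₂.comp s hp)
  have hr := (hk₁.mul (hT₁.inner ℝ hT₂)).add (ht₁.mul (hu₁.inner ℝ hT₂))
  have he : (fun t => deriv s₂ t * normalCurvature c₂ n₂ (s₂ t)) =ᶠ[𝓝 s] fun t =>
      normalCurvature c₁ n₁ t * ⟪deriv c₁ t, deriv c₂ (s₂ t)⟫ +
        relativeTorsion c₁ n₁ t * ⟪conormal c₁ n₁ t, deriv c₂ (s₂ t)⟫ := by
    filter_upwards [hI] with t ht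
    have f₂ := h.isUnitNormalAlong₂.isONFrame (h.mapsTo ht)
    have h1 := congrArg (fun v => ⟪v, deriv c₂ (s₂ t)⟫) (h.deriv_normal_eq ht)
    simp only [inner_add_left, inner_smul_left, f₂.TT, conj_trivial,
      real_inner_comm (deriv c₂ (s₂ t)) (conormal c₂ n₂ (s₂ t)), f₂.Tu] at h1
    linarith
  have hτ : deriv s₂ s * relativeTorsion c₂ n₂ (s₂ s) =
      relativeTorsion c₁ n₁ s * ⟪deriv c₁ s, deriv c₂ (s₂ s)⟫ -
        normalCurvature c₁ n₁ s * ⟪conormal c₁ n₁ s, deriv c₂ (s₂ s)⟫ := by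
    have h1 := congrArg (fun v => ⟪v, conormal c₂ n₂ (s₂ s)⟫) (h.deriv_normal_eq hs)
    simp only [inner_add_left, inner_smul_left, f₂.uu, conj_trivial, f₂.Tu,
      h.inner_conormal_tangent hs, h.inner_conormal_conormal hs] at h1
    linarith
  have hnT₂ : ⟪n₁ s, deriv c₂ (s₂ s)⟫ = 0 := by
    rw [h.normal_eq s hs, real_inner_comm]; exact f₂.Tn
  have hTn : ⟪deriv c₁ s, n₂ (s₂ s)⟫ = 0 := by rw [← h.normal_eq s hs]; exact f₁.Tn
  have hun : ⟪conormal c₁ n₁ s, n₂ (s₂ s)⟫ = 0 := by rw [← h.normal_eq s hs]; exact f₁.un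
  have hd := hl.unique (hr.congr_of_eventuallyEq he)
  simp only [Function.comp_apply, inner_add_left, inner_add_right, inner_smul_left,
    inner_smul_right, conj_trivial, hnT₂, hTn, hun, h.inner_conormal_tangent hs,
    h.inner_conormal_conormal hs] at hd
  linear_combination hd - (deriv s₂ s * geodesicCurvature c₂ n₂ (s₂ s) -
    geodesicCurvature c₁ n₁ s) * hτ

/-- The angle between the two curves is the difference of their angles with the ruling. -/
lemma inner_eq_cos_sin (hs : s ∈ I₁) {r : E3} {β₁ β₂ : ℝ}
    (h₁ : IsAngle (deriv c₁ s) (conormal c₁ n₁ s) r β₁)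
    (h₂ : IsAngle (deriv c₂ (s₂ s)) (conormal c₂ n₂ (s₂ s)) r β₂) :
    ⟪deriv c₁ s, deriv c₂ (s₂ s)⟫ = Real.cos (β₁ - β₂) ∧
      ⟪conormal c₁ n₁ s, deriv c₂ (s₂ s)⟫ = Real.sin (β₁ - β₂) := by
  have f₂ := h.isUnitNormalAlong₂.isONFrame (h.mapsTo hs)
  have e : Real.cos β₁ • deriv c₁ s + Real.sin β₁ • conormal c₁ n₁ s =
    Real.cos β₂ • deriv c₂ (s₂ s) + Real.sin β₂ • conormal c₂ n₂ (s₂ s) := h₁.symm.trans h₂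
  have e1 := congrArg (fun v => ⟪v, deriv c₂ (s₂ s)⟫) e
  have e2 := congrArg (fun v => ⟪v, conormal c₂ n₂ (s₂ s)⟫) e
  simp only [inner_add_left, inner_smul_left, f₂.TT, f₂.uu, conj_trivial, f₂.Tu,
    real_inner_comm (deriv c₂ (s₂ s)) (conormal c₂ n₂ (s₂ s)),
    h.inner_conormal_tangent hs, h.inner_conormal_conormal hs] at e1 e2
  have := Real.sin_sq_add_cos_sq β₁
  constructor
  · rw [Real.cos_sub]
    linear_combination Real.cos β₁ * e1 + Real.sin β₁ * e2 - ⟪deriv c₁ s, deriv c₂ (s₂ s)⟫ * this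
  · rw [Real.sin_sub]
    linear_combination Real.sin β₁ * e1 - Real.cos β₁ * e2 -
      ⟪conormal c₁ n₁ s, deriv c₂ (s₂ s)⟫ * this

/-- The relative torsion of the second curve with respect to the reflected normal. -/
lemma relativeTorsion_foldedNormal (hs : s ∈ I₁) (hne₁ : normalCurvature c₁ n₁ s ≠ 0)
    (hne₂ : normalCurvature c₂ n₂ (s₂ s) ≠ 0)
    (hk₁ : DifferentiableAt ℝ (normalCurvature c₁ n₁) s)
    (ht₁ : DifferentiableAt ℝ (relativeTorsion c₁ n₁) s)
    (hkg : DifferentiableAt ℝ (geodesicCurvature c₂ n₂) (s₂ s))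
    (hkn : DifferentiableAt ℝ (normalCurvature c₂ n₂) (s₂ s)) {r : E3} {β₁ β₂ : ℝ}
    (h₁ : IsAngle (deriv c₁ s) (conormal c₁ n₁ s) r β₁)
    (h₂ : IsAngle (deriv c₂ (s₂ s)) (conormal c₂ n₂ (s₂ s)) r β₂) :
    relativeTorsion c₂ (foldedNormal c₂ n₂) (s₂ s) = relativeTorsion c₂ n₂ (s₂ s) -
      2 / (deriv s₂ s ^ 2 *
          (normalCurvature c₂ n₂ (s₂ s) ^ 2 + geodesicCurvature c₂ n₂ (s₂ s) ^ 2)) *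
        (deriv (deriv s₂) s * normalCurvature c₂ n₂ (s₂ s) * geodesicCurvature c₂ n₂ (s₂ s)
          + deriv s₂ s * (normalCurvature c₂ n₂ (s₂ s) *
              deriv (fun t => geodesicCurvature c₂ n₂ (s₂ t)) s
            - relativeTorsion c₂ n₂ (s₂ s) * geodesicCurvature c₂ n₂ (s₂ s) *
              (deriv s₂ s * geodesicCurvature c₂ n₂ (s₂ s) - geodesicCurvature c₁ n₁ s))
          - geodesicCurvature c₂ n₂ (s₂ s) *
            (Real.cos (β₁ - β₂) * deriv (normalCurvature c₁ n₁) s +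
              Real.sin (β₁ - β₂) * deriv (relativeTorsion c₁ n₁) s)) := by
  have hp := h.deriv_ne_zero hs hne₁
  have hk := (curvature_sq_pos hne₂).ne'
  have hk' : normalCurvature c₂ n₂ (s₂ s) ^ 2 + geodesicCurvature c₂ n₂ (s₂ s) ^ 2 ≠ 0 := by
    rwa [add_comm]
  have e1 : deriv (fun t => geodesicCurvature c₂ n₂ (s₂ t)) s =
      deriv (geodesicCurvature c₂ n₂) (s₂ s) * deriv s₂ s :=
    (hkg.hasDerivAt.comp s (h.hasDerivAt hs)).deriv
  have e2 := h.deriv_normalCurvature hs hk₁.hasDerivAt ht₁.hasDerivAt hkn.hasDerivAt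
  obtain ⟨e3, e4⟩ := h.inner_eq_cos_sin hs h₁ h₂
  rw [e3, e4] at e2
  rw [CurvedFolding.relativeTorsion_foldedNormal h.isUnitNormalAlong₂ (h.mapsTo hs) hne₂
    hkg.hasDerivAt hkn.hasDerivAt, e1]
  generalize Real.cos (β₁ - β₂) * deriv (normalCurvature c₁ n₁) s +
    Real.sin (β₁ - β₂) * deriv (relativeTorsion c₁ n₁) s = e at e2 ⊢
  generalize geodesicCurvature c₂ n₂ (s₂ s) = kg at *
  generalize normalCurvature c₂ n₂ (s₂ s) = kn at *
  generalize relativeTorsion c₂ n₂ (s₂ s) = τ at *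
  rw [eq_sub_of_add_eq e2.symm]
  field_simp
  ring

end IsNormalLink

end Formula

end CurvedFolding

/-! ### Folding along the second of two curves linked by rulings -/

theorem mainTheorem3 {X : Type*} [TopologicalSpace X] [T2Space X]
    (pos normal : X → E3)
    (hM : IsDevelopable 3 pos normal)
    (hpar : ∀ p : X, IsParabolicAt pos normal p)
    (γ₁ γ₂ : ℝ → X) (I₁ I₂ : Set ℝ)
    (hγ₁ : IsCurveOn 3 pos γ₁ I₁) (hγ₂ : IsCurveOn 4 pos γ₂ I₂)
    (s₂ : ℝ → ℝ) (hlink : LinkedByRulings pos γ₁ γ₂ I₁ I₂ s₂)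
    (c₁ c₂ n₁ n₂ : ℝ → E3)
    (hc₁ : c₁ = pos ∘ γ₁) (hc₂ : c₂ = pos ∘ γ₂)
    (hn₁ : n₁ = normal ∘ γ₁) (hn₂ : n₂ = normal ∘ γ₂)
    (k1g k1n τ1r k2g k2n τ2r : ℝ → ℝ)
    (hk1g : k1g = geodesicCurvature c₁ n₁) (hk1n : k1n = normalCurvature c₁ n₁)
    (hτ1r : τ1r = relativeTorsion c₁ n₁)
    (hk2g : k2g = geodesicCurvature c₂ n₂) (hk2n : k2n = normalCurvature c₂ n₂)
    (hτ2r : τ2r = relativeTorsion c₂ n₂)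
    (hne₁ : ∀ s ∈ I₁, k1g s ≠ 0 ∧ k1n s ≠ 0)
    (hne₂ : ∀ s ∈ I₂, k2g s ≠ 0 ∧ k2n s ≠ 0) :
    -- the quantities in the formula make sense
    (ContDiffOn ℝ 2 s₂ I₁ ∧ ∀ s ∈ I₁, deriv s₂ s ≠ 0 ∧ DifferentiableAt ℝ k1n s ∧
      DifferentiableAt ℝ τ1r s ∧ DifferentiableAt ℝ (fun t => k2g (s₂ t)) s) ∧
    -- there is a foldline with the geodesic curvature of the second curve
    (∃ g : ℝ → E2, IsFoldline g I₂ k2g) ∧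
    -- along any such foldline, and for either side of it, ...
    ∀ (g : ℝ → E2) (J : Set ℝ) (ε : ℝ), IsOpen J → J.OrdConnected → J ⊆ I₂ →
      IsFoldline g J k2g → IsEmbedding (fun t : J => g t) → (ε = 1 ∨ ε = -1) →
      -- ... a proper fold onto the second curve, consistent with the surface on that side, exists,
      (∃ (A B : Set E2) (F : E2 → E3),
        IsProperFold g c₂ J ε A B F ∧ IsConsistent pos γ₂ g J A F) ∧
      -- ... is unique near the foldline,
      (∀ (A B : Set E2) (F : E2 → E3) (A' B' : Set E2) (F' : E2 → E3),
        IsProperFold g c₂ J ε A B F → IsConsistent pos γ₂ g J A F →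
        IsProperFold g c₂ J ε A' B' F' → IsConsistent pos γ₂ g J A' F' →
        ∀ᶠ x in 𝓝ˢ (g '' J), F x = F' x) ∧
      -- ... and has the following normal curvature and relative torsion on the new side.
      (∀ (A B : Set E2) (F : E2 → E3),
        IsProperFold g c₂ J ε A B F → IsConsistent pos γ₂ g J A F →
        ∀ s ∈ I₁, s₂ s ∈ J →
          DifferentiableAt ℝ (ridgeNormal g J B F) (s₂ s) ∧
          normalCurvature c₂ (ridgeNormal g J B F) (s₂ s) = - k2n (s₂ s) ∧
          ∀ (r : E3) (a β₁ β₂ : ℝ), ‖r‖ = 1 → c₂ (s₂ s) - c₁ s = a • r →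
            IsAngle (deriv c₁ s) (conormal c₁ n₁ s) r β₁ →
            IsAngle (deriv c₂ (s₂ s)) (conormal c₂ n₂ (s₂ s)) r β₂ →
            relativeTorsion c₂ (ridgeNormal g J B F) (s₂ s) =
              τ2r (s₂ s) -
                2 / ((deriv s₂ s) ^ 2 * ((k2n (s₂ s)) ^ 2 + (k2g (s₂ s)) ^ 2)) *
                  (deriv (deriv s₂) s * k2n (s₂ s) * k2g (s₂ s)
                    + deriv s₂ s *
                      (k2n (s₂ s) * deriv (fun t => k2g (s₂ t)) s
                        - τ2r (s₂ s) * k2g (s₂ s) * (deriv s₂ s * k2g (s₂ s) - k1g s))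
                    - k2g (s₂ s) *
                      (Real.cos (β₁ - β₂) * deriv k1n s + Real.sin (β₁ - β₂) * deriv τ1r s))) := by
  subst hc₁ hc₂ hn₁ hn₂ hk1g hk1n hτ1r hk2g hk2n hτ2r
  have hγ₂' : IsCurveOn 3 pos γ₂ I₂ := hγ₂.of_le (by norm_num)
  have hu₁ := hγ₁.isUnitNormalAlong hM
  have hu₂ := hγ₂'.isUnitNormalAlong hM
  have hN₁ := hγ₁.contDiffOn_normal hM
  have hN₂ := hγ₂'.contDiffOn_normal hM
  have hmaps := hlink.bijOn.mapsTo
  have hnn : ∀ s ∈ I₁, (normal ∘ γ₁) s = (normal ∘ γ₂) (s₂ s) := fun s hs => by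
    obtain ⟨σ, hσ, -⟩ := hlink.ruling s hs
    exact hM.normal_eq_of_isRulingSegment hσ
  have hs₂ : ContDiffOn ℝ 2 s₂ I₁ := contDiffOn_of_comp_eq hγ₁.isOpen hγ₂.isOpen hN₁ hN₂
    (fun s hs => hu₂.deriv_normal_ne_zero hs (hne₂ s hs).2) hlink.continuousOn hmaps hnn
  have hL : IsNormalLink (pos ∘ γ₁) (normal ∘ γ₁) (pos ∘ γ₂) (normal ∘ γ₂) I₁ I₂ s₂ :=
    ⟨hu₁, hu₂, hmaps, hs₂, hnn⟩
  have hk1n : ∀ s ∈ I₁, DifferentiableAt ℝ (normalCurvature (pos ∘ γ₁) (normal ∘ γ₁)) s :=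
    fun s hs => ((contDiffOn_normalCurvature (m := 1) hγ₁.isOpen
      (hγ₁.contDiffOn.of_le (by norm_num)) (hN₁.of_le (by norm_num))).contDiffAt
        (hγ₁.isOpen.mem_nhds hs)).differentiableAt (by simp)
  have hτ1 : ∀ s ∈ I₁, DifferentiableAt ℝ (relativeTorsion (pos ∘ γ₁) (normal ∘ γ₁)) s :=
    fun s hs => ((contDiffOn_relativeTorsion (m := 1) hγ₁.isOpen
      (hγ₁.contDiffOn.of_le (by norm_num)) (hN₁.of_le (by norm_num))).contDiffAt
        (hγ₁.isOpen.mem_nhds hs)).differentiableAt (by simp)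
  have hkg2 : ContDiffOn ℝ 2 (geodesicCurvature (pos ∘ γ₂) (normal ∘ γ₂)) I₂ :=
    contDiffOn_geodesicCurvature hγ₂.isOpen (hγ₂.contDiffOn.of_le (by norm_num)) hN₂
  have hkn2 : ContDiffOn ℝ 2 (normalCurvature (pos ∘ γ₂) (normal ∘ γ₂)) I₂ :=
    contDiffOn_normalCurvature hγ₂.isOpen (hγ₂.contDiffOn.of_le (by norm_num)) hN₂
  have hkg2d : ∀ s ∈ I₂, DifferentiableAt ℝ (geodesicCurvature (pos ∘ γ₂) (normal ∘ γ₂)) s :=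
    fun s hs => (hkg2.contDiffAt (hγ₂.isOpen.mem_nhds hs)).differentiableAt (by simp)
  have hkn2d : ∀ s ∈ I₂, DifferentiableAt ℝ (normalCurvature (pos ∘ γ₂) (normal ∘ γ₂)) s :=
    fun s hs => (hkn2.contDiffAt (hγ₂.isOpen.mem_nhds hs)).differentiableAt (by simp)
  refine ⟨⟨hs₂, fun s hs => ⟨hL.deriv_ne_zero hs (hne₁ s hs).2, hk1n s hs, hτ1 s hs,
    ((hkg2d _ (hmaps hs)).hasDerivAt.comp s (hL.hasDerivAt hs)).differentiableAt⟩⟩,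
    exists_isFoldline hγ₂.isOpen hγ₂.ordConnected hkg2, ?_⟩
  intro g J ε hJ _ hJI hg hemb hε
  have hD : IsFoldData g (pos ∘ γ₂) (normal ∘ γ₂) J :=
    ⟨⟨hJ, hu₂.contDiffOn_curve.mono hJI, hu₂.contDiffOn_normal.mono hJI,
      fun s hs => hu₂.tangent_unit s (hJI hs), fun s hs => hu₂.normal_unit s (hJI hs),
      fun s hs => hu₂.tangent_normal s (hJI hs)⟩,
    hγ₂.contDiffOn.mono hJI, hN₂.mono hJI, hg,
    isEmbeddedArc_of_isEmbedding hJ (hg.contDiffOn.of_le (by norm_num)) hg.unit_speed hemb,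
    fun s hs => (hne₂ s (hJI hs)).1, fun s hs => (hne₂ s (hJI hs)).2⟩
  refine ⟨?_, ?_, ?_⟩
  · obtain ⟨V, k, hV, hVI, hk, hkp, hkγ⟩ := hγ₂'.exists_lift hM fun s hs => (hne₂ s hs).2
    exact hD.exists_fold hε
      ⟨V, k, hV, fun s hs => hVI s (hJI hs), hk, hkp, fun s hs => hkγ s (hJI hs)⟩
  · intro A B F A' B' F' hF hcons hF' hcons'
    refine mem_nhdsSet_iff_forall.2 ?_
    rintro _ ⟨s, hs, rfl⟩
    exact hD.eventually_eq hM (fun _ _ => rfl) hε hF hcons hF' hcons' hs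
  · intro A B F hF hcons s hs hsJ
    have hev : ridgeNormal g J B F =ᶠ[𝓝 (s₂ s)] foldedNormal (pos ∘ γ₂) (normal ∘ γ₂) := by
      filter_upwards [hJ.mem_nhds hsJ] with t ht
        using hD.ridgeNormal_eq hM (fun _ _ => rfl) hε hF hcons ht
    have hne := (hne₂ _ (hJI hsJ)).2
    refine ⟨?_, ?_, ?_⟩
    · refine DifferentiableAt.congr_of_eventuallyEq ?_ hev
      exact (hD.isRidgeData_folded.contDiffOn_normal.contDiffAt
        (hJ.mem_nhds hsJ)).differentiableAt (by simp)
    · rw [normalCurvature_congr hev, normalCurvature_foldedNormal hne]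
    · intro r a β₁ β₂ _ _ h₁ h₂
      rw [relativeTorsion_congr hev]
      exact hL.relativeTorsion_foldedNormal hs (hne₁ s hs).2 hne (hk1n s hs) (hτ1 s hs)
        (hkg2d _ (hJI hsJ)) (hkn2d _ (hJI hsJ)) h₁ h₂
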